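/- Let $\mathcal G$ be a finite, connected discrete graph with $V$ vertices and $E$ edges, where loops and parallel edges are allowed. Let $\partial\mathcal G$ be the set of vertices of degree one (loops count twice in the degree) and let $\beta = E - V + 1$. Assigning a length $L(e)\in(0,\infty)$ to every edge $e$ and identifying $e$ with the interval $[0,L(e)]$ yields an associated metric graph $\Gamma$. Let $-\Delta_\Gamma$ be the Laplacian in $L^2(\Gamma)$ with standard (continuity and Kirchhoff) vertex conditions, i.e. $(-\Delta_\Gamma f)_e = -f_e''$ for all $f$ that are continuous on $\Gamma$, are in $H^2$ on each edge, and for which at each vertex the derivatives along all incident edges, taken towards the vertex, sum up to zero. Let $\mu_2(\Gamma)$ be its smallest positive eigenvalue; all eigenfunctions are taken real-valued. Let $\partial\Gamma\subset\Gamma$ be the set of vertices of degree one, and let $\mathcal D_\Gamma\subset\Gamma$ be the doubly connected part, i.e. the set of all points that are part of a cycle (the union of all closed edges that belong to a cycle of $\mathcal G$; loops and pairs of parallel edges count as cycles). Maxima and minima are global. Then: (i) If $|\partial\mathcal G|\ge 1$, then there is an associated metric graph $\Gamma$ such that $\mu_2(\Gamma)$ is simple and the corresponding eigenfunction, with a suitable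 choice of its sign, takes its maximum only on $\partial\Gamma$. (ii) If $|\partial\mathcal G|\ge 2$, then there is an associated metric graph $\Gamma$ such that $\mu_2(\Gamma)$ is simple and the corresponding eigenfunction takes its maximum and its minimum only on $\partial\Gamma$. (iii) If $\beta\ge 1$ and $\mathcal G$ is not a cycle graph (a connected graph in which each vertex has degree two), then there is an associated metric graph $\Gamma$ such that $\mu_2(\Gamma)$ is simple and the corresponding eigenfunction, with a suitable choice of its sign, takes its maximum only in $\mathcal D_\Gamma$. (iv) If $\beta\ge 2$, then there is an associated metric graph $\Gamma$ such that $\mu_2(\Gamma)$ is simple and the corresponding eigenfunction takes its maximum and its minimum only in $\mathcal D_\Gamma$. -/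

import Mathlib

open MeasureTheory Set
open scoped ContDiff

/-- A discrete graph with vertex set `V` and edge set `E`; loops and parallel edges are allowed.
Every edge `e` carries an (arbitrary) orientation, from `o e` to `t e`. -/
structure DiscreteGraph (V E : Type*) where
  /-- the vertex from which the edge originates -/
  o : E → V
  /-- the vertex at which the edge terminates -/
  t : E → V

namespace DiscreteGraph

variable {V E : Type*} (G : DiscreteGraph V E)

/-- The edge `e` joins `u` and `v` (in either direction). -/
def Joins (e : E) (u v : V) : Prop :=
  (G.o e = u ∧ G.t e = v) ∨ (G.o e = v ∧ G.t e = u)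

/-- `G` is non-empty and any two of its vertices are connected by a path. -/
def Connected : Prop :=
  Nonempty V ∧ ∀ u v : V, Relation.ReflTransGen (fun a b => ∃ e, G.Joins e a b) u v

/-- The degree of a vertex; a loop counts twice. -/
def degree [Fintype E] [DecidableEq V] (v : V) : ℕ :=
  (Finset.univ.filter fun e => G.o e = v).card + (Finset.univ.filter fun e => G.t e = v).card

/-- The boundary of `G`: the set of vertices of degree one. -/
def boundary [Fintype V] [Fintype E] [DecidableEq V] : Finset V :=
  Finset.univ.filter fun v => G.degree v = 1

/-- The first Betti number `E - V + 1` (of a connected graph). -/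
def betti (_G : DiscreteGraph V E) [Fintype V] [Fintype E] : ℤ :=
  (Fintype.card E : ℤ) - Fintype.card V + 1

/-- A cycle graph: a connected graph all of whose vertices have degree two. -/
def IsCycleGraph [Fintype E] [DecidableEq V] : Prop :=
  G.Connected ∧ ∀ v, G.degree v = 2

/-- A cycle in `G` with `n + 1` edges: pairwise different vertices `v 0, …, v n` and pairwise
different edges `c 0, …, c n`, where `c i` joins `v i` to `v (i + 1)`, the indices being taken
modulo `n + 1`. So loops are the cycles with one edge, and a pair of parallel edges forms a cycle
with two edges. -/
def IsCycle {n : ℕ} (v : Fin (n + 1) → V) (c : Fin (n + 1) → E) : Prop :=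
  Function.Injective v ∧ Function.Injective c ∧ ∀ i, G.Joins (c i) (v i) (v (i + 1))

/-- The edge `e` is part of a cycle. -/
def InCycle (e : E) : Prop :=
  ∃ (n : ℕ) (v : Fin (n + 1) → V) (c : Fin (n + 1) → E), G.IsCycle v c ∧ ∃ i, c i = e

end DiscreteGraph

/-- A metric graph associated with the discrete graph `G`: every edge `e` has a length
`len e ∈ (0, ∞)` and is identified with the interval `[0, len e]`. -/
structure MetricGraph {V E : Type*} (G : DiscreteGraph V E) where
  /-- the length of an edge -/
  len : E → ℝ
  len_pos : ∀ e, 0 < len e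

/-- `f` and `g` are in `L²(0, ℓ)` and `g` is the weak derivative of `f` on `(0, ℓ)`. -/
def IsWeakDeriv (ℓ : ℝ) (f g : ℝ → ℝ) : Prop :=
  MemLp f 2 (volume.restrict (Ioo 0 ℓ)) ∧ MemLp g 2 (volume.restrict (Ioo 0 ℓ)) ∧
    ∀ φ : ℝ → ℝ, ContDiff ℝ ∞ φ → HasCompactSupport φ → tsupport φ ⊆ Ioo 0 ℓ →
      ∫ x in Ioo 0 ℓ, f x * deriv φ x = -∫ x in Ioo 0 ℓ, g x * φ x

/-- `f` belongs to the Sobolev space `H^k(0, ℓ)`, where `H^0 = L²`. -/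
def MemSobolev (ℓ : ℝ) : ℕ → (ℝ → ℝ) → Prop
  | 0, f => MemLp f 2 (volume.restrict (Ioo 0 ℓ))
  | k + 1, f => ∃ g, IsWeakDeriv ℓ f g ∧ MemSobolev ℓ k g

theorem IsWeakDeriv.zero (ℓ : ℝ) : IsWeakDeriv ℓ (fun _ => 0) (fun _ => 0) :=
  ⟨MemLp.zero, MemLp.zero, fun φ _ _ _ => by simp⟩

theorem IsWeakDeriv.integrable_mul {ℓ : ℝ} {f φ : ℝ → ℝ}
    (hf : MemLp f 2 (volume.restrict (Ioo 0 ℓ))) (hφ : Continuous φ)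
    (hc : HasCompactSupport φ) :
    Integrable (fun x => f x * φ x) (volume.restrict (Ioo 0 ℓ)) :=
  MemLp.integrable_mul (q := 2) hf ((hφ.memLp_of_hasCompactSupport hc).restrict _)

theorem IsWeakDeriv.add {ℓ : ℝ} {f₁ g₁ f₂ g₂ : ℝ → ℝ} (h₁ : IsWeakDeriv ℓ f₁ g₁)
    (h₂ : IsWeakDeriv ℓ f₂ g₂) :
    IsWeakDeriv ℓ (fun x => f₁ x + f₂ x) (fun x => g₁ x + g₂ x) := by
  refine ⟨h₁.1.add h₂.1, h₁.2.1.add h₂.2.1, fun φ hφ hc hs => ?_⟩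
  have hd : Continuous (deriv φ) := hφ.continuous_deriv (by simp)
  simp only [add_mul]
  rw [integral_add (integrable_mul h₁.1 hd hc.deriv) (integrable_mul h₂.1 hd hc.deriv),
    integral_add (integrable_mul h₁.2.1 hφ.continuous hc)
      (integrable_mul h₂.2.1 hφ.continuous hc),
    h₁.2.2 φ hφ hc hs, h₂.2.2 φ hφ hc hs]
  ring

theorem IsWeakDeriv.const_mul {ℓ : ℝ} {f g : ℝ → ℝ} (c : ℝ) (h : IsWeakDeriv ℓ f g) :
    IsWeakDeriv ℓ (fun x => c * f x) (fun x => c * g x) := by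
  refine ⟨h.1.const_mul c, h.2.1.const_mul c, fun φ hφ hc hs => ?_⟩
  simp only [mul_assoc]
  rw [integral_const_mul, integral_const_mul, h.2.2 φ hφ hc hs]
  ring

theorem MemSobolev.zero (ℓ : ℝ) (k : ℕ) : MemSobolev ℓ k (fun _ => 0) := by
  induction k with
  | zero => exact MemLp.zero
  | succ k ih => exact ⟨_, IsWeakDeriv.zero ℓ, ih⟩

theorem MemSobolev.add {ℓ : ℝ} {k : ℕ} {f g : ℝ → ℝ} (hf : MemSobolev ℓ k f)
    (hg : MemSobolev ℓ k g) : MemSobolev ℓ k (fun x => f x + g x) := by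
  induction k generalizing f g with
  | zero => exact MemLp.add hf hg
  | succ k ih =>
    obtain ⟨f', hf, hf'⟩ := hf
    obtain ⟨g', hg, hg'⟩ := hg
    exact ⟨_, hf.add hg, ih hf' hg'⟩

theorem MemSobolev.const_mul {ℓ : ℝ} {k : ℕ} {f : ℝ → ℝ} (c : ℝ) (hf : MemSobolev ℓ k f) :
    MemSobolev ℓ k (fun x => c * f x) := by
  induction k generalizing f with
  | zero => exact MemLp.const_mul hf c
  | succ k ih =>
    obtain ⟨f', hf, hf'⟩ := hf
    exact ⟨_, hf.const_mul c, ih hf'⟩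

namespace MetricGraph

variable {V E : Type*} {G : DiscreteGraph V E}

/-- The points of the metric graph `Γ`: the vertices, and the interior points of the edges. This is
the set obtained from the intervals `[0, len e]` by gluing their endpoints at the vertices. -/
inductive Point (Γ : MetricGraph G) where
  | vertex (v : V) : Point Γ
  | inner (e : E) (x : ℝ) (hx : x ∈ Ioo 0 (Γ.len e)) : Point Γ

variable (Γ : MetricGraph G)

open Classical in
/-- The point of `Γ` that corresponds to the point `x ∈ [0, len e]` of the edge `e`: the endpoint
`0` is the vertex `o e`, the endpoint `len e` is the vertex `t e`. (This is used only for
`x ∈ [0, len e]`.) -/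
noncomputable def edgePoint (e : E) (x : ℝ) : Γ.Point :=
  if hx : x ∈ Ioo 0 (Γ.len e) then .inner e x hx
  else if x ≤ 0 then .vertex (G.o e) else .vertex (G.t e)

/-- The restriction `f_e` of a function `f` on `Γ` to the edge `e`, as a function on
`[0, len e]`. -/
noncomputable def onEdge (f : Γ.Point → ℝ) (e : E) : ℝ → ℝ := fun x => f (Γ.edgePoint e x)

/-- The boundary of `Γ`: the vertices of degree one. -/
def boundary [Fintype V] [Fintype E] [DecidableEq V] : Set Γ.Point :=
  {p | ∃ v ∈ G.boundary, p = .vertex v}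

/-- The doubly connected part of `Γ`: all points that are part of a cycle. -/
def doublyConnectedPart : Set Γ.Point :=
  {p | ∃ e, G.InCycle e ∧ ∃ x ∈ Icc 0 (Γ.len e), p = Γ.edgePoint e x}

/-- `f ∈ C(Γ)`: `f` is continuous on each edge. That the values at a vertex agree for all incident
edges is part of `f` being a function on the points of `Γ`. -/
def MemC (f : Γ.Point → ℝ) : Prop :=
  ∀ e, ContinuousOn (Γ.onEdge f e) (Icc 0 (Γ.len e))

/-- `f ∈ H̃^k(Γ)`: the restriction of `f` to each edge `e` is in `H^k(0, len e)`. -/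
def MemSobolevTilde (k : ℕ) (f : Γ.Point → ℝ) : Prop :=
  ∀ e, MemSobolev (Γ.len e) k (Γ.onEdge f e)

/-- `f ∈ H¹(Γ) = H̃¹(Γ) ∩ C(Γ)`. -/
def MemH1 (f : Γ.Point → ℝ) : Prop := Γ.MemSobolevTilde 1 f ∧ Γ.MemC f

/-- For functions `p e` on `[0, len e]`, the sum over the edges terminating at `v` of their values
at `len e`, minus the sum over the edges originating from `v` of their values at `0`. -/
def vertexSum [Fintype E] [DecidableEq V] (p : E → ℝ → ℝ) (v : V) : ℝ :=
  (∑ e with G.t e = v, p e (Γ.len e)) - ∑ e with G.o e = v, p e 0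

/-- The Kirchhoff condition `∂_ν f(v) = 0` at all vertices. For `f ∈ H̃²(Γ)` the derivative `f_e'` is
in `H¹(0, len e)`, and its values at the endpoints are those of its continuous representative
`p e` on `[0, len e]`, which is unique. -/
def Kirchhoff [Fintype E] [DecidableEq V] (f : Γ.Point → ℝ) : Prop :=
  ∃ p : E → ℝ → ℝ, (∀ e, ContinuousOn (p e) (Icc 0 (Γ.len e)) ∧
    IsWeakDeriv (Γ.len e) (Γ.onEdge f e) (p e)) ∧ ∀ v, Γ.vertexSum p v = 0

/-- `f` is in the domain of the Laplacian with standard (continuity and Kirchhoff) vertex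
conditions. An element of `H¹(Γ) ⊆ C(Γ)` is identified with its continuous representative. -/
def MemDom [Fintype E] [DecidableEq V] (f : Γ.Point → ℝ) : Prop :=
  Γ.MemH1 f ∧ Γ.MemSobolevTilde 2 f ∧ Γ.Kirchhoff f

/-- `-f_e'' = h_e` in `L²(0, len e)` for all edges `e`. -/
def NegSecondDeriv (f h : Γ.Point → ℝ) : Prop :=
  ∀ e, ∃ g, IsWeakDeriv (Γ.len e) (Γ.onEdge f e) g ∧
    IsWeakDeriv (Γ.len e) g (fun x => -Γ.onEdge h e x)

/-- The space of all real-valued `f` in the domain of the Laplacian with `-Δ_Γ f = μ f`. -/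
noncomputable def eigenspace [Fintype E] [DecidableEq V] (μ : ℝ) :
    Submodule ℝ (Γ.Point → ℝ) where
  carrier := {f | Γ.MemDom f ∧ Γ.NegSecondDeriv f (μ • f)}
  zero_mem' := by
    refine ⟨⟨⟨fun e => MemSobolev.zero _ _, fun e => continuousOn_const⟩,
      fun e => MemSobolev.zero _ _, fun _ _ => 0,
      fun e => ⟨continuousOn_const, IsWeakDeriv.zero _⟩, fun v => by simp [vertexSum]⟩,
      fun e => ⟨_, IsWeakDeriv.zero _, ?_⟩⟩
    simpa [onEdge] using IsWeakDeriv.zero (Γ.len e)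
  add_mem' := by
    rintro f₁ f₂ ⟨⟨⟨a₁, b₁⟩, c₁, p₁, d₁, k₁⟩, l₁⟩ ⟨⟨⟨a₂, b₂⟩, c₂, p₂, d₂, k₂⟩, l₂⟩
    refine ⟨⟨⟨fun e => (a₁ e).add (a₂ e), fun e => (b₁ e).add (b₂ e)⟩,
      fun e => (c₁ e).add (c₂ e), fun e x => p₁ e x + p₂ e x,
      fun e => ⟨(d₁ e).1.add (d₂ e).1, (d₁ e).2.add (d₂ e).2⟩, fun v => ?_⟩, fun e => ?_⟩
    · have h₁ := k₁ v
      have h₂ := k₂ v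
      simp only [vertexSum, Finset.sum_add_distrib] at h₁ h₂ ⊢
      linarith
    · obtain ⟨g₁, u₁, w₁⟩ := l₁ e
      obtain ⟨g₂, u₂, w₂⟩ := l₂ e
      refine ⟨_, u₁.add u₂, ?_⟩
      convert w₁.add w₂ using 2
      simp [onEdge]
      ring
  smul_mem' := by
    rintro c f ⟨⟨⟨a₁, b₁⟩, c₁, p₁, d₁, k₁⟩, l₁⟩
    refine ⟨⟨⟨fun e => (a₁ e).const_mul c, fun e => (b₁ e).const_smul c⟩,
      fun e => (c₁ e).const_mul c, fun e x => c * p₁ e x,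
      fun e => ⟨(d₁ e).1.const_smul c, (d₁ e).2.const_mul c⟩, fun v => ?_⟩, fun e => ?_⟩
    · have h₁ := k₁ v
      simp only [vertexSum, ← Finset.mul_sum] at h₁ ⊢
      rw [← mul_sub, h₁, mul_zero]
    · obtain ⟨g₁, u₁, w₁⟩ := l₁ e
      refine ⟨_, u₁.const_mul c, ?_⟩
      convert w₁.const_mul c using 2
      simp [onEdge]
      ring

/-- `μ` is the smallest positive eigenvalue of `-Δ_Γ`. For connected `Γ` the eigenvalue `0` is
simple (with the constant eigenfunctions), so this is the second eigenvalue `μ₂(Γ)`. -/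
def IsMu2 [Fintype E] [DecidableEq V] (μ : ℝ) : Prop :=
  IsLeast {lam : ℝ | 0 < lam ∧ Γ.eigenspace lam ≠ ⊥} μ

/-- The eigenvalue `μ` of `-Δ_Γ` is simple. -/
def IsSimpleEigenvalue [Fintype E] [DecidableEq V] (μ : ℝ) : Prop :=
  Module.finrank ℝ (Γ.eigenspace μ) = 1

/-- `ψ` takes its (global) maximum on `Γ`, and only at points of `S`. -/
def TakesMaxOnlyIn (ψ : Γ.Point → ℝ) (S : Set Γ.Point) : Prop :=
  {p | ∀ q, ψ q ≤ ψ p}.Nonempty ∧ {p | ∀ q, ψ q ≤ ψ p} ⊆ S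

/-- `ψ` takes its (global) minimum on `Γ`, and only at points of `S`. -/
def TakesMinOnlyIn (ψ : Γ.Point → ℝ) (S : Set Γ.Point) : Prop :=
  {p | ∀ q, ψ p ≤ ψ q}.Nonempty ∧ {p | ∀ q, ψ p ≤ ψ q} ⊆ S

end MetricGraph

/-! Two edges `e₁`, `e₂` are chosen, each either pendant (`n = 1`) or on a cycle (`n = 2`), such
that the remaining edges connect a vertex set `S`. The remaining edges get a tiny length `ε`, `e₁`
gets `n₁ · 3π/4` and `e₂` gets `n₂ θ`. As `ε → 0`, `S` shrinks to a point carrying two pendant edges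
or loops. A loop with an even function on it counts as two pendant edges of half its length, and the
function with value 1 at the centre that is a cosine on every branch has eigenvalue 1 iff `n₁ tan
(3π/4) + n₂ tan θ = 0`, that is `tan θ = n₁ / n₂`. It falls below zero on the long `e₁` and exceeds
1 on `e₂`; the minimum is at the tip of `e₁` (leaf or midpoint), the maximum at the tip of `e₂`.

For positive `ε` the eigenvalue is kept equal to 1 and `θ` is adjusted. Solutions of `-u'' = u` on
the edges are determined by their vertex values, and the Kirchhoff conditions say that these values
lie in the kernel of a quadratic form (`edgeSol_mem_eigenspace`). The form, made nonnegative in the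
variable of a leaf `u₁`, is nonnegative at `θ = arctan (1/4)` (`modForm_ge`) and takes a value `≤ 0`
at `θ = π/4`, where `n₁ ≤ n₂` is needed (`exists_contForm_nonpos`). By the intermediate value
theorem some `θ` in between gives a nonnegative form with a kernel (`exists_nonneg_form_with_zero`,
`exists_vertex_values`). The kernel vector is nearly constant on `S`, so the shape of the limit
persists (`exists_metricGraph`).

That 1 is the smallest positive eigenvalue and simple is a min-max argument: the form `∫ g'² - g²`
is coercive on functions vanishing at two suitable points (`coercive`, by Jacobi's comparison with
cosines), so constants and the eigenfunction exhaust the eigenvalues up to 1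
(`eigen_eq_smul_of_coercive`).

Two leaves give (ii), a leaf as `e₁` and a cycle edge as `e₂` give (i) and (iii), two edges outside
a spanning set give (iv). Degree counting reduces (i) and (iii) to these cases; the graph with one
edge and two leaves is treated directly. -/

/-! ### Weak derivatives on an interval. -/

/-- A test function on `(0, ℓ)`. -/
def IsTest (ℓ : ℝ) (φ : ℝ → ℝ) : Prop :=
  ContDiff ℝ ∞ φ ∧ HasCompactSupport φ ∧ tsupport φ ⊆ Ioo 0 ℓ

theorem IsTest.deriv {ℓ : ℝ} {φ : ℝ → ℝ} (h : IsTest ℓ φ) : IsTest ℓ (deriv φ) :=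
  ⟨(contDiff_infty_iff_deriv.1 h.1).2, h.2.1.deriv, (tsupport_deriv_subset).trans h.2.2⟩

theorem IsTest.eq_zero_of_notMem {ℓ : ℝ} {φ : ℝ → ℝ} (h : IsTest ℓ φ) {x : ℝ}
    (hx : x ∉ Ioo 0 ℓ) : φ x = 0 :=
  image_eq_zero_of_notMem_tsupport fun hx' => hx (h.2.2 hx')

theorem IsTest.exists_Icc {ℓ : ℝ} {φ : ℝ → ℝ} (hℓ : 0 < ℓ) (h : IsTest ℓ φ) :
    ∃ a b, 0 < a ∧ a ≤ b ∧ b < ℓ ∧ ∀ x, x ∉ Icc a b → φ x = 0 := by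
  rcases (tsupport φ).eq_empty_or_nonempty with he | hne
  · refine ⟨ℓ / 2, ℓ / 2, by positivity, le_rfl, by linarith, fun x _ => ?_⟩
    exact image_eq_zero_of_notMem_tsupport (by simp [he])
  · obtain ⟨a, ha⟩ := h.2.1.isCompact.exists_isLeast hne
    obtain ⟨b, hb⟩ := h.2.1.isCompact.exists_isGreatest hne
    exact ⟨a, b, (h.2.2 ha.1).1, ha.2 hb.1, (h.2.2 hb.1).2, fun x hx =>
      image_eq_zero_of_notMem_tsupport fun hx' => hx ⟨ha.2 hx', hb.2 hx'⟩⟩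

/-- The primitive starting at 0 vanishes to the left of the support of `η`, and also to its right
because the total integral is zero. -/
theorem IsTest.exists_primitive {ℓ : ℝ} {η : ℝ → ℝ} (hℓ : 0 < ℓ) (h : IsTest ℓ η)
    (h0 : ∫ x, η x = 0) : ∃ φ, IsTest ℓ φ ∧ _root_.deriv φ = η := by
  obtain ⟨a, b, ha, hab, hb, hz⟩ := h.exists_Icc hℓ
  set φ : ℝ → ℝ := fun x => ∫ t in (0 : ℝ)..x, η t with hφ
  have hc : Continuous η := h.1.continuous
  have hd : ∀ x, HasDerivAt φ (η x) x := fun x =>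
    intervalIntegral.integral_hasDerivAt_right (hc.intervalIntegrable _ _)
      hc.aestronglyMeasurable.stronglyMeasurableAtFilter hc.continuousAt
  have hderiv : _root_.deriv φ = η := funext fun x => (hd x).deriv
  have hsupp : ∀ x, x ∉ Icc a b → φ x = 0 := by
    intro x hx
    by_cases hxa : x < a
    · have : φ x = ∫ t in (0 : ℝ)..x, (0 : ℝ) := by
        refine intervalIntegral.integral_congr fun t ht => hz t fun ht' => ?_
        have := ht.2
        rcases le_sup_iff.1 this with h1 | h1 <;> linarith [ht'.1]
      simpa using this
    · have hxb : b < x := by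
        by_contra hxb
        exact hx ⟨not_lt.1 hxa, not_lt.1 hxb⟩
      rw [← h0]
      refine intervalIntegral.integral_eq_integral_of_support_subset fun t ht => ?_
      have : t ∈ Icc a b := by
        by_contra hcon
        exact ht (hz t hcon)
      exact ⟨ha.trans_le this.1, this.2.trans hxb.le⟩
  have hts : tsupport φ ⊆ Icc a b := by
    refine closure_minimal (fun x hx => ?_) isClosed_Icc
    by_contra hcon
    exact hx (hsupp x hcon)
  refine ⟨φ, ⟨?_, ?_, ?_⟩, hderiv⟩
  · rw [contDiff_infty_iff_deriv, hderiv]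
    exact ⟨fun x => (hd x).differentiableAt, h.1⟩
  · exact HasCompactSupport.of_support_subset_isCompact isCompact_Icc
      (subset_closure.trans hts)
  · exact hts.trans fun x hx => ⟨ha.trans_le hx.1, hx.2.trans_lt hb⟩

theorem exists_isTest_integral_eq_one {ℓ : ℝ} (hℓ : 0 < ℓ) :
    ∃ χ, IsTest ℓ χ ∧ ∫ x, χ x = 1 := by
  let B : ContDiffBump (ℓ / 2) := ⟨ℓ / 8, ℓ / 4, by positivity, by linarith⟩
  refine ⟨B.normed volume, ⟨B.contDiff_normed, B.hasCompactSupport_normed, ?_⟩, B.integral_normed⟩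
  rw [B.tsupport_normed_eq, Real.closedBall_eq_Icc]
  intro x hx
  simp only [B, mem_Icc, mem_Ioo] at hx ⊢
  constructor <;> linarith [hx.1, hx.2]

theorem setIntegral_Ioo_eq_integral_of_isTest {ℓ : ℝ} {φ : ℝ → ℝ} (f : ℝ → ℝ) (h : IsTest ℓ φ) :
    ∫ x in Ioo 0 ℓ, f x * φ x = ∫ x, f x * φ x :=
  setIntegral_eq_integral_of_forall_compl_eq_zero fun x hx => by
    rw [h.eq_zero_of_notMem hx, mul_zero]

/-- The lemma of du Bois-Reymond. -/
theorem ae_eq_const_of_isWeakDeriv_zero {ℓ : ℝ} (hℓ : 0 < ℓ) {u : ℝ → ℝ}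
    (h : IsWeakDeriv ℓ u fun _ => 0) : ∃ c, ∀ᵐ x, x ∈ Ioo 0 ℓ → u x = c := by
  obtain ⟨χ, hχ, hχ1⟩ := exists_isTest_integral_eq_one hℓ
  set c := ∫ x in Ioo 0 ℓ, u x * χ x with hc
  have hcm : MemLp (fun _ : ℝ => c) 2 (volume.restrict (Ioo 0 ℓ)) := memLp_const c
  have huc : MemLp (fun x => u x - c) 2 (volume.restrict (Ioo 0 ℓ)) := h.1.sub hcm
  have huI : IntegrableOn (fun x => u x - c) (Ioo 0 ℓ) := huc.integrable (by norm_num)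
  have key := isOpen_Ioo.ae_eq_zero_of_integral_contDiff_smul_eq_zero (U := Ioo 0 ℓ)
    (μ := volume) (f := fun x => u x - c) huI.locallyIntegrableOn ?_
  · exact ⟨c, key.mono fun x hx hx' => sub_eq_zero.1 (hx hx')⟩
  intro ψ hψ hψc hψs
  have hψt : IsTest ℓ ψ := ⟨hψ, hψc, hψs⟩
  set m := ∫ x, ψ x with hm
  -- Subtracting `m χ` removes the mean of `ψ`, so that the difference is the derivative of a test
  -- function.
  have hηt : IsTest ℓ (fun x => ψ x - m * χ x) := by
    refine ⟨hψ.sub (contDiff_const.mul hχ.1), ?_, ?_⟩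
    · exact hψc.sub (hχ.2.1.mul_left)
    · refine (tsupport_sub ψ (fun x => m * χ x)).trans (union_subset hψs ?_)
      exact (tsupport_mul_subset_right).trans hχ.2.2
  have iψ : Integrable ψ := hψ.continuous.integrable_of_hasCompactSupport hψc
  have iχ : Integrable χ := hχ.1.continuous.integrable_of_hasCompactSupport hχ.2.1
  have hη0 : ∫ x, (ψ x - m * χ x) = 0 := by
    rw [integral_sub iψ (iχ.const_mul m), integral_const_mul, hχ1, mul_one, sub_self]
  obtain ⟨φ, hφ, hφd⟩ := hηt.exists_primitive hℓ hη0
  have h2 := h.2.2 φ hφ.1 hφ.2.1 hφ.2.2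
  rw [hφd] at h2
  have iuψ := IsWeakDeriv.integrable_mul h.1 hψ.continuous hψc
  have iuχ := IsWeakDeriv.integrable_mul h.1 hχ.1.continuous hχ.2.1
  have e1 : ∫ x in Ioo 0 ℓ, u x * (ψ x - m * χ x) = (∫ x in Ioo 0 ℓ, u x * ψ x) - m * c := by
    rw [hc, ← integral_const_mul, ← integral_sub iuψ (iuχ.const_mul m)]
    congr 1
    ext x
    ring
  have e2 : ∫ x, ψ x • (u x - c) = ∫ x in Ioo 0 ℓ, (u x - c) * ψ x := by
    rw [setIntegral_Ioo_eq_integral_of_isTest _ hψt]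
    congr 1
    ext x
    simp [mul_comm]
  have e3 : ∫ x in Ioo 0 ℓ, (u x - c) * ψ x = (∫ x in Ioo 0 ℓ, u x * ψ x) - c * m := by
    have : m = ∫ x in Ioo 0 ℓ, ψ x := by
      have := setIntegral_Ioo_eq_integral_of_isTest (fun _ => 1) hψt
      simpa using this.symm
    rw [this, ← integral_const_mul, ← integral_sub iuψ (iψ.integrableOn.const_mul c)]
    congr 1
    ext x
    ring
  rw [e2, e3]
  rw [e1] at h2
  simp at h2
  linarith

/-- A continuous function whose restriction to `(0, ℓ)` has the weak derivative zero is constant. -/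
theorem eqOn_const_of_isWeakDeriv_zero {ℓ : ℝ} (hℓ : 0 < ℓ) {u : ℝ → ℝ}
    (hu : ContinuousOn u (Ioo 0 ℓ)) (h : IsWeakDeriv ℓ u fun _ => 0) :
    ∃ c, ∀ x ∈ Ioo 0 ℓ, u x = c := by
  obtain ⟨c, hc⟩ := ae_eq_const_of_isWeakDeriv_zero hℓ h
  refine ⟨c, Measure.eqOn_Ioo_of_ae_eq (μ := volume) (g := fun _ => c) ?_ hu continuousOn_const⟩
  exact (ae_restrict_iff' measurableSet_Ioo).2 hc

theorem memLp_restrict_Ioo_of_continuous {ℓ : ℝ} {f : ℝ → ℝ} (hf : Continuous f) :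
    MemLp f 2 (volume.restrict (Ioo 0 ℓ)) := by
  obtain ⟨C, hC⟩ := isCompact_Icc.exists_bound_of_continuousOn (s := Icc 0 ℓ) hf.continuousOn
  refine MemLp.of_bound hf.aestronglyMeasurable C ?_
  exact (ae_restrict_iff' measurableSet_Ioo).2
    (.of_forall fun x hx => hC x (Ioo_subset_Icc_self hx))

theorem IsWeakDeriv.congr {ℓ : ℝ} {f f' g g' : ℝ → ℝ} (h : IsWeakDeriv ℓ f g)
    (hf : ∀ x ∈ Ioo 0 ℓ, f x = f' x) (hg : ∀ x ∈ Ioo 0 ℓ, g x = g' x) : IsWeakDeriv ℓ f' g' := by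
  have hf1 : f =ᵐ[volume.restrict (Ioo 0 ℓ)] f' :=
    (ae_restrict_iff' measurableSet_Ioo).2 (.of_forall hf)
  have hg1 : g =ᵐ[volume.restrict (Ioo 0 ℓ)] g' :=
    (ae_restrict_iff' measurableSet_Ioo).2 (.of_forall hg)
  refine ⟨h.1.ae_eq hf1, h.2.1.ae_eq hg1, fun φ a b c => ?_⟩
  have h1 : ∫ x in Ioo 0 ℓ, f x * deriv φ x = ∫ x in Ioo 0 ℓ, f' x * deriv φ x :=
    setIntegral_congr_fun measurableSet_Ioo fun x hx => by simp only [hf x hx]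
  have h2 : ∫ x in Ioo 0 ℓ, g x * φ x = ∫ x in Ioo 0 ℓ, g' x * φ x :=
    setIntegral_congr_fun measurableSet_Ioo fun x hx => by simp only [hg x hx]
  rw [← h1, ← h2]
  exact h.2.2 φ a b c

theorem isWeakDeriv_of_hasDerivAt {ℓ : ℝ} {F F' : ℝ → ℝ} (hF : ∀ x, HasDerivAt F (F' x) x)
    (hF' : Continuous F') : IsWeakDeriv ℓ F F' := by
  have hFc : Continuous F := continuous_iff_continuousAt.2 fun x => (hF x).continuousAt
  refine ⟨memLp_restrict_Ioo_of_continuous hFc, memLp_restrict_Ioo_of_continuous hF',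
    fun φ hφ hc hs => ?_⟩
  have ht : IsTest ℓ φ := ⟨hφ, hc, hs⟩
  rw [setIntegral_Ioo_eq_integral_of_isTest _ ht, setIntegral_Ioo_eq_integral_of_isTest _ ht.deriv]
  refine integral_mul_deriv_eq_deriv_mul_of_integrable (fun x _ => hF x)
    (fun x _ => (hφ.differentiable (by simp) x).hasDerivAt) ?_ ?_ ?_
  · exact (hFc.mul (hφ.continuous_deriv (by simp))).integrable_of_hasCompactSupport
      hc.deriv.mul_left
  · exact (hF'.mul hφ.continuous).integrable_of_hasCompactSupport hc.mul_left
  · exact (hFc.mul hφ.continuous).integrable_of_hasCompactSupport hc.mul_left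

/-- A continuous weak derivative is a classical one. -/
theorem IsWeakDeriv.hasDerivAt {ℓ : ℝ} {f p : ℝ → ℝ} (hf : ContinuousOn f (Icc 0 ℓ))
    (hp : ContinuousOn p (Icc 0 ℓ)) (h : IsWeakDeriv ℓ f p) {x : ℝ} (hx : x ∈ Ioo 0 ℓ) :
    HasDerivAt f (p x) x := by
  have hℓ : 0 < ℓ := hx.1.trans hx.2
  -- The extension by constants is continuous on the whole line, so its primitive `P` is
  -- differentiable everywhere, and `f - P` has weak derivative zero.
  set p' : ℝ → ℝ := IccExtend hℓ.le (domRestrict (Icc 0 ℓ) p) with hp'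
  have hpc : Continuous p' := (continuousOn_iff_continuous_domRestrict.1 hp).Icc_extend'
  have hpp : ∀ y ∈ Ioo 0 ℓ, p' y = p y := fun y hy => by
    rw [hp', IccExtend_of_mem _ _ (Ioo_subset_Icc_self hy)]; rfl
  set P : ℝ → ℝ := fun y => ∫ t in (0 : ℝ)..y, p' t with hP
  have hd : ∀ y, HasDerivAt P (p' y) y := fun y =>
    intervalIntegral.integral_hasDerivAt_right (hpc.intervalIntegrable _ _)
      hpc.aestronglyMeasurable.stronglyMeasurableAtFilter hpc.continuousAt
  have hPc : Continuous P := continuous_iff_continuousAt.2 fun y => (hd y).continuousAt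
  have hu : IsWeakDeriv ℓ (fun y => f y + -1 * P y) fun _ => 0 := by
    refine (h.add ((isWeakDeriv_of_hasDerivAt (ℓ := ℓ) hd hpc).const_mul (-1))).congr
      (fun y _ => rfl) fun y hy => ?_
    rw [hpp y hy]; ring
  obtain ⟨c, hc⟩ := eqOn_const_of_isWeakDeriv_zero hℓ
    ((hf.mono Ioo_subset_Icc_self).add (continuousOn_const.mul hPc.continuousOn)) hu
  rw [← hpp x hx]
  refine ((hd x).const_add c).congr_of_eventuallyEq ?_
  filter_upwards [Ioo_mem_nhds hx.1 hx.2] with y hy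
  have := hc y hy
  simp only [Pi.add_apply, Pi.mul_apply] at this
  linarith

/-- Testing `f` against `φ''` shows that `p` and `g` have the same integral against `φ'`; almost
everywhere uniqueness of weak derivatives is not needed. -/
theorem IsWeakDeriv.of_isWeakDeriv {ℓ : ℝ} {f g p h : ℝ → ℝ} (hp : IsWeakDeriv ℓ f p)
    (hg : IsWeakDeriv ℓ f g) (hh : IsWeakDeriv ℓ g h) : IsWeakDeriv ℓ p h := by
  refine ⟨hp.2.1, hh.2.1, fun φ a b c => ?_⟩
  have ht : IsTest ℓ φ := ⟨a, b, c⟩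
  have h1 := hp.2.2 _ ht.deriv.1 ht.deriv.2.1 ht.deriv.2.2
  have h2 := hg.2.2 _ ht.deriv.1 ht.deriv.2.1 ht.deriv.2.2
  have h3 := hh.2.2 φ a b c
  linarith

/-! ### Classical eigenfunctions, Green's formula and a min-max criterion. -/

namespace MetricGraph

variable {V E : Type*} {G : DiscreteGraph V E} (Γ : MetricGraph G)

theorem edgePoint_zero (e : E) : Γ.edgePoint e 0 = .vertex (G.o e) := by
  simp [edgePoint]

theorem edgePoint_len (e : E) : Γ.edgePoint e (Γ.len e) = .vertex (G.t e) := by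
  simp [edgePoint, Γ.len_pos e]

theorem edgePoint_of_mem (e : E) {x : ℝ} (hx : x ∈ Ioo 0 (Γ.len e)) :
    Γ.edgePoint e x = .inner e x hx := by
  simp only [edgePoint, dif_pos hx]

theorem onEdge_zero (f : Γ.Point → ℝ) (e : E) : Γ.onEdge f e 0 = f (.vertex (G.o e)) := by
  rw [onEdge, edgePoint_zero]

theorem onEdge_len (f : Γ.Point → ℝ) (e : E) :
    Γ.onEdge f e (Γ.len e) = f (.vertex (G.t e)) := by
  rw [onEdge, edgePoint_len]

theorem exists_edgePoint (hc : ∀ v, ∃ e, G.o e = v ∨ G.t e = v) (P : Γ.Point) :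
    ∃ e, ∃ x ∈ Icc 0 (Γ.len e), Γ.edgePoint e x = P := by
  cases P with
  | vertex v =>
    obtain ⟨e, rfl | rfl⟩ := hc v
    · exact ⟨e, 0, ⟨le_rfl, (Γ.len_pos e).le⟩, Γ.edgePoint_zero e⟩
    · exact ⟨e, _, ⟨(Γ.len_pos e).le, le_rfl⟩, Γ.edgePoint_len e⟩
  | inner e x hx => exact ⟨e, x, Ioo_subset_Icc_self hx, Γ.edgePoint_of_mem e hx⟩

/-- The function `g` on `Γ` is continuously differentiable on each edge, with derivative `q`. -/
def IsC1 (g : Γ.Point → ℝ) (q : E → ℝ → ℝ) : Prop :=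
  ∀ e, ContinuousOn (Γ.onEdge g e) (Icc 0 (Γ.len e)) ∧ ContinuousOn (q e) (Icc 0 (Γ.len e)) ∧
    ∀ x ∈ Ioo 0 (Γ.len e), HasDerivAt (Γ.onEdge g e) (q e x) x

/-- `f` is a classical solution of `-f'' = lam f` on each edge with derivative `p`, and satisfies
the Kirchhoff condition. -/
def IsClassicalEigen [Fintype E] [DecidableEq V] (lam : ℝ) (f : Γ.Point → ℝ)
    (p : E → ℝ → ℝ) : Prop :=
  Γ.IsC1 f p ∧ (∀ e, ∀ x ∈ Ioo 0 (Γ.len e), HasDerivAt (p e) (-(lam * Γ.onEdge f e x)) x) ∧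
    ∀ v, Γ.vertexSum p v = 0

/-- The derivative in the Kirchhoff condition and the one in the eigenvalue equation come from
separate existential statements; `IsWeakDeriv.of_isWeakDeriv` transfers the equation to the former,
which is continuous. -/
theorem exists_isClassicalEigen [Fintype E] [DecidableEq V] {lam : ℝ} {f : Γ.Point → ℝ}
    (hf : f ∈ Γ.eigenspace lam) : ∃ p, Γ.IsClassicalEigen lam f p := by
  obtain ⟨⟨⟨-, hc⟩, -, p, hp, hk⟩, hn⟩ := hf
  refine ⟨p, fun e => ⟨hc e, (hp e).1, fun x hx => (hp e).2.hasDerivAt (hc e) (hp e).1 hx⟩,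
    fun e x hx => ?_, hk⟩
  obtain ⟨g, hg, hg'⟩ := hn e
  refine IsWeakDeriv.hasDerivAt (p := fun x => -(lam * Γ.onEdge f e x)) (hp e).1 ?_ ?_ hx
  · exact (continuousOn_const.mul (hc e)).neg
  · exact (hp e).2.of_isWeakDeriv hg hg'

/-- The bilinear form `∑ₑ ∫ Fₑ Hₑ` on families of functions on the edges. -/
noncomputable def ip [Fintype E] (F H : E → ℝ → ℝ) : ℝ :=
  ∑ e, ∫ x in (0 : ℝ)..Γ.len e, F e x * H e x

/-- A family of functions which are continuous on the edges. -/
def EdgeCont (F : E → ℝ → ℝ) : Prop := ∀ e, ContinuousOn (F e) (Icc 0 (Γ.len e))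

variable {Γ}

theorem EdgeCont.add {F H : E → ℝ → ℝ} (hF : Γ.EdgeCont F) (hH : Γ.EdgeCont H) :
    Γ.EdgeCont (F + H) := fun e => (hF e).add (hH e)

theorem EdgeCont.smul {F : E → ℝ → ℝ} (hF : Γ.EdgeCont F) (c : ℝ) :
    Γ.EdgeCont (c • F) := fun e => (hF e).const_smul c

theorem EdgeCont.intervalIntegrable_mul {F H : E → ℝ → ℝ} (hF : Γ.EdgeCont F)
    (hH : Γ.EdgeCont H) (e : E) :
    IntervalIntegrable (fun x => F e x * H e x) volume 0 (Γ.len e) := by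
  refine ContinuousOn.intervalIntegrable ?_
  rw [uIcc_of_le (Γ.len_pos e).le]
  exact (hF e).mul (hH e)

theorem ip_comm [Fintype E] (F H : E → ℝ → ℝ) : Γ.ip F H = Γ.ip H F := by
  simp only [ip, mul_comm]

theorem ip_smul_left [Fintype E] (c : ℝ) (F H : E → ℝ → ℝ) :
    Γ.ip (c • F) H = c * Γ.ip F H := by
  simp only [ip, Pi.smul_apply, smul_eq_mul, mul_assoc, intervalIntegral.integral_const_mul,
    Finset.mul_sum]

theorem ip_smul_right [Fintype E] (c : ℝ) (F H : E → ℝ → ℝ) :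
    Γ.ip F (c • H) = c * Γ.ip F H := by
  rw [ip_comm, ip_smul_left, ip_comm]

theorem ip_add_left [Fintype E] {F₁ F₂ H : E → ℝ → ℝ} (h₁ : Γ.EdgeCont F₁)
    (h₂ : Γ.EdgeCont F₂) (hH : Γ.EdgeCont H) :
    Γ.ip (F₁ + F₂) H = Γ.ip F₁ H + Γ.ip F₂ H := by
  simp only [ip, ← Finset.sum_add_distrib]
  refine Finset.sum_congr rfl fun e _ => ?_
  rw [← intervalIntegral.integral_add (h₁.intervalIntegrable_mul hH e)
    (h₂.intervalIntegrable_mul hH e)]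
  simp only [Pi.add_apply, add_mul]

theorem ip_add_right [Fintype E] {F₁ F₂ H : E → ℝ → ℝ} (h₁ : Γ.EdgeCont F₁)
    (h₂ : Γ.EdgeCont F₂) (hH : Γ.EdgeCont H) :
    Γ.ip H (F₁ + F₂) = Γ.ip H F₁ + Γ.ip H F₂ := by
  rw [ip_comm, ip_add_left h₁ h₂ hH, ip_comm F₁, ip_comm F₂]

theorem ip_self_nonneg [Fintype E] (F : E → ℝ → ℝ) : 0 ≤ Γ.ip F F :=
  Finset.sum_nonneg fun e _ =>
    intervalIntegral.integral_nonneg (Γ.len_pos e).le fun _ _ => mul_self_nonneg _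

theorem EdgeCont.eq_zero_of_ip_self [Fintype E] {F : E → ℝ → ℝ} (hF : Γ.EdgeCont F)
    (h : Γ.ip F F = 0) (e : E) {x : ℝ} (hx : x ∈ Icc 0 (Γ.len e)) : F e x = 0 := by
  have h1 := (Finset.sum_eq_zero_iff_of_nonneg fun e _ =>
    intervalIntegral.integral_nonneg (Γ.len_pos e).le fun x _ =>
      mul_self_nonneg (F e x)).1 h e (Finset.mem_univ _)
  by_contra hne
  have := intervalIntegral.integral_pos (Γ.len_pos e) ((hF e).mul (hF e))
    (fun x _ => mul_self_nonneg (F e x)) ⟨x, hx, mul_self_pos.2 hne⟩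
  simp only [Pi.mul_apply] at this
  linarith

/-- Regrouping by edges turns vertex conditions into boundary terms of integrations by parts. It
serves both Green's formula and the identification of Kirchhoff conditions with the kernel of
`vertexForm`. -/
theorem sum_mul_vertexSum [Fintype V] [Fintype E] [DecidableEq V] (p : E → ℝ → ℝ) (y : V → ℝ) :
    ∑ v, y v * Γ.vertexSum p v = ∑ e, (p e (Γ.len e) * y (G.t e) - p e 0 * y (G.o e)) := by
  simp only [vertexSum, mul_sub, Finset.sum_sub_distrib, Finset.mul_sum]
  congr 1
  · rw [← Finset.sum_fiberwise Finset.univ G.t]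
    refine Finset.sum_congr rfl fun v _ => Finset.sum_congr rfl fun e he => ?_
    rw [(Finset.mem_filter.1 he).2, mul_comm]
  · rw [← Finset.sum_fiberwise Finset.univ G.o]
    refine Finset.sum_congr rfl fun v _ => Finset.sum_congr rfl fun e he => ?_
    rw [(Finset.mem_filter.1 he).2, mul_comm]

theorem IsC1.cont {g : Γ.Point → ℝ} {q : E → ℝ → ℝ} (h : Γ.IsC1 g q) :
    Γ.EdgeCont (Γ.onEdge g) := fun e => (h e).1

theorem IsC1.cont' {g : Γ.Point → ℝ} {q : E → ℝ → ℝ} (h : Γ.IsC1 g q) :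
    Γ.EdgeCont q := fun e => (h e).2.1

theorem IsC1.add {g₁ g₂ : Γ.Point → ℝ} {q₁ q₂ : E → ℝ → ℝ} (h₁ : Γ.IsC1 g₁ q₁)
    (h₂ : Γ.IsC1 g₂ q₂) : Γ.IsC1 (g₁ + g₂) (q₁ + q₂) := fun e =>
  ⟨(h₁ e).1.add (h₂ e).1, (h₁ e).2.1.add (h₂ e).2.1,
    fun x hx => ((h₁ e).2.2 x hx).add ((h₂ e).2.2 x hx)⟩

theorem IsC1.smul {g : Γ.Point → ℝ} {q : E → ℝ → ℝ} (h : Γ.IsC1 g q) (c : ℝ) :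
    Γ.IsC1 (c • g) (c • q) := fun e =>
  ⟨(h e).1.const_smul c, (h e).2.1.const_smul c, fun x hx => ((h e).2.2 x hx).const_smul c⟩

theorem isC1_one : Γ.IsC1 1 0 := fun _ =>
  ⟨continuousOn_const, continuousOn_const, fun x _ => hasDerivAt_const x 1⟩

/-- Green's formula. -/
theorem IsClassicalEigen.green [Fintype V] [Fintype E] [DecidableEq V] {lam : ℝ}
    {f g : Γ.Point → ℝ} {p q : E → ℝ → ℝ} (hf : Γ.IsClassicalEigen lam f p) (hg : Γ.IsC1 g q) :
    Γ.ip p q = lam * Γ.ip (Γ.onEdge f) (Γ.onEdge g) := by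
  have h1 : ∀ e, (∫ x in (0 : ℝ)..Γ.len e, p e x * q e x) -
      lam * ∫ x in (0 : ℝ)..Γ.len e, Γ.onEdge f e x * Γ.onEdge g e x =
      p e (Γ.len e) * g (.vertex (G.t e)) - p e 0 * g (.vertex (G.o e)) := by
    intro e
    have i1 := hf.1.cont'.intervalIntegrable_mul hg.cont' e
    have i2 := (hf.1.cont.intervalIntegrable_mul hg.cont e).const_mul lam
    rw [← Γ.onEdge_len g e, ← Γ.onEdge_zero g e, ← intervalIntegral.integral_const_mul,
      ← intervalIntegral.integral_sub i1 i2]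
    refine intervalIntegral.integral_eq_sub_of_hasDerivAt_of_le (Γ.len_pos e).le
      (f := fun x => p e x * Γ.onEdge g e x) ((hf.1.cont' e).mul (hg.cont e)) (fun x hx => ?_)
      (i1.sub i2)
    exact ((hf.2.1 e x hx).mul ((hg e).2.2 x hx)).congr_deriv (by ring)
  have h2 : Γ.ip p q - lam * Γ.ip (Γ.onEdge f) (Γ.onEdge g) = 0 := by
    rw [ip, ip, Finset.mul_sum, ← Finset.sum_sub_distrib, Finset.sum_congr rfl fun e _ => h1 e,
      ← sum_mul_vertexSum p fun v => g (.vertex v)]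
    simp [hf.2.2]
  linarith

/-- Two linear conditions on three unknowns. If `s₁ ≠ s₂`, the solution is the cross product of the
two coefficient vectors. -/
theorem exists_three_coeff (s₁ t₁ s₂ t₂ : ℝ) : ∃ a b c : ℝ, (a ≠ 0 ∨ b ≠ 0 ∨ c ≠ 0) ∧
    a + b * s₁ + c * t₁ = 0 ∧ a + b * s₂ + c * t₂ = 0 := by
  by_cases hs : s₁ = s₂
  · by_cases ht : t₁ = t₂
    · exact ⟨-s₁, 1, 0, by simp, by ring, by rw [hs]; ring⟩
    · exact ⟨-s₁, 1, 0, by simp, by ring, by rw [hs]; ring⟩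
  · refine ⟨s₁ * t₂ - s₂ * t₁, t₁ - t₂, s₂ - s₁, Or.inr (Or.inr ?_), by ring, by ring⟩
    exact sub_ne_zero.2 (Ne.symm hs)

/-- If the form `∑ₑ ∫ (gₑ')² - gₑ²` is coercive on the functions vanishing at two given points, then
every eigenfunction to an eigenvalue in `(0, 1]` is a multiple of a given one to the
eigenvalue `1`. -/
theorem eigen_eq_smul_of_coercive [Fintype V] [Fintype E] [DecidableEq V]
    (hc : ∀ v, ∃ e, G.o e = v ∨ G.t e = v) {P Q : Γ.Point} {κ : ℝ} (hκ : 0 < κ)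
    (hco : ∀ g q, Γ.IsC1 g q → g P = 0 → g Q = 0 →
      κ * Γ.ip (Γ.onEdge g) (Γ.onEdge g) ≤ Γ.ip q q - Γ.ip (Γ.onEdge g) (Γ.onEdge g))
    {ψ : Γ.Point → ℝ} (hψ : ψ ∈ Γ.eigenspace 1) (hψ0 : ψ ≠ 0) {lam : ℝ} (hl : 0 < lam)
    (hl1 : lam ≤ 1) {f : Γ.Point → ℝ} (hf : f ∈ Γ.eigenspace lam) (hf0 : f ≠ 0) :
    lam = 1 ∧ ∃ s : ℝ, s • ψ = f := by
  obtain ⟨p, hp⟩ := Γ.exists_isClassicalEigen hψ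
  obtain ⟨r, hr⟩ := Γ.exists_isClassicalEigen hf
  obtain ⟨a, b, c, habc, hP, hQ⟩ := exists_three_coeff (ψ P) (f P) (ψ Q) (f Q)
  have hone : Γ.IsC1 1 0 := isC1_one
  -- The competitor `a + b ψ + c f` vanishes at `P` and `Q`, so coercivity applies to it.
  have hg := ((hone.smul a).add (hp.1.smul b)).add (hr.1.smul c)
  have key := hco _ _ hg (by simpa using hP) (by simpa using hQ)
  have e0 : Γ.onEdge (a • 1 + b • ψ + c • f) =
    a • Γ.onEdge 1 + b • Γ.onEdge ψ + c • Γ.onEdge f := rfl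
  have g1 := hp.green hone
  have g2 := hr.green hone
  have g3 := hp.green hp.1
  have g4 := hp.green hr.1
  have g5 := hr.green hr.1
  have z : ∀ F : E → ℝ → ℝ, Γ.ip F 0 = 0 := fun F => by simp [ip]
  rw [z] at g1 g2
  have g2' : Γ.ip (Γ.onEdge f) (Γ.onEdge 1) = 0 := by
    rcases mul_eq_zero.1 g2.symm with h | h
    · exact absurd h hl.ne'
    · exact h
  have c1 : Γ.EdgeCont (Γ.onEdge 1) := hone.cont
  have cψ := hp.1.cont
  have cf := hr.1.cont
  have cp := hp.1.cont'
  have cr := hr.1.cont'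
  set g := a • (1 : Γ.Point → ℝ) + b • ψ + c • f with hgdef
  have eq : Γ.ip (a • 0 + b • p + c • r) (a • 0 + b • p + c • r) =
      b ^ 2 * Γ.ip p p + 2 * b * c * Γ.ip p r + c ^ 2 * Γ.ip r r := by
    rw [smul_zero, zero_add, ip_add_left (cp.smul b) (cr.smul c) ((cp.smul b).add (cr.smul c)),
      ip_add_right (cp.smul b) (cr.smul c) (cp.smul b),
      ip_add_right (cp.smul b) (cr.smul c) (cr.smul c)]
    simp only [ip_smul_left, ip_smul_right]
    rw [ip_comm r p]
    ring
  have eg : Γ.ip (Γ.onEdge g) (Γ.onEdge g) = a ^ 2 * Γ.ip (Γ.onEdge 1) (Γ.onEdge 1) +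
      b ^ 2 * Γ.ip (Γ.onEdge ψ) (Γ.onEdge ψ) + 2 * b * c * Γ.ip (Γ.onEdge ψ) (Γ.onEdge f) +
      c ^ 2 * Γ.ip (Γ.onEdge f) (Γ.onEdge f) := by
    have k1 := c1.smul a
    have k2 := cψ.smul b
    have k3 := cf.smul c
    rw [e0, ip_add_left (k1.add k2) k3 ((k1.add k2).add k3),
      ip_add_left k1 k2 ((k1.add k2).add k3), ip_add_right (k1.add k2) k3 k1,
      ip_add_right (k1.add k2) k3 k2, ip_add_right (k1.add k2) k3 k3,
      ip_add_right k1 k2 k1, ip_add_right k1 k2 k2, ip_add_right k1 k2 k3]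
    simp only [ip_smul_left, ip_smul_right]
    rw [ip_comm (Γ.onEdge 1) (Γ.onEdge ψ), ip_comm (Γ.onEdge 1) (Γ.onEdge f),
      ip_comm (Γ.onEdge f) (Γ.onEdge ψ), g2']
    have : Γ.ip (Γ.onEdge ψ) (Γ.onEdge 1) = 0 := by linarith
    rw [this]
    ring
  have n1 := Γ.ip_self_nonneg (Γ.onEdge 1)
  have nf := Γ.ip_self_nonneg (Γ.onEdge f)
  have ng := Γ.ip_self_nonneg (Γ.onEdge g)
  -- Constants are orthogonal to `ψ` and `f`, and the mixed term of `ψ` and `f` cancels by Green's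
  -- formula. Hence the form is at most zero on the competitor, which by coercivity must vanish.
  have hJ : Γ.ip (a • 0 + b • p + c • r) (a • 0 + b • p + c • r) -
      Γ.ip (Γ.onEdge g) (Γ.onEdge g) = -(a ^ 2 * Γ.ip (Γ.onEdge 1) (Γ.onEdge 1)) -
      (1 - lam) * (c ^ 2 * Γ.ip (Γ.onEdge f) (Γ.onEdge f)) := by
    rw [eq, eg, g3, g4, g5]
    ring
  have m1 : 0 ≤ a ^ 2 * Γ.ip (Γ.onEdge 1) (Γ.onEdge 1) := by positivity
  have m2 : 0 ≤ (1 - lam) * (c ^ 2 * Γ.ip (Γ.onEdge f) (Γ.onEdge f)) :=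
    mul_nonneg (by linarith) (by positivity)
  have m3 : 0 ≤ κ * Γ.ip (Γ.onEdge g) (Γ.onEdge g) := by positivity
  have pt : ∀ {h : Γ.Point → ℝ}, Γ.EdgeCont (Γ.onEdge h) →
      Γ.ip (Γ.onEdge h) (Γ.onEdge h) = 0 → h = 0 := by
    intro h hh h0
    ext R
    obtain ⟨e, x, hx, rfl⟩ := Γ.exists_edgePoint hc R
    exact hh.eq_zero_of_ip_self h0 e hx
  have hg0 : g = 0 := pt hg.cont <| by
    have : κ * Γ.ip (Γ.onEdge g) (Γ.onEdge g) = 0 := by linarith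
    exact (mul_eq_zero.1 this).resolve_left hκ.ne'
  have hf1 : Γ.ip (Γ.onEdge f) (Γ.onEdge f) ≠ 0 := fun h => hf0 (pt cf h)
  have h11 : Γ.ip (Γ.onEdge 1) (Γ.onEdge 1) ≠ 0 := fun h => by
    have := congrFun (pt c1 h) P
    simp at this
  have ha : a = 0 := by
    have : a ^ 2 * Γ.ip (Γ.onEdge 1) (Γ.onEdge 1) = 0 := by linarith
    simpa [h11] using this
  have hsum : ∀ R, b * ψ R + c * f R = 0 := fun R => by
    have := congrFun hg0 R
    simpa [hgdef, ha] using this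
  have hc0 : c ≠ 0 := by
    intro hc0
    have hb : b ≠ 0 := by
      rcases habc with h | h | h
      · exact absurd ha h
      · exact h
      · exact absurd hc0 h
    refine hψ0 (funext fun R => ?_)
    have := hsum R
    simpa [hc0, hb] using this
  refine ⟨?_, -(b / c), ?_⟩
  · have : (1 - lam) * (c ^ 2 * Γ.ip (Γ.onEdge f) (Γ.onEdge f)) = 0 := by linarith
    have := (mul_eq_zero.1 this).resolve_right (mul_ne_zero (pow_ne_zero 2 hc0) hf1)
    linarith
  · ext R
    have := hsum R
    simp only [Pi.smul_apply, smul_eq_mul]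
    field_simp
    linarith

theorem isMu2_and_isSimple_of_coercive [Fintype V] [Fintype E] [DecidableEq V]
    (hc : ∀ v, ∃ e, G.o e = v ∨ G.t e = v) {P Q : Γ.Point} {κ : ℝ} (hκ : 0 < κ)
    (hco : ∀ g q, Γ.IsC1 g q → g P = 0 → g Q = 0 →
      κ * Γ.ip (Γ.onEdge g) (Γ.onEdge g) ≤ Γ.ip q q - Γ.ip (Γ.onEdge g) (Γ.onEdge g))
    {ψ : Γ.Point → ℝ} (hψ : ψ ∈ Γ.eigenspace 1) (hψ0 : ψ ≠ 0) :
    Γ.IsMu2 1 ∧ Γ.IsSimpleEigenvalue 1 := by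
  refine ⟨⟨⟨one_pos, fun h => hψ0 ?_⟩, ?_⟩, ?_⟩
  · rw [h] at hψ
    exact (Submodule.mem_bot ℝ).1 hψ
  · rintro lam ⟨hl, hne⟩
    by_contra hlt
    obtain ⟨f, hf, hf0⟩ := (Submodule.ne_bot_iff _).1 hne
    have := (eigen_eq_smul_of_coercive hc hκ hco hψ hψ0 hl (not_le.1 hlt).le hf hf0).1
    linarith
  · rw [IsSimpleEigenvalue, finrank_eq_one_iff']
    refine ⟨⟨ψ, hψ⟩, fun h => hψ0 (congrArg Subtype.val h), fun ⟨f, hf⟩ => ?_⟩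
    by_cases hf0 : f = 0
    · exact ⟨0, by ext; simp [hf0]⟩
    · obtain ⟨s, hs⟩ := (eigen_eq_smul_of_coercive hc hκ hco hψ hψ0 one_pos le_rfl hf hf0).2
      exact ⟨s, Subtype.ext hs⟩

end MetricGraph

/-! ### Comparison inequalities on an interval. -/

/-- Jacobi's inequality: comparison with the solution `cos (k (x - θ))` of `w'' = -k² w`. -/
theorem jacobi_inequality {g q : ℝ → ℝ} {a b k θ : ℝ} (hab : a ≤ b) (hk : 0 < k)
    (hg : ContinuousOn g (Icc a b)) (hq : ContinuousOn q (Icc a b))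
    (hd : ∀ x ∈ Ioo a b, HasDerivAt g (q x) x)
    (ha : -(Real.pi / 2) < k * (a - θ)) (hb : k * (b - θ) < Real.pi / 2) :
    k ^ 2 * ∫ x in a..b, g x * g x ≤ (∫ x in a..b, q x * q x) +
      k * Real.tan (k * (b - θ)) * g b ^ 2 - k * Real.tan (k * (a - θ)) * g a ^ 2 := by
  have hcos : ∀ x ∈ Icc a b, 0 < Real.cos (k * (x - θ)) := fun x hx =>
    Real.cos_pos_of_mem_Ioo
      ⟨ha.trans_le (mul_le_mul_of_nonneg_left (by linarith [hx.1]) hk.le),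
        (mul_le_mul_of_nonneg_left (by linarith [hx.2]) hk.le).trans_lt hb⟩
  have htan : ContinuousOn (fun x => Real.tan (k * (x - θ))) (Icc a b) := by
    intro x hx
    have h1 : ContinuousAt Real.tan (k * (x - θ)) := Real.continuousAt_tan.2 (hcos x hx).ne'
    exact (ContinuousAt.comp (f := fun x => k * (x - θ)) h1 (by fun_prop)).continuousWithinAt
  have hcont : ContinuousOn (fun x => k * Real.tan (k * (x - θ)) * g x ^ 2) (Icc a b) :=
    (continuousOn_const.mul htan).mul (hg.pow 2)
  have hcont' : ContinuousOn (fun x => k * (k * (1 + Real.tan (k * (x - θ)) ^ 2)) * g x ^ 2 +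
      k * Real.tan (k * (x - θ)) * (2 * g x * q x)) (Icc a b) := by fun_prop
  have ii : ∀ {F : ℝ → ℝ}, ContinuousOn F (Icc a b) → IntervalIntegrable F volume a b :=
    fun {F} hF => ContinuousOn.intervalIntegrable (by rwa [uIcc_of_le hab])
  have hint := intervalIntegral.integral_eq_sub_of_hasDerivAt_of_le hab hcont (f' := fun x =>
      k * (k * (1 + Real.tan (k * (x - θ)) ^ 2)) * g x ^ 2 +
      k * Real.tan (k * (x - θ)) * (2 * g x * q x)) (fun x hx => ?_) (ii hcont')
  · have hle : (∫ x in a..b, (k ^ 2 * (g x * g x) - q x * q x)) ≤ ∫ x in a..b,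
        (k * (k * (1 + Real.tan (k * (x - θ)) ^ 2)) * g x ^ 2 +
          k * Real.tan (k * (x - θ)) * (2 * g x * q x)) := by
      refine intervalIntegral.integral_mono_on hab (ii (by fun_prop)) (ii hcont') fun x _ => ?_
      -- The right-hand integrand minus the left-hand one is exactly this square.
      nlinarith [sq_nonneg (q x + k * Real.tan (k * (x - θ)) * g x)]
    rw [hint, intervalIntegral.integral_sub (ii (by fun_prop)) (ii (by fun_prop)),
      intervalIntegral.integral_const_mul] at hle
    linarith
  · have h1 : HasDerivAt (fun x => k * (x - θ)) k x := by
      simpa using ((hasDerivAt_id x).sub_const θ).const_mul k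
    have hc := hcos x (Ioo_subset_Icc_self hx)
    have h2 := ((Real.hasDerivAt_tan hc.ne').comp x h1).const_mul k
    have h3 := h2.mul ((hd x hx).pow 2)
    refine h3.congr_deriv ?_
    have : 1 / Real.cos (k * (x - θ)) ^ 2 = 1 + Real.tan (k * (x - θ)) ^ 2 := by
      rw [Real.tan_eq_sin_div_cos, div_pow, eq_comm]
      field_simp
      rw [add_comm]
      exact Real.sin_sq_add_cos_sq _
    rw [this]
    simp only [Function.comp, Pi.pow_apply]
    push_cast
    ring

/-- The factor `k` in the comparison functions `cos (k x)`. -/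
noncomputable def kFac : ℝ := 11 / 10

/-- A bound for the boundary terms in Jacobi's inequality. -/
noncomputable def tanBound : ℝ := kFac * Real.tan (kFac * (3 * Real.pi / 8))

theorem kFac_angle : kFac * (3 * Real.pi / 8) < Real.pi / 2 := by
  -- The angle is `33π/80`. The factor `kFac` exceeds 1 to leave the gap `kFac² - 1 = 21/100`, yet
  -- keeps the cosine positive up to distance `3π/8` from its centre.
  unfold kFac
  linarith [Real.pi_pos]

theorem tanBound_nonneg : 0 ≤ tanBound := by
  refine mul_nonneg (by norm_num [kFac]) (Real.tan_nonneg_of_nonneg_of_le_pi_div_two ?_ ?_)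
  · exact mul_nonneg (by norm_num [kFac]) (by positivity)
  · exact kFac_angle.le

theorem kFac_mul_tan_le {y : ℝ} (h1 : -(3 * Real.pi / 8) ≤ y) (h2 : y ≤ 3 * Real.pi / 8) :
    kFac * Real.tan (kFac * y) ≤ tanBound := by
  have hk : 0 < kFac := by norm_num [kFac]
  have h := kFac_angle
  refine mul_le_mul_of_nonneg_left ?_ hk.le
  refine Real.strictMonoOn_tan.monotoneOn ⟨?_, ?_⟩ ⟨?_, h⟩ (mul_le_mul_of_nonneg_left h2 hk.le)
  · have := mul_le_mul_of_nonneg_left h1 hk.le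
    rw [mul_neg] at this
    linarith
  · exact (mul_le_mul_of_nonneg_left h2 hk.le).trans_lt h
  · have : 0 ≤ kFac * (3 * Real.pi / 8) := mul_nonneg hk.le (by positivity)
    linarith [Real.pi_pos]

/-- Jacobi's inequality on an interval on which `x - θ` is at most `3π/8`. -/
theorem jacobi_le {g q : ℝ → ℝ} {a b θ : ℝ} (hab : a ≤ b)
    (hg : ContinuousOn g (Icc a b)) (hq : ContinuousOn q (Icc a b))
    (hd : ∀ x ∈ Ioo a b, HasDerivAt g (q x) x)
    (ha : θ - 3 * Real.pi / 8 ≤ a) (hb : b ≤ θ + 3 * Real.pi / 8) :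
    kFac ^ 2 * ∫ x in a..b, g x * g x ≤ (∫ x in a..b, q x * q x) +
      tanBound * g b ^ 2 + tanBound * g a ^ 2 := by
  have hk : 0 < kFac := by norm_num [kFac]
  have h := kFac_angle
  have h1 := jacobi_inequality (θ := θ) hab hk hg hq hd
    (by
      have := mul_le_mul_of_nonneg_left (show -(3 * Real.pi / 8) ≤ a - θ by linarith) hk.le
      rw [mul_neg] at this
      linarith)
    ((mul_le_mul_of_nonneg_left (show b - θ ≤ 3 * Real.pi / 8 by linarith) hk.le).trans_lt h)
  have h2 := mul_le_mul_of_nonneg_right (kFac_mul_tan_le (y := b - θ) (by linarith) (by linarith))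
    (sq_nonneg (g b))
  have h3 := mul_le_mul_of_nonneg_right (kFac_mul_tan_le (y := -(a - θ)) (by linarith)
    (by linarith)) (sq_nonneg (g a))
  rw [mul_neg, Real.tan_neg, mul_neg, neg_mul] at h3
  linarith

/-- Jacobi's inequality on a short interval with a natural boundary condition on the left. -/
theorem jacobi_le_left {g q : ℝ → ℝ} {a b : ℝ} (hab : a ≤ b)
    (hg : ContinuousOn g (Icc a b)) (hq : ContinuousOn q (Icc a b))
    (hd : ∀ x ∈ Ioo a b, HasDerivAt g (q x) x) (hb : b ≤ a + 3 * Real.pi / 8) :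
    kFac ^ 2 * ∫ x in a..b, g x * g x ≤ (∫ x in a..b, q x * q x) + tanBound * g b ^ 2 := by
  have hk : 0 < kFac := by norm_num [kFac]
  have h := kFac_angle
  -- Centring the cosine at the free endpoint makes its boundary term `tan 0` disappear.
  have h1 := jacobi_inequality (θ := a) hab hk hg hq hd
    (by simp [Real.pi_pos])
    ((mul_le_mul_of_nonneg_left (show b - a ≤ 3 * Real.pi / 8 by linarith) hk.le).trans_lt h)
  have h2 := mul_le_mul_of_nonneg_right (kFac_mul_tan_le (y := b - a)
    (by linarith [Real.pi_pos]) (by linarith)) (sq_nonneg (g b))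
  simp only [sub_self, mul_zero, Real.tan_zero, zero_mul, sub_zero] at h1
  linarith

/-- Jacobi's inequality on a short interval with a natural boundary condition on the right. -/
theorem jacobi_le_right {g q : ℝ → ℝ} {a b : ℝ} (hab : a ≤ b)
    (hg : ContinuousOn g (Icc a b)) (hq : ContinuousOn q (Icc a b))
    (hd : ∀ x ∈ Ioo a b, HasDerivAt g (q x) x) (hb : b ≤ a + 3 * Real.pi / 8) :
    kFac ^ 2 * ∫ x in a..b, g x * g x ≤ (∫ x in a..b, q x * q x) + tanBound * g a ^ 2 := by
  have hk : 0 < kFac := by norm_num [kFac]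
  have h := kFac_angle
  have h1 := jacobi_inequality (θ := b) hab hk hg hq hd
    (by
      have := mul_le_mul_of_nonneg_left (show -(3 * Real.pi / 8) ≤ a - b by linarith) hk.le
      rw [mul_neg] at this
      linarith)
    (by simp [Real.pi_pos])
  have h3 := mul_le_mul_of_nonneg_right (kFac_mul_tan_le (y := -(a - b)) (by linarith [Real.pi_pos])
    (by linarith)) (sq_nonneg (g a))
  rw [mul_neg, Real.tan_neg, mul_neg, neg_mul] at h3
  simp only [sub_self, mul_zero, Real.tan_zero, zero_mul, add_zero] at h1
  linarith

/-- The Cauchy-Schwarz inequality for the integral of a derivative. -/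
theorem sq_sub_le_mul_integral {g q : ℝ → ℝ} {a b : ℝ} (hab : a ≤ b)
    (hg : ContinuousOn g (Icc a b)) (hq : ContinuousOn q (Icc a b))
    (hd : ∀ x ∈ Ioo a b, HasDerivAt g (q x) x) :
    (g b - g a) ^ 2 ≤ (b - a) * ∫ x in a..b, q x * q x := by
  have ii : ∀ {F : ℝ → ℝ}, ContinuousOn F (Icc a b) → IntervalIntegrable F volume a b :=
    fun {F} hF => ContinuousOn.intervalIntegrable (by rwa [uIcc_of_le hab])
  have h1 := intervalIntegral.integral_eq_sub_of_hasDerivAt_of_le hab hg hd (ii hq)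
  rcases hab.eq_or_lt with rfl | hlt
  · simp
  -- With `m` the mean slope, the inequality says that the variance of `q` is nonnegative.
  set m := (g b - g a) / (b - a) with hm
  have h2 : 0 ≤ ∫ x in a..b, (q x - m) * (q x - m) :=
    intervalIntegral.integral_nonneg hab fun x _ => mul_self_nonneg _
  have h3 : ∫ x in a..b, (q x - m) * (q x - m) =
      (∫ x in a..b, q x * q x) - 2 * m * (g b - g a) + (b - a) * (m * m) := by
    have : ∀ x, (q x - m) * (q x - m) = (q x * q x - 2 * m * q x) + m * m := fun x => by ring
    simp only [this]
    rw [intervalIntegral.integral_add (ii (by fun_prop)) (ii (by fun_prop)),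
      intervalIntegral.integral_sub (ii (by fun_prop)) (ii (by fun_prop)),
      intervalIntegral.integral_const_mul, h1, intervalIntegral.integral_const, smul_eq_mul]
  have hpos : 0 < b - a := by linarith
  have h4 : m * (b - a) = g b - g a := by rw [hm]; field_simp
  rw [h3] at h2
  have h5 := mul_nonneg hpos.le h2
  rw [← h4] at h5 ⊢
  nlinarith

/-- A Poincaré inequality on an interval. -/
theorem integral_sq_le {g q : ℝ → ℝ} {ℓ : ℝ} (hℓ : 0 ≤ ℓ)
    (hg : ContinuousOn g (Icc 0 ℓ)) (hq : ContinuousOn q (Icc 0 ℓ))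
    (hd : ∀ x ∈ Ioo 0 ℓ, HasDerivAt g (q x) x) :
    ∫ x in (0 : ℝ)..ℓ, g x * g x ≤
      ℓ * (2 * g 0 ^ 2 + 2 * (ℓ * ∫ x in (0 : ℝ)..ℓ, q x * q x)) := by
  have ii : ∀ {F : ℝ → ℝ} {c : ℝ}, c ∈ Icc 0 ℓ → ContinuousOn F (Icc 0 ℓ) →
      IntervalIntegrable F volume 0 c := fun {F} {c} hc hF =>
    ContinuousOn.intervalIntegrable
      (by rw [uIcc_of_le hc.1]; exact hF.mono (Icc_subset_Icc_right hc.2))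
  have hqq : ContinuousOn (fun x => q x * q x) (Icc 0 ℓ) := hq.mul hq
  have key : ∀ x ∈ Icc 0 ℓ,
      g x * g x ≤ 2 * g 0 ^ 2 + 2 * (ℓ * ∫ x in (0 : ℝ)..ℓ, q x * q x) := by
    intro x hx
    have h1 := sq_sub_le_mul_integral hx.1 (hg.mono (Icc_subset_Icc_right hx.2))
      (hq.mono (Icc_subset_Icc_right hx.2)) fun y hy => hd y ⟨hy.1, hy.2.trans_le hx.2⟩
    have h0 : 0 ≤ ∫ x in (0 : ℝ)..x, q x * q x :=
      intervalIntegral.integral_nonneg hx.1 fun x _ => mul_self_nonneg _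
    have h2 : ∫ x in (0 : ℝ)..x, q x * q x ≤ ∫ x in (0 : ℝ)..ℓ, q x * q x :=
      intervalIntegral.integral_mono_interval le_rfl hx.1 hx.2
        (.of_forall fun y => mul_self_nonneg (q y)) (ii (right_mem_Icc.2 hℓ) hqq)
    have h3 : (x - 0) * ∫ x in (0 : ℝ)..x, q x * q x ≤ ℓ * ∫ x in (0 : ℝ)..ℓ, q x * q x :=
      mul_le_mul (by linarith [hx.2]) h2 h0 hℓ
    nlinarith [sq_nonneg (g x - 2 * g 0)]
  have := intervalIntegral.integral_mono_on hℓ (ii (right_mem_Icc.2 hℓ) (hg.mul hg))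
    (ii (right_mem_Icc.2 hℓ) continuousOn_const) key
  rwa [intervalIntegral.integral_const, sub_zero, smul_eq_mul] at this

/-! ### Solutions of `-u'' = u` on the edges and the form in their vertex values. -/

namespace MetricGraph

variable {V E : Type*} {G : DiscreteGraph V E} (Γ : MetricGraph G)

/-- The function on `Γ` with given values at the vertices and in the interiors of the edges. -/
def ofEdges (x : V → ℝ) (φ : E → ℝ → ℝ) : Γ.Point → ℝ
  | .vertex v => x v
  | .inner e y _ => φ e y

variable {Γ}

theorem onEdge_ofEdges {x : V → ℝ} {φ : E → ℝ → ℝ} {e : E} (h0 : φ e 0 = x (G.o e))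
    (h1 : φ e (Γ.len e) = x (G.t e)) {y : ℝ} (hy : y ∈ Icc 0 (Γ.len e)) :
    Γ.onEdge (Γ.ofEdges x φ) e y = φ e y := by
  rcases hy.1.eq_or_lt with rfl | hy0
  · rw [onEdge_zero, h0]; rfl
  · rcases hy.2.eq_or_lt with rfl | hy1
    · rw [onEdge_len, h1]; rfl
    · rw [onEdge, edgePoint_of_mem _ _ ⟨hy0, hy1⟩]; rfl

theorem ofEdges_mem_eigenspace [Fintype E] [DecidableEq V] {x : V → ℝ} {φ φ' : E → ℝ → ℝ}
    (hφ : ∀ e y, HasDerivAt (φ e) (φ' e y) y) (hφ' : ∀ e y, HasDerivAt (φ' e) (-φ e y) y)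
    (h0 : ∀ e, φ e 0 = x (G.o e)) (h1 : ∀ e, φ e (Γ.len e) = x (G.t e))
    (hK : ∀ v, Γ.vertexSum φ' v = 0) : Γ.ofEdges x φ ∈ Γ.eigenspace 1 := by
  have hc : ∀ e, Continuous (φ e) := fun e =>
    continuous_iff_continuousAt.2 fun y => (hφ e y).continuousAt
  have hc' : ∀ e, Continuous (φ' e) := fun e =>
    continuous_iff_continuousAt.2 fun y => (hφ' e y).continuousAt
  have heq : ∀ e, ∀ y ∈ Icc 0 (Γ.len e), φ e y = Γ.onEdge (Γ.ofEdges x φ) e y :=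
    fun e y hy => (onEdge_ofEdges (h0 e) (h1 e) hy).symm
  have w1 : ∀ e, IsWeakDeriv (Γ.len e) (Γ.onEdge (Γ.ofEdges x φ) e) (φ' e) := fun e =>
    (isWeakDeriv_of_hasDerivAt (hφ e) (hc' e)).congr
      (fun y hy => heq e y (Ioo_subset_Icc_self hy)) fun _ _ => rfl
  have w2 : ∀ e, IsWeakDeriv (Γ.len e) (φ' e)
      fun y => -Γ.onEdge ((1 : ℝ) • Γ.ofEdges x φ) e y := fun e =>
    (isWeakDeriv_of_hasDerivAt (hφ' e) (hc e).neg).congr (fun _ _ => rfl) fun y hy => by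
      rw [one_smul, heq e y (Ioo_subset_Icc_self hy)]
  refine ⟨⟨⟨fun e => ⟨φ' e, w1 e, (w2 e).1⟩, fun e => ?_⟩,
    fun e => ⟨φ' e, w1 e, _, w2 e, (w2 e).2.1⟩,
    φ', fun e => ⟨(hc' e).continuousOn, w1 e⟩, hK⟩, fun e => ⟨φ' e, w1 e, w2 e⟩⟩
  exact (hc e).continuousOn.congr fun y hy => (heq e y hy).symm

end MetricGraph

/-- The solution of `-u'' = u` on `[0, ℓ]` with the boundary values `a` and `b`. -/
noncomputable def edgeSol (ℓ a b y : ℝ) : ℝ := (a * Real.sin (ℓ - y) + b * Real.sin y) / Real.sin ℓ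

/-- The derivative of `edgeSol`. -/
noncomputable def edgeSol' (ℓ a b y : ℝ) : ℝ :=
  (-a * Real.cos (ℓ - y) + b * Real.cos y) / Real.sin ℓ

theorem hasDerivAt_edgeSol (ℓ a b y : ℝ) : HasDerivAt (edgeSol ℓ a b) (edgeSol' ℓ a b y) y := by
  have h1 : HasDerivAt (fun y => ℓ - y) (-1) y := by simpa using (hasDerivAt_id y).const_sub ℓ
  refine ((((h1.sin).const_mul a).add ((Real.hasDerivAt_sin y).const_mul b)).div_const
    (Real.sin ℓ)).congr_deriv ?_
  simp only [edgeSol']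
  ring

theorem hasDerivAt_edgeSol' (ℓ a b y : ℝ) : HasDerivAt (edgeSol' ℓ a b) (-edgeSol ℓ a b y) y := by
  have h1 : HasDerivAt (fun y => ℓ - y) (-1) y := by simpa using (hasDerivAt_id y).const_sub ℓ
  refine ((((h1.cos).const_mul (-a)).add ((Real.hasDerivAt_cos y).const_mul b)).div_const
    (Real.sin ℓ)).congr_deriv ?_
  simp only [edgeSol]
  ring

theorem edgeSol_zero {ℓ : ℝ} (h : Real.sin ℓ ≠ 0) (a b : ℝ) : edgeSol ℓ a b 0 = a := by
  simp [edgeSol, h]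

theorem edgeSol_len {ℓ : ℝ} (h : Real.sin ℓ ≠ 0) (a b : ℝ) : edgeSol ℓ a b ℓ = b := by
  simp [edgeSol, h]

theorem edgeSol_symm (ℓ a b y : ℝ) : edgeSol ℓ a b y = edgeSol ℓ b a (ℓ - y) := by
  simp [edgeSol, add_comm]

/-- The bilinear form in the boundary values which belongs to `∫ u' w' - u w` for the solutions
of `-u'' = u` on `[0, ℓ]`. -/
noncomputable def edgeForm (ℓ a b a' b' : ℝ) : ℝ :=
  (Real.cos ℓ * (a * a' + b * b') - (a * b' + b * a')) / Real.sin ℓ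

theorem edgeForm_swap (ℓ a b a' b' : ℝ) : edgeForm ℓ a b a' b' = edgeForm ℓ b a b' a' := by
  unfold edgeForm; congr 1; ring

theorem edgeForm_add_smul (ℓ a b a' b' s : ℝ) :
    edgeForm ℓ (a + s * a') (b + s * b') (a + s * a') (b + s * b') =
      edgeForm ℓ a b a b + 2 * s * edgeForm ℓ a b a' b' + s ^ 2 * edgeForm ℓ a' b' a' b' := by
  unfold edgeForm; ring

theorem edgeSol'_mul_sub (ℓ a b a' b' : ℝ) :
    edgeSol' ℓ a b ℓ * b' - edgeSol' ℓ a b 0 * a' = edgeForm ℓ a b a' b' := by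
  simp only [edgeSol', edgeForm, sub_self, sub_zero, Real.cos_zero]; ring

namespace DiscreteGraph

variable {V E : Type*} (G : DiscreteGraph V E)

/-- The bilinear form in the vertex values for the edge lengths `ℓ`. -/
noncomputable def vertexForm [Fintype E] (ℓ : E → ℝ) (x y : V → ℝ) : ℝ :=
  ∑ e, edgeForm (ℓ e) (x (G.o e)) (x (G.t e)) (y (G.o e)) (y (G.t e))

end DiscreteGraph

namespace MetricGraph

variable {V E : Type*} {G : DiscreteGraph V E} {Γ : MetricGraph G}

/-- Pairing `x` with the indicator of a vertex `v` gives the Kirchhoff sum at `v`, so a vector in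
the kernel of `vertexForm` yields an element of the eigenspace. -/
theorem edgeSol_mem_eigenspace [Fintype V] [Fintype E] [DecidableEq V] {x : V → ℝ}
    (hs : ∀ e, Real.sin (Γ.len e) ≠ 0) (hx : ∀ y, G.vertexForm Γ.len x y = 0) :
    Γ.ofEdges x (fun e => edgeSol (Γ.len e) (x (G.o e)) (x (G.t e))) ∈ Γ.eigenspace 1 := by
  refine ofEdges_mem_eigenspace
    (φ' := fun e => edgeSol' (Γ.len e) (x (G.o e)) (x (G.t e)))
    (fun e y => hasDerivAt_edgeSol _ _ _ _) (fun e y => hasDerivAt_edgeSol' _ _ _ _)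
    (fun e => edgeSol_zero (hs e) _ _) (fun e => edgeSol_len (hs e) _ _) fun v => ?_
  have h1 := sum_mul_vertexSum (Γ := Γ)
    (fun e => edgeSol' (Γ.len e) (x (G.o e)) (x (G.t e))) (Pi.single v 1)
  simp only [edgeSol'_mul_sub] at h1
  rw [show (∑ e, edgeForm (Γ.len e) (x (G.o e)) (x (G.t e)) ((Pi.single v 1 : V → ℝ) (G.o e))
    ((Pi.single v 1 : V → ℝ) (G.t e))) = 0 from hx _, Finset.sum_eq_single v] at h1
  · simpa using h1
  · intro w _ hw
    simp [hw]
  · simp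

end MetricGraph

/-! ### Degenerate nonnegative forms and bounds for the forms of single edges. -/

/-- A continuous family of quadratic forms which passes from a nonnegative one to one which is not
positive contains a nonnegative one with a non-trivial zero. -/
theorem exists_nonneg_form_with_zero {ι : Type*} [Fintype ι] {F : ℝ → (ι → ℝ) → ℝ}
    (hF : Continuous ↿F) (hom : ∀ s (c : ℝ) x, F s (c • x) = c ^ 2 * F s x) {a b : ℝ} (hab : a ≤ b)
    (ha : ∀ x, 0 ≤ F a x) (hb : ∃ x, x ≠ 0 ∧ F b x ≤ 0) :
    ∃ s ∈ Icc a b, (∀ x, 0 ≤ F s x) ∧ ∃ x, x ≠ 0 ∧ F s x = 0 := by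
  obtain ⟨x₀, hx₀, hFx₀⟩ := hb
  set S : Set (ι → ℝ) := Metric.sphere 0 1
  have hS : IsCompact S := isCompact_sphere 0 1
  have hnorm : ∀ x : ι → ℝ, x ≠ 0 → ‖x‖⁻¹ • x ∈ S := fun x hx => by
    simp [S, norm_smul, hx]
  have hSne : S.Nonempty := ⟨_, hnorm x₀ hx₀⟩
  have hcs : ∀ s, ContinuousOn (F s) S := fun s =>
    (hF.comp (Continuous.prodMk_right s)).continuousOn
  have hm : Continuous fun s => sInf (F s '' S) := hS.continuous_sInf hF
  have hbdd : ∀ s, BddBelow (F s '' S) := fun s => (hS.image_of_continuousOn (hcs s)).bddBelow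
  have h1 : 0 ≤ sInf (F a '' S) := by
    refine le_csInf (hSne.image _) ?_
    rintro _ ⟨x, -, rfl⟩
    exact ha x
  have h2 : sInf (F b '' S) ≤ 0 := by
    refine (csInf_le (hbdd b) ⟨_, hnorm x₀ hx₀, rfl⟩).trans ?_
    rw [hom]
    exact mul_nonpos_of_nonneg_of_nonpos (by positivity) hFx₀
  -- The minimum over the compact unit sphere depends continuously on the parameter; where it is
  -- zero, a minimiser is the desired non-trivial zero.
  obtain ⟨s, hs, hs0⟩ := intermediate_value_Icc' hab hm.continuousOn ⟨h2, h1⟩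
  simp only at hs0
  obtain ⟨z, hzS, hz⟩ := (hS.image_of_continuousOn (hcs s)).sInf_mem (hSne.image _)
  refine ⟨s, hs, fun x => ?_, z, ?_, by rw [hz, hs0]⟩
  · by_cases hx : x = 0
    · have := hom s 0 x
      rw [hx] at this ⊢
      simp at this
      exact this.ge
    · have h3 : 0 ≤ F s (‖x‖⁻¹ • x) := hs0 ▸ csInf_le (hbdd s) ⟨_, hnorm x hx, rfl⟩
      have h4 : x = ‖x‖ • (‖x‖⁻¹ • x) := by
        rw [smul_smul, mul_inv_cancel₀ (norm_ne_zero_iff.2 hx), one_smul]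
      rw [h4, hom]
      positivity
  · rintro rfl
    simp [S] at hzS

/-- Near `s = 0` the linear term dominates. Consequently a zero of a nonnegative quadratic form lies
in the kernel of the bilinear form. -/
theorem eq_zero_of_forall_nonneg_quadratic {A B : ℝ} (h : ∀ s : ℝ, 0 ≤ 2 * s * A + s ^ 2 * B) :
    A = 0 := by
  have h1 := h (-A)
  have h2 := h A
  by_contra hA
  have hA2 : 0 < A ^ 2 := by positivity
  have hB : 2 ≤ B := by nlinarith
  have h3 := h (-A / B)
  have hB0 : 0 < B := by linarith
  have : 2 * (-A / B) * A + (-A / B) ^ 2 * B = -(A ^ 2 / B) := by field_simp; ring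
  rw [this] at h3
  have : 0 < A ^ 2 / B := by positivity
  linarith

theorem DiscreteGraph.Joins.edgeForm_eq {V E : Type*} {G : DiscreteGraph V E} {e : E} {u a : V}
    (h : G.Joins e u a) (ℓ : ℝ) (x y : V → ℝ) :
    edgeForm ℓ (x (G.o e)) (x (G.t e)) (y (G.o e)) (y (G.t e)) =
      edgeForm ℓ (x u) (x a) (y u) (y a) := by
  rcases h with ⟨rfl, rfl⟩ | ⟨rfl, rfl⟩
  · rfl
  · rw [edgeForm_swap]

theorem one_sub_cos_le {ε : ℝ} (h0 : 0 < ε) (h1 : ε ≤ 1) : 1 - Real.cos ε ≤ ε * Real.sin ε := by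
  have h2 := Real.one_sub_sq_div_two_le_cos (x := ε)
  have h3 := Real.sin_gt_sub_cube h0
  nlinarith [mul_pos h0 h0, mul_lt_mul_of_pos_left h3 h0, mul_le_mul_of_nonneg_left h1 h0.le,
    mul_le_mul_of_nonneg_left h1 (pow_nonneg h0.le 2),
    mul_le_mul_of_nonneg_left h1 (pow_nonneg h0.le 3)]

/-- A lower bound for the form of a short edge. -/
theorem edgeForm_short_ge {ε : ℝ} (h0 : 0 < ε) (h1 : ε ≤ 1) (a b : ℝ) :
    (a - b) ^ 2 / ε - ε * (a ^ 2 + b ^ 2) ≤ edgeForm ε a b a b := by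
  have hs : 0 < Real.sin ε := Real.sin_pos_of_pos_of_lt_pi h0 (by linarith [Real.pi_gt_three])
  have hs1 : Real.sin ε ≤ ε := Real.sin_le h0.le
  have hc := one_sub_cos_le h0 h1
  have e1 : edgeForm ε a b a b =
      (a - b) ^ 2 / Real.sin ε - (1 - Real.cos ε) / Real.sin ε * (a ^ 2 + b ^ 2) := by
    unfold edgeForm
    field_simp
    ring
  have e2 : (a - b) ^ 2 / ε ≤ (a - b) ^ 2 / Real.sin ε :=
    div_le_div_of_nonneg_left (sq_nonneg _) hs hs1
  have e3 : (1 - Real.cos ε) / Real.sin ε ≤ ε := (div_le_iff₀ hs).2 hc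
  have e4 := mul_le_mul_of_nonneg_right e3 (add_nonneg (sq_nonneg a) (sq_nonneg b))
  rw [e1]
  linarith

theorem edgeForm_const_nonpos {ℓ : ℝ} (h : 0 < Real.sin ℓ) : edgeForm ℓ 1 1 1 1 ≤ 0 := by
  unfold edgeForm
  exact div_nonpos_of_nonpos_of_nonneg (by linarith [Real.cos_le_one ℓ]) h.le

theorem sin_three_pi_div_four : Real.sin (3 * Real.pi / 4) = Real.sqrt 2 / 2 := by
  rw [show 3 * Real.pi / 4 = Real.pi - Real.pi / 4 by ring, Real.sin_pi_sub, Real.sin_pi_div_four]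

theorem cos_three_pi_div_four : Real.cos (3 * Real.pi / 4) = -(Real.sqrt 2 / 2) := by
  rw [show 3 * Real.pi / 4 = Real.pi - Real.pi / 4 by ring, Real.cos_pi_sub, Real.cos_pi_div_four]

theorem sin_two_mul_three_pi_div_four : Real.sin (2 * (3 * Real.pi / 4)) = -1 := by
  rw [show 2 * (3 * Real.pi / 4) = Real.pi / 2 + Real.pi by ring, Real.sin_add_pi,
    Real.sin_pi_div_two]

theorem cos_two_mul_three_pi_div_four : Real.cos (2 * (3 * Real.pi / 4)) = 0 := by
  rw [show 2 * (3 * Real.pi / 4) = Real.pi / 2 + Real.pi by ring, Real.cos_add_pi,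
    Real.cos_pi_div_two, neg_zero]

theorem edgeForm_three_pi_div_four (a b a' b' : ℝ) :
    edgeForm (3 * Real.pi / 4) a b a' b' = -(a * a' + b * b') - Real.sqrt 2 * (a * b' + b * a') := by
  have h : Real.sqrt 2 ^ 2 = 2 := Real.sq_sqrt (by norm_num)
  have h0 : 0 < Real.sqrt 2 := by positivity
  rw [edgeForm, sin_three_pi_div_four, cos_three_pi_div_four]
  field_simp
  linear_combination (a * b' + a' * b) * h

theorem edgeForm_three_pi_div_two (a b a' b' : ℝ) :
    edgeForm (2 * (3 * Real.pi / 4)) a b a' b' = a * b' + b * a' := by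
  rw [edgeForm, sin_two_mul_three_pi_div_four, cos_two_mul_three_pi_div_four]
  ring

/-- A lower bound for the modified form of the first long edge. -/
theorem edgeForm_first_ge {n u c r : ℝ} (hr : 0 ≤ r) (h : n = 1 ∨ n = 2 ∧ (u - c) ^ 2 ≤ r) :
    c ^ 2 - r ≤ edgeForm (n * (3 * Real.pi / 4)) u c u c +
      2 * (2 - n) * (u + Real.sqrt 2 * c) ^ 2 := by
  have hs : Real.sqrt 2 ^ 2 = 2 := Real.sq_sqrt (by norm_num)
  rcases h with rfl | ⟨rfl, h⟩
  · rw [one_mul, edgeForm_three_pi_div_four]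
    -- The left-over is a perfect square: the modified form equals `c² + (u + √2 c)²`.
    nlinarith [sq_nonneg (u + Real.sqrt 2 * c)]
  · rw [edgeForm_three_pi_div_two]
    -- The form is `2uc = c² + u² - (u - c)²`.
    nlinarith [sq_nonneg (c - (u - c)), sq_nonneg u]

/-- Completing the square in the leaf value `u`: it vanishes for `u cos θ = a`, the natural boundary
condition at the leaf. -/
theorem edgeForm_pendant {θ : ℝ} (hs : Real.sin θ ≠ 0) (hc : Real.cos θ ≠ 0) (u a : ℝ) :
    edgeForm θ u a u a = Real.cos θ / Real.sin θ * (u - a / Real.cos θ) ^ 2 -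
      Real.tan θ * a ^ 2 := by
  have h : Real.sin θ ^ 2 = 1 - Real.cos θ ^ 2 := Real.sin_sq θ
  rw [edgeForm, Real.tan_eq_sin_div_cos]
  field_simp
  rw [h]
  ring

/-- Splitting into parts even and odd about the midpoint: the even part behaves like two pendant
edges of length `θ` free at the tip, the odd part like two edges with a zero there. -/
theorem edgeForm_double {θ : ℝ} (hs : Real.sin θ ≠ 0) (hc : Real.cos θ ≠ 0) (u a : ℝ) :
    edgeForm (2 * θ) u a u a = Real.cos θ / Real.sin θ * ((u - a) ^ 2 / 2) -
      Real.tan θ * ((u + a) ^ 2 / 2) := by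
  have h : Real.sin θ ^ 2 = 1 - Real.cos θ ^ 2 := Real.sin_sq θ
  rw [edgeForm, Real.tan_eq_sin_div_cos, Real.sin_two_mul, Real.cos_two_mul]
  field_simp
  rw [h]
  ring

/-- A lower bound for the form of the second long edge. -/
theorem edgeForm_second_ge {n u a c r θ : ℝ} (h0 : 0 < θ) (h1 : θ < Real.pi / 2)
    (ha : (a - c) ^ 2 ≤ r) (h : n = 1 ∨ n = 2 ∧ (u - c) ^ 2 ≤ r) :
    -(Real.tan θ * (9 / 4 * c ^ 2 + 18 * r)) ≤ edgeForm (n * θ) u a u a := by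
  have hs : 0 < Real.sin θ := Real.sin_pos_of_pos_of_lt_pi h0 (by linarith)
  have hc : 0 < Real.cos θ := Real.cos_pos_of_mem_Ioo ⟨by linarith, h1⟩
  have ht : 0 ≤ Real.tan θ := (Real.tan_pos_of_pos_of_lt_pi_div_two h0 h1).le
  have hr : 0 ≤ r := (sq_nonneg _).trans ha
  -- Young's inequality for `a = c + (a - c)` with weights `1 + 1/8` and `1 + 8`.
  have ha2 : a ^ 2 ≤ 9 / 8 * c ^ 2 + 9 * r := by nlinarith [sq_nonneg (c - 8 * (a - c))]
  have hcs : 0 ≤ Real.cos θ / Real.sin θ := by positivity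
  rcases h with rfl | ⟨rfl, h⟩
  · rw [one_mul, edgeForm_pendant hs.ne' hc.ne']
    have := mul_le_mul_of_nonneg_left (show a ^ 2 ≤ 9 / 4 * c ^ 2 + 18 * r by nlinarith) ht
    have := mul_nonneg hcs (sq_nonneg (u - a / Real.cos θ))
    linarith
  · have hu2 : u ^ 2 ≤ 9 / 8 * c ^ 2 + 9 * r := by nlinarith [sq_nonneg (c - 8 * (u - c))]
    rw [edgeForm_double hs.ne' hc.ne']
    have := mul_le_mul_of_nonneg_left
      (show (u + a) ^ 2 / 2 ≤ 9 / 4 * c ^ 2 + 18 * r by nlinarith [sq_nonneg (u - a)]) ht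
    have := mul_nonneg hcs (show 0 ≤ (u - a) ^ 2 / 2 by positivity)
    linarith

/-! ### The configuration of two long edges and the choice of `θ`. -/

/-- Two special edges `e₁` and `e₂` of `G`, where `eᵢ` joins `uᵢ` and `aᵢ`, such that the other edges
of `G` form a connected graph on the vertex set `S`. The edge `eᵢ` either has both endpoints in `S`
(`nᵢ = 2`), or is a pendant edge with the leaf `uᵢ ∉ S` (`nᵢ = 1`). -/
structure IsConfig {V E : Type*} (G : DiscreteGraph V E) (S : Set V) (e₁ e₂ : E) (u₁ a₁ u₂ a₂ : V)
    (n₁ n₂ : ℝ) : Prop where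
  ne : e₁ ≠ e₂
  joins₁ : G.Joins e₁ u₁ a₁
  joins₂ : G.Joins e₂ u₂ a₂
  mem₁ : a₁ ∈ S
  mem₂ : a₂ ∈ S
  tip₁ : n₁ = 1 ∧ u₁ ∉ S ∨ n₁ = 2 ∧ u₁ ∈ S
  tip₂ : n₂ = 1 ∧ u₂ ∉ S ∨ n₂ = 2 ∧ u₂ ∈ S
  le : n₁ ≤ n₂
  tip_ne : u₁ ∉ S → u₁ ≠ u₂
  cover : ∀ v, v ∈ S ∨ v = u₁ ∨ v = u₂
  rest : ∀ e, e ≠ e₁ → e ≠ e₂ → G.o e ∈ S ∧ G.t e ∈ S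
  conn : ∀ v ∈ S, Relation.ReflTransGen (fun a b => ∃ e, (e ≠ e₁ ∧ e ≠ e₂) ∧ G.Joins e a b) a₁ v

open Classical in
/-- The edges other than `e₁` and `e₂`. -/
noncomputable def restEdges {E : Type*} [Fintype E] (e₁ e₂ : E) : Finset E :=
  Finset.univ.filter fun e => e ≠ e₁ ∧ e ≠ e₂

theorem mem_restEdges {E : Type*} [Fintype E] {e₁ e₂ e : E} :
    e ∈ restEdges e₁ e₂ ↔ e ≠ e₁ ∧ e ≠ e₂ := by
  simp [restEdges]

theorem sum_eq_add_restEdges {E : Type*} [Fintype E] {e₁ e₂ : E} (h : e₁ ≠ e₂) (f : E → ℝ) :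
    ∑ e, f e = f e₁ + f e₂ + ∑ e ∈ restEdges e₁ e₂, f e := by
  classical
  rw [← Finset.add_sum_erase _ f (Finset.mem_univ e₁),
    ← Finset.add_sum_erase _ f (Finset.mem_erase.2 ⟨h.symm, Finset.mem_univ e₂⟩), ← add_assoc]
  congr 1
  refine Finset.sum_congr ?_ fun _ _ => rfl
  ext e
  simp [mem_restEdges, and_comm]

open Classical in
/-- The length `n₁ · 3π/4` for `e₁`, the length `n₂ θ` for `e₂` and the length `ε` for all other
edges. -/
noncomputable def configLen {E : Type*} (e₁ e₂ : E) (n₁ n₂ ε θ : ℝ) (e : E) : ℝ :=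
  if e = e₁ then n₁ * (3 * Real.pi / 4) else if e = e₂ then n₂ * θ else ε

section

variable {E : Type*} {e₁ e₂ : E} {n₁ n₂ ε θ : ℝ}

theorem configLen_first : configLen e₁ e₂ n₁ n₂ ε θ e₁ = n₁ * (3 * Real.pi / 4) := by
  simp [configLen]

theorem configLen_second (h : e₁ ≠ e₂) : configLen e₁ e₂ n₁ n₂ ε θ e₂ = n₂ * θ := by
  simp [configLen, h.symm]

theorem configLen_rest {e : E} (h : e ≠ e₁ ∧ e ≠ e₂) : configLen e₁ e₂ n₁ n₂ ε θ e = ε := by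
  simp [configLen, h.1, h.2]

end

namespace IsConfig

variable {V E : Type*} {G : DiscreteGraph V E} {S : Set V} {e₁ e₂ : E}
  {u₁ a₁ u₂ a₂ : V} {n₁ n₂ : ℝ}

theorem n₁_eq (h : IsConfig G S e₁ e₂ u₁ a₁ u₂ a₂ n₁ n₂) {x : V → ℝ} {r : ℝ}
    (hr : ∀ v ∈ S, (x v - x a₁) ^ 2 ≤ r) : n₁ = 1 ∨ n₁ = 2 ∧ (x u₁ - x a₁) ^ 2 ≤ r :=
  h.tip₁.imp (fun h => h.1) fun h => ⟨h.1, hr _ h.2⟩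

theorem n₂_eq (h : IsConfig G S e₁ e₂ u₁ a₁ u₂ a₂ n₁ n₂) {x : V → ℝ} {r : ℝ}
    (hr : ∀ v ∈ S, (x v - x a₁) ^ 2 ≤ r) : n₂ = 1 ∨ n₂ = 2 ∧ (x u₂ - x a₁) ^ 2 ≤ r :=
  h.tip₂.imp (fun h => h.1) fun h => ⟨h.1, hr _ h.2⟩

variable [Fintype E]

/-- The sum of the squared differences along the short edges. -/
noncomputable def diffSum (G : DiscreteGraph V E) (e₁ e₂ : E) (x : V → ℝ) : ℝ :=
  ∑ e ∈ restEdges e₁ e₂, (x (G.o e) - x (G.t e)) ^ 2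

theorem diffSum_nonneg (G : DiscreteGraph V E) (e₁ e₂ : E) (x : V → ℝ) :
    0 ≤ diffSum G e₁ e₂ x := Finset.sum_nonneg fun _ _ => sq_nonneg _

/-- Each further edge of a path costs one use of `(s + t)² ≤ 2 s² + 2 t²`; the constant does not
depend on `x`. -/
theorem exists_const_of_reflTransGen (G : DiscreteGraph V E) {e₁ e₂ : E} {a v : V}
    (h : Relation.ReflTransGen (fun a b => ∃ e, (e ≠ e₁ ∧ e ≠ e₂) ∧ G.Joins e a b) a v) :
    ∃ K, 0 ≤ K ∧ ∀ x : V → ℝ, (x v - x a) ^ 2 ≤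
      K * ∑ e ∈ restEdges e₁ e₂, (x (G.o e) - x (G.t e)) ^ 2 := by
  induction h with
  | refl => exact ⟨0, le_rfl, fun x => by simp⟩
  | @tail b c _ hbc ih =>
    obtain ⟨K, hK, ih⟩ := ih
    obtain ⟨e, he, hj⟩ := hbc
    refine ⟨2 + 2 * K, by positivity, fun x => ?_⟩
    have h1 : (x c - x b) ^ 2 ≤ ∑ e ∈ restEdges e₁ e₂, (x (G.o e) - x (G.t e)) ^ 2 := by
      refine le_trans (le_of_eq ?_) (Finset.single_le_sum
        (f := fun e => (x (G.o e) - x (G.t e)) ^ 2) (fun _ _ => sq_nonneg _) (mem_restEdges.2 he))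
      rcases hj with ⟨rfl, rfl⟩ | ⟨rfl, rfl⟩
      · ring
      · rfl
    have h2 := ih x
    nlinarith [sq_nonneg ((x c - x b) - (x b - x a))]

/-- The constant `K` depends only on the graph and the configuration, so `ε` can afterwards be
chosen small relative to it. -/
theorem exists_const [Fintype V] (h : IsConfig G S e₁ e₂ u₁ a₁ u₂ a₂ n₁ n₂) :
    ∃ K, 1 ≤ K ∧ ∀ x : V → ℝ, ∀ v ∈ S, (x v - x a₁) ^ 2 ≤ K * diffSum G e₁ e₂ x := by
  have h1 : ∀ v, ∃ K, 0 ≤ K ∧ (v ∈ S → ∀ x : V → ℝ,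
      (x v - x a₁) ^ 2 ≤ K * diffSum G e₁ e₂ x) := by
    intro v
    by_cases hv : v ∈ S
    · obtain ⟨K, hK, hx⟩ := exists_const_of_reflTransGen G (h.conn v hv)
      exact ⟨K, hK, fun _ => hx⟩
    · exact ⟨0, le_rfl, fun h => absurd h hv⟩
  choose K hK0 hK using h1
  refine ⟨1 + ∑ v, K v, by linarith [Finset.sum_nonneg fun v (_ : v ∈ Finset.univ) => hK0 v],
    fun x v hv => (hK v hv x).trans ?_⟩
  refine mul_le_mul_of_nonneg_right ?_ (diffSum_nonneg _ _ _ _)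
  have := Finset.single_le_sum (fun v _ => hK0 v) (Finset.mem_univ v)
  linarith

/-- The form in the vertex values, modified in the case of a leaf `u₁` by a square which
makes it nonnegative in `x u₁`. -/
noncomputable def modForm (G : DiscreteGraph V E) (e₁ e₂ : E) (u₁ a₁ : V) (n₁ n₂ ε θ : ℝ)
    (x y : V → ℝ) : ℝ :=
  G.vertexForm (configLen e₁ e₂ n₁ n₂ ε θ) x y +
    2 * (2 - n₁) * ((x u₁ + Real.sqrt 2 * x a₁) * (y u₁ + Real.sqrt 2 * y a₁))

theorem modForm_add_smul (ε θ s : ℝ) (x y : V → ℝ) :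
    modForm G e₁ e₂ u₁ a₁ n₁ n₂ ε θ (x + s • y) (x + s • y) =
      modForm G e₁ e₂ u₁ a₁ n₁ n₂ ε θ x x + 2 * s * modForm G e₁ e₂ u₁ a₁ n₁ n₂ ε θ x y +
        s ^ 2 * modForm G e₁ e₂ u₁ a₁ n₁ n₂ ε θ y y := by
  have : G.vertexForm (configLen e₁ e₂ n₁ n₂ ε θ) (x + s • y) (x + s • y) =
      G.vertexForm (configLen e₁ e₂ n₁ n₂ ε θ) x x +
        2 * s * G.vertexForm (configLen e₁ e₂ n₁ n₂ ε θ) x y +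
        s ^ 2 * G.vertexForm (configLen e₁ e₂ n₁ n₂ ε θ) y y := by
    simp only [DiscreteGraph.vertexForm, Pi.add_apply, Pi.smul_apply, smul_eq_mul,
      edgeForm_add_smul, Finset.sum_add_distrib, Finset.mul_sum]
  simp only [modForm, this, Pi.add_apply, Pi.smul_apply, smul_eq_mul]
  ring

theorem vertexForm_eq (h : IsConfig G S e₁ e₂ u₁ a₁ u₂ a₂ n₁ n₂) (ε θ : ℝ) (x y : V → ℝ) :
    G.vertexForm (configLen e₁ e₂ n₁ n₂ ε θ) x y =
      edgeForm (n₁ * (3 * Real.pi / 4)) (x u₁) (x a₁) (y u₁) (y a₁) +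
      edgeForm (n₂ * θ) (x u₂) (x a₂) (y u₂) (y a₂) +
      ∑ e ∈ restEdges e₁ e₂,
        edgeForm ε (x (G.o e)) (x (G.t e)) (y (G.o e)) (y (G.t e)) := by
  rw [DiscreteGraph.vertexForm, sum_eq_add_restEdges h.ne, h.joins₁.edgeForm_eq, h.joins₂.edgeForm_eq,
    configLen_first, configLen_second h.ne]
  congr 1
  refine Finset.sum_congr rfl fun e he => ?_
  rw [configLen_rest (mem_restEdges.1 he)]

/-- The short edges contribute about `D / ε`, while every deviation from the value `c` at `a₁`
within `S` costs at most a multiple of `K D`; half of `D / ε` absorbs all such errors. Of the terms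
in `c²`, `e₁` supplies `c²`, `e₂` takes at most `9/4 tan θ c²` and the short edges take at most
`4/100 c²`, which leaves room for `4/5`. -/
theorem modForm_ge (h : IsConfig G S e₁ e₂ u₁ a₁ u₂ a₂ n₁ n₂) {K ε θ : ℝ} (hK1 : 1 ≤ K)
    (hK : ∀ x : V → ℝ, ∀ v ∈ S, (x v - x a₁) ^ 2 ≤ K * diffSum G e₁ e₂ x)
    (h0 : 0 < ε) (h1 : ε ≤ 1) (hεN : ε * Fintype.card E ≤ 1 / 100) (hεK : ε * K ≤ 1 / 10 ^ 7)
    (hθ0 : 0 < θ) (hθ : θ ≤ Real.pi / 4) (x : V → ℝ) :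
    diffSum G e₁ e₂ x * (1 / (2 * ε)) + (4 / 5 - 9 / 4 * Real.tan θ) * x a₁ ^ 2 ≤
      modForm G e₁ e₂ u₁ a₁ n₁ n₂ ε θ x x := by
  set D := diffSum G e₁ e₂ x with hD
  set c := x a₁ with hc
  have hD0 : 0 ≤ D := diffSum_nonneg _ _ _ _
  have hr := hK x
  rw [← hD] at hr
  have hr0 : 0 ≤ K * D := by positivity
  have b1 := edgeForm_first_ge hr0 (h.n₁_eq hr)
  have b2 := edgeForm_second_ge (n := n₂) (u := x u₂) hθ0 (by linarith [Real.pi_pos])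
    (hr _ h.mem₂) (h.n₂_eq hr)
  have b3 : D / ε - ε * Fintype.card E * (4 * c ^ 2 + 4 * (K * D)) ≤ ∑ e ∈ restEdges e₁ e₂,
      edgeForm ε (x (G.o e)) (x (G.t e)) (x (G.o e)) (x (G.t e)) := by
    have s1 : ∀ e ∈ restEdges e₁ e₂, (x (G.o e) - x (G.t e)) ^ 2 / ε -
        ε * (4 * c ^ 2 + 4 * (K * D)) ≤
        edgeForm ε (x (G.o e)) (x (G.t e)) (x (G.o e)) (x (G.t e)) := by
      intro e he
      have he' := mem_restEdges.1 he
      refine le_trans ?_ (edgeForm_short_ge h0 h1 _ _)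
      have m := h.rest e he'.1 he'.2
      have r1 := hr _ m.1
      have r2 := hr _ m.2
      refine sub_le_sub_left (mul_le_mul_of_nonneg_left ?_ h0.le) _
      nlinarith [sq_nonneg (x (G.o e) - 2 * c), sq_nonneg (x (G.t e) - 2 * c)]
    have s2 := Finset.sum_le_sum s1
    rw [Finset.sum_sub_distrib, ← Finset.sum_div, Finset.sum_const, nsmul_eq_mul] at s2
    refine le_trans ?_ s2
    refine sub_le_sub_left ?_ _
    rw [← mul_assoc]
    refine mul_le_mul_of_nonneg_right ?_ (by positivity)
    rw [mul_comm]
    refine mul_le_mul_of_nonneg_left ?_ h0.le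
    exact_mod_cast Finset.card_le_univ _
  have ht1 : Real.tan θ ≤ 1 := by
    rw [← Real.tan_pi_div_four]
    exact Real.strictMonoOn_tan.monotoneOn ⟨by linarith, by linarith [Real.pi_pos]⟩
      ⟨by linarith, by linarith [Real.pi_pos]⟩ hθ
  have b4 : ε * Fintype.card E * (4 * c ^ 2 + 4 * (K * D)) ≤
      1 / 100 * (4 * c ^ 2 + 4 * (K * D)) := mul_le_mul_of_nonneg_right hεN (by positivity)
  have b5 : Real.tan θ * (18 * (K * D)) ≤ 1 * (18 * (K * D)) :=
    mul_le_mul_of_nonneg_right ht1 (by positivity)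
  have b6 : 20 * (K * D) ≤ D * (1 / (2 * ε)) := by
    rw [mul_one_div, le_div_iff₀ (by positivity)]
    nlinarith [mul_le_mul_of_nonneg_right hεK hD0]
  have b7 : D / ε = D * (1 / (2 * ε)) + D * (1 / (2 * ε)) := by field_simp; ring
  rw [modForm, h.vertexForm_eq]
  nlinarith [sq_nonneg c]

/-- Only `e₁` meets the leaf, so testing with its indicator isolates the natural boundary condition
at `u₁`. -/
theorem vertexForm_single₁ [DecidableEq V] (h : IsConfig G S e₁ e₂ u₁ a₁ u₂ a₂ n₁ n₂) (hu : u₁ ∉ S)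
    (ε θ : ℝ) (x : V → ℝ) :
    G.vertexForm (configLen e₁ e₂ n₁ n₂ ε θ) x (Pi.single u₁ 1) =
      edgeForm (n₁ * (3 * Real.pi / 4)) (x u₁) (x a₁) 1 0 := by
  have hne : ∀ v ∈ S, v ≠ u₁ := fun v hv hv' => hu (hv' ▸ hv)
  rw [h.vertexForm_eq, Finset.sum_eq_zero, Pi.single_eq_same, Pi.single_eq_of_ne (hne _ h.mem₁),
    Pi.single_eq_of_ne (hne _ h.mem₂), Pi.single_eq_of_ne (h.tip_ne hu).symm]
  · simp [edgeForm]
  · intro e he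
    have he' := mem_restEdges.1 he
    have m := h.rest e he'.1 he'.2
    rw [Pi.single_eq_of_ne (hne _ m.1), Pi.single_eq_of_ne (hne _ m.2)]
    simp [edgeForm]

theorem vertexForm_single₂ [DecidableEq V] (h : IsConfig G S e₁ e₂ u₁ a₁ u₂ a₂ n₁ n₂) (hu : u₂ ∉ S)
    (ε θ : ℝ) (x : V → ℝ) :
    G.vertexForm (configLen e₁ e₂ n₁ n₂ ε θ) x (Pi.single u₂ 1) =
      edgeForm (n₂ * θ) (x u₂) (x a₂) 1 0 := by
  have hne : ∀ v ∈ S, v ≠ u₂ := fun v hv hv' => hu (hv' ▸ hv)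
  have hu12 : u₁ ≠ u₂ := by
    by_cases h1 : u₁ ∈ S
    · exact hne _ h1
    · exact h.tip_ne h1
  rw [h.vertexForm_eq, Finset.sum_eq_zero, Pi.single_eq_same, Pi.single_eq_of_ne (hne _ h.mem₁),
    Pi.single_eq_of_ne (hne _ h.mem₂), Pi.single_eq_of_ne hu12]
  · simp [edgeForm]
  · intro e he
    have he' := mem_restEdges.1 he
    have m := h.rest e he'.1 he'.2
    rw [Pi.single_eq_of_ne (hne _ m.1), Pi.single_eq_of_ne (hne _ m.2)]
    simp [edgeForm]

end IsConfig

namespace IsConfig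

variable {V E : Type*} {G : DiscreteGraph V E} {S : Set V} {e₁ e₂ : E}
  {u₁ a₁ u₂ a₂ : V} {n₁ n₂ : ℝ}

theorem sin_n₂_pos (h : IsConfig G S e₁ e₂ u₁ a₁ u₂ a₂ n₁ n₂) {θ : ℝ} (h0 : 0 < θ)
    (h1 : θ ≤ Real.pi / 4) : 0 < Real.sin (n₂ * θ) := by
  have := Real.pi_pos
  rcases h.tip₂ with ⟨h, -⟩ | ⟨h, -⟩ <;> rw [h] <;>
    exact Real.sin_pos_of_pos_of_lt_pi (by linarith) (by linarith)

theorem sin_n₁_ne (h : IsConfig G S e₁ e₂ u₁ a₁ u₂ a₂ n₁ n₂) :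
    Real.sin (n₁ * (3 * Real.pi / 4)) ≠ 0 := by
  rcases h.tip₁ with ⟨h, -⟩ | ⟨h, -⟩ <;> rw [h]
  · rw [one_mul, sin_three_pi_div_four]
    positivity
  · rw [sin_two_mul_three_pi_div_four]
    norm_num

variable [Fintype E]

/-- The quadratic form of `modForm`, multiplied by `sin (n₂ θ)`. -/
noncomputable def contForm (G : DiscreteGraph V E) (e₁ e₂ : E) (u₁ a₁ u₂ a₂ : V) (n₁ n₂ ε θ : ℝ)
    (x : V → ℝ) : ℝ :=
  Real.sin (n₂ * θ) * (edgeForm (n₁ * (3 * Real.pi / 4)) (x u₁) (x a₁) (x u₁) (x a₁) +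
    2 * (2 - n₁) * (x u₁ + Real.sqrt 2 * x a₁) ^ 2 +
    ∑ e ∈ restEdges e₁ e₂, edgeForm ε (x (G.o e)) (x (G.t e)) (x (G.o e)) (x (G.t e))) +
    (Real.cos (n₂ * θ) * (x u₂ * x u₂ + x a₂ * x a₂) - (x u₂ * x a₂ + x a₂ * x u₂))

/-- The factor `sin (n₂ θ)` clears the only denominator that depends on `θ`, so joint continuity
holds for all real `θ`. -/
theorem continuous_contForm (ε : ℝ) :
    Continuous ↿(contForm G e₁ e₂ u₁ a₁ u₂ a₂ n₁ n₂ ε) := by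
  change Continuous fun p : ℝ × (V → ℝ) => contForm G e₁ e₂ u₁ a₁ u₂ a₂ n₁ n₂ ε p.1 p.2
  unfold contForm edgeForm
  fun_prop

theorem contForm_smul (ε θ c : ℝ) (x : V → ℝ) :
    contForm G e₁ e₂ u₁ a₁ u₂ a₂ n₁ n₂ ε θ (c • x) =
      c ^ 2 * contForm G e₁ e₂ u₁ a₁ u₂ a₂ n₁ n₂ ε θ x := by
  have h : ∀ ℓ a b : ℝ, edgeForm ℓ (c * a) (c * b) (c * a) (c * b) =
      c ^ 2 * edgeForm ℓ a b a b := fun ℓ a b => by unfold edgeForm; ring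
  simp only [contForm, Pi.smul_apply, smul_eq_mul, h, ← Finset.mul_sum]
  ring

theorem contForm_eq (h : IsConfig G S e₁ e₂ u₁ a₁ u₂ a₂ n₁ n₂) (ε : ℝ) {θ : ℝ}
    (hs : Real.sin (n₂ * θ) ≠ 0) (x : V → ℝ) : contForm G e₁ e₂ u₁ a₁ u₂ a₂ n₁ n₂ ε θ x =
      Real.sin (n₂ * θ) * modForm G e₁ e₂ u₁ a₁ n₁ n₂ ε θ x x := by
  rw [contForm, modForm, h.vertexForm_eq]
  have : Real.cos (n₂ * θ) * (x u₂ * x u₂ + x a₂ * x a₂) - (x u₂ * x a₂ + x a₂ * x u₂) =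
      Real.sin (n₂ * θ) * edgeForm (n₂ * θ) (x u₂) (x a₂) (x u₂) (x a₂) := by
    unfold edgeForm
    field_simp
  rw [this]
  ring

/-- At `θ = π / 4` the form takes a value which is not positive. -/
theorem exists_contForm_nonpos (h : IsConfig G S e₁ e₂ u₁ a₁ u₂ a₂ n₁ n₂) {ε : ℝ} (h0 : 0 < ε)
    (h1 : ε ≤ 1) :
    ∃ x, x ≠ 0 ∧ contForm G e₁ e₂ u₁ a₁ u₂ a₂ n₁ n₂ ε (Real.pi / 4) x ≤ 0 := by
  classical
  have hq : Real.sqrt 2 ^ 2 = 2 := Real.sq_sqrt (by norm_num)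
  have hq0 : 0 < Real.sqrt 2 := by positivity
  -- The function with value 1 on `S`, continued to the leaves by `√2` times a cosine: at `3π/4`
  -- this forces `-√2` at `u₁`, at `π/4` it forces `√2` at `u₂`.
  set x : V → ℝ := fun v => if v ∈ S then 1 else if v = u₁ then -Real.sqrt 2 else Real.sqrt 2
  have hxS : ∀ v ∈ S, x v = 1 := fun v hv => by simp [x, hv]
  have hs := h.sin_n₂_pos (θ := Real.pi / 4) (by positivity) le_rfl
  refine ⟨x, fun hx => ?_, ?_⟩
  · have := congrFun hx a₁
    rw [hxS _ h.mem₁] at this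
    simp at this
  rw [contForm_eq h ε hs.ne', modForm, h.vertexForm_eq]
  refine mul_nonpos_of_nonneg_of_nonpos hs.le ?_
  have hrest : ∑ e ∈ restEdges e₁ e₂,
      edgeForm ε (x (G.o e)) (x (G.t e)) (x (G.o e)) (x (G.t e)) ≤ 0 := by
    refine Finset.sum_nonpos fun e he => ?_
    have he' := mem_restEdges.1 he
    have m := h.rest e he'.1 he'.2
    rw [hxS _ m.1, hxS _ m.2]
    exact edgeForm_const_nonpos (Real.sin_pos_of_pos_of_lt_pi h0 (by linarith [Real.pi_gt_three]))
  have hfirst : edgeForm (n₁ * (3 * Real.pi / 4)) (x u₁) (x a₁) (x u₁) (x a₁) +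
      2 * (2 - n₁) * ((x u₁ + Real.sqrt 2 * x a₁) * (x u₁ + Real.sqrt 2 * x a₁)) = n₁ := by
    rw [hxS _ h.mem₁]
    rcases h.tip₁ with ⟨hn, hu⟩ | ⟨hn, hu⟩
    · have : x u₁ = -Real.sqrt 2 := by simp [x, hu]
      rw [this, hn, one_mul, edgeForm_three_pi_div_four]
      nlinarith
    · rw [hxS _ hu, hn, edgeForm_three_pi_div_two]
      ring
  have hsecond : edgeForm (n₂ * (Real.pi / 4)) (x u₂) (x a₂) (x u₂) (x a₂) = -n₂ := by
    have hs4 : Real.sin (Real.pi / 4) ≠ 0 := by rw [Real.sin_pi_div_four]; positivity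
    have hc4 : Real.cos (Real.pi / 4) ≠ 0 := by rw [Real.cos_pi_div_four]; positivity
    rw [hxS _ h.mem₂]
    rcases h.tip₂ with ⟨hn, hu⟩ | ⟨hn, hu⟩
    · have h12 : u₂ ≠ u₁ := by
        by_cases hu1 : u₁ ∈ S
        · exact fun h' => hu (h' ▸ hu1)
        · exact (h.tip_ne hu1).symm
      have : x u₂ = Real.sqrt 2 := by simp [x, hu, h12]
      rw [this, hn, one_mul, edgeForm_pendant hs4 hc4, Real.tan_pi_div_four, Real.cos_pi_div_four]
      have : Real.sqrt 2 - 1 / (Real.sqrt 2 / 2) = 0 := by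
        field_simp
        linarith
      rw [this]
      ring
    · rw [hxS _ hu, hn, edgeForm_double hs4 hc4, Real.tan_pi_div_four]
      ring
  -- The total is at most `n₁ - n₂`, which is where `n₁ ≤ n₂` enters.
  have := h.le
  linarith

theorem exists_vertex_values (h : IsConfig G S e₁ e₂ u₁ a₁ u₂ a₂ n₁ n₂) [Fintype V] {K ε : ℝ}
    (hK1 : 1 ≤ K) (hK : ∀ x : V → ℝ, ∀ v ∈ S, (x v - x a₁) ^ 2 ≤ K * diffSum G e₁ e₂ x)
    (h0 : 0 < ε) (h1 : ε ≤ 1) (hεN : ε * Fintype.card E ≤ 1 / 100) (hεK : ε * K ≤ 1 / 10 ^ 7) :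
    ∃ (θ : ℝ) (x : V → ℝ), Real.arctan (1 / 4) ≤ θ ∧ θ ≤ Real.pi / 4 ∧ x a₁ = 1 ∧
      (∀ v ∈ S, |x v - 1| ≤ 1 / 1000) ∧ (n₁ = 1 → x u₁ = -Real.sqrt 2 * x a₁) ∧
      (n₂ = 1 → x u₂ * Real.cos θ = x a₂) ∧
      ∀ y, G.vertexForm (configLen e₁ e₂ n₁ n₂ ε θ) x y = 0 := by
  classical
  have hpi := Real.pi_pos
  have hat : 0 < Real.arctan (1 / 4) := Real.arctan_pos.2 (by norm_num)
  have hat4 : Real.arctan (1 / 4) ≤ Real.pi / 4 := by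
    rw [← Real.arctan_one]
    exact Real.arctan_strictMono.monotone (by norm_num)
  have hD := diffSum_nonneg G e₁ e₂
  obtain ⟨θ, ⟨hθ1, hθ2⟩, hnn, z, hz0, hz⟩ := exists_nonneg_form_with_zero
    (F := contForm G e₁ e₂ u₁ a₁ u₂ a₂ n₁ n₂ ε) (continuous_contForm ε)
    (fun s c x => contForm_smul ε s c x) hat4 (fun x => by
      have hs := h.sin_n₂_pos hat hat4
      rw [contForm_eq h ε hs.ne']
      refine mul_nonneg hs.le (le_trans ?_ (h.modForm_ge hK1 hK h0 h1 hεN hεK hat hat4 x))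
      -- At this end of the range of `θ` the coefficient of `x a₁ ^ 2` is `4/5 - 9/16 > 0`.
      rw [Real.tan_arctan]
      have := mul_nonneg (hD x) (show 0 ≤ 1 / (2 * ε) by positivity)
      nlinarith [sq_nonneg (x a₁)])
    (h.exists_contForm_nonpos h0 h1)
  have hθ0 : 0 < θ := hat.trans_le hθ1
  have hcos : 0 < Real.cos θ := Real.cos_pos_of_mem_Ioo ⟨by linarith, by linarith⟩
  have hsin : 0 < Real.sin θ := Real.sin_pos_of_pos_of_lt_pi hθ0 (by linarith)
  have hs := h.sin_n₂_pos hθ0 hθ2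
  have hnn' : ∀ x, 0 ≤ modForm G e₁ e₂ u₁ a₁ n₁ n₂ ε θ x x := fun x => by
    have := hnn x
    rw [contForm_eq h ε hs.ne'] at this
    exact nonneg_of_mul_nonneg_right this hs
  have hz' : modForm G e₁ e₂ u₁ a₁ n₁ n₂ ε θ z z = 0 := by
    rw [contForm_eq h ε hs.ne'] at hz
    exact (mul_eq_zero.1 hz).resolve_left hs.ne'
  have hzy : ∀ y, modForm G e₁ e₂ u₁ a₁ n₁ n₂ ε θ z y = 0 := fun y =>
    eq_zero_of_forall_nonneg_quadratic (B := modForm G e₁ e₂ u₁ a₁ n₁ n₂ ε θ y y) fun s => by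
      have := hnn' (z + s • y)
      rw [modForm_add_smul, hz'] at this
      linarith
  -- Testing with the indicator of the leaf gives `z u₁ + √2 z a₁ = 0`. So the added square
  -- contributes nothing at `z`, and `z` lies in the kernel of the unmodified form.
  have hleaf₁ : n₁ = 1 → z u₁ = -Real.sqrt 2 * z a₁ := by
    intro hn
    have hu : u₁ ∉ S := by
      rcases h.tip₁ with h' | h'
      · exact h'.2
      · linarith [h'.1]
    have hau : a₁ ≠ u₁ := fun h' => hu (h' ▸ h.mem₁)
    have := hzy (Pi.single u₁ 1)
    rw [modForm, h.vertexForm_single₁ hu, Pi.single_eq_same, Pi.single_eq_of_ne hau, hn, one_mul,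
      edgeForm_three_pi_div_four] at this
    linarith
  have hleaf₂ : n₂ = 1 → z u₂ * Real.cos θ = z a₂ := by
    intro hn
    have hu : u₂ ∉ S := by
      rcases h.tip₂ with h' | h'
      · exact h'.2
      · linarith [h'.1]
    have h21 : u₁ ≠ u₂ := by
      by_cases h1 : u₁ ∈ S
      · exact fun h' => hu (h' ▸ h1)
      · exact h.tip_ne h1
    have ha21 : a₁ ≠ u₂ := fun h' => hu (h' ▸ h.mem₁)
    have := hzy (Pi.single u₂ 1)
    rw [modForm, h.vertexForm_single₂ hu, Pi.single_eq_of_ne h21, Pi.single_eq_of_ne ha21, hn,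
      one_mul, edgeForm] at this
    simp [hsin.ne'] at this
    linarith
  have hvf : ∀ y, G.vertexForm (configLen e₁ e₂ n₁ n₂ ε θ) z y = 0 := by
    intro y
    have := hzy y
    rw [modForm] at this
    rcases h.tip₁ with ⟨hn, -⟩ | ⟨hn, -⟩
    · rw [hleaf₁ hn] at this
      simpa using this
    · rw [hn] at this ⊢
      simpa using this
  have hge := h.modForm_ge hK1 hK h0 h1 hεN hεK hθ0 hθ2 z
  have ht1 : Real.tan θ ≤ 1 := by
    rw [← Real.tan_pi_div_four]
    exact Real.strictMonoOn_tan.monotoneOn ⟨by linarith, by linarith⟩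
      ⟨by linarith, by linarith⟩ hθ2
  -- The lower bound for the form is at most zero at `z`, and `9/4 - 4/5 ≤ 2`.
  have hDle : diffSum G e₁ e₂ z ≤ 4 * ε * z a₁ ^ 2 := by
    rw [hz'] at hge
    have h3 : diffSum G e₁ e₂ z * (1 / (2 * ε)) ≤ 2 * z a₁ ^ 2 := by
      nlinarith [mul_le_mul_of_nonneg_right ht1 (sq_nonneg (z a₁))]
    rw [mul_one_div, div_le_iff₀ (by positivity)] at h3
    linarith
  -- Here `K · 4ε ≤ 4 / 10 ^ 7` is below `(1/1000)²`, which dictates the bound on `ε K`.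
  have hdiff : ∀ v ∈ S, (z v - z a₁) ^ 2 ≤ (1 / 1000 * z a₁) ^ 2 := fun v hv => by
    refine (hK z v hv).trans ?_
    have := mul_le_mul_of_nonneg_left hDle (show 0 ≤ K by linarith)
    nlinarith [mul_le_mul_of_nonneg_right hεK (sq_nonneg (z a₁)), sq_nonneg (z a₁)]
  -- If `z a₁ = 0`, then `z` vanishes on `S` by `hdiff` and at the leaves by their boundary
  -- conditions. So `z` may be scaled to 1 at `a₁`.
  have hc : z a₁ ≠ 0 := by
    intro hc
    have hS : ∀ v ∈ S, z v = 0 := fun v hv => by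
      have := hdiff v hv
      rw [hc] at this
      simp only [sub_zero, mul_zero] at this
      nlinarith [sq_nonneg (z v)]
    refine hz0 (funext fun v => ?_)
    rcases h.cover v with hv | rfl | rfl
    · exact hS v hv
    · rcases h.tip₁ with ⟨hn, -⟩ | ⟨-, hu⟩
      · rw [hleaf₁ hn, hc, mul_zero]; rfl
      · exact hS _ hu
    · rcases h.tip₂ with ⟨hn, -⟩ | ⟨-, hu⟩
      · have := hleaf₂ hn
        rw [hS _ h.mem₂] at this
        exact (mul_eq_zero.1 this).resolve_right hcos.ne'
      · exact hS _ hu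
  refine ⟨θ, (z a₁)⁻¹ • z, hθ1, hθ2, ?_, fun v hv => ?_, fun hn => ?_, fun hn => ?_, fun y => ?_⟩
  · simp [hc]
  · have h1 : ((z a₁)⁻¹ • z) v - 1 = (z v - z a₁) / z a₁ := by
      simp only [Pi.smul_apply, smul_eq_mul]
      field_simp
    rw [h1]
    refine abs_le_of_sq_le_sq ?_ (by norm_num)
    rw [div_pow, div_le_iff₀ (by positivity)]
    have := hdiff v hv
    rw [mul_pow] at this
    exact this
  · simp only [Pi.smul_apply, smul_eq_mul, hleaf₁ hn]
    ring
  · simp only [Pi.smul_apply, smul_eq_mul, ← hleaf₂ hn]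
    ring
  · have : G.vertexForm (configLen e₁ e₂ n₁ n₂ ε θ) ((z a₁)⁻¹ • z) y =
        (z a₁)⁻¹ * G.vertexForm (configLen e₁ e₂ n₁ n₂ ε θ) z y := by
      simp only [DiscreteGraph.vertexForm, Finset.mul_sum, Pi.smul_apply, smul_eq_mul]
      refine Finset.sum_congr rfl fun e _ => ?_
      unfold edgeForm
      ring
    rw [this, hvf, mul_zero]

end IsConfig

/-! ### The shape of the solutions on the edges. -/

theorem edgeSol_short {ε a b y : ℝ} (h0 : 0 < ε) (h1 : ε ≤ 1 / 10) (ha : |a - 1| ≤ 1 / 1000)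
    (hb : |b - 1| ≤ 1 / 1000) (hy : y ∈ Icc 0 ε) :
    0 ≤ edgeSol ε a b y ∧ edgeSol ε a b y ≤ 101 / 100 := by
  obtain ⟨ha1, ha2⟩ := abs_le.1 ha
  obtain ⟨hb1, hb2⟩ := abs_le.1 hb
  have hpi := Real.pi_gt_three
  have hs : 0 < Real.sin ε := Real.sin_pos_of_pos_of_lt_pi h0 (by linarith)
  have s1 : 0 ≤ Real.sin (ε - y) :=
    Real.sin_nonneg_of_nonneg_of_le_pi (by linarith [hy.2]) (by linarith [hy.1])
  have s2 : 0 ≤ Real.sin y := Real.sin_nonneg_of_nonneg_of_le_pi hy.1 (by linarith [hy.2])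
  have t1 : Real.sin (ε - y) ≤ ε - y := Real.sin_le (by linarith [hy.2])
  have t2 : Real.sin y ≤ y := Real.sin_le hy.1
  have t3 := Real.sin_gt_sub_cube h0
  have t4 : ε ^ 3 ≤ ε / 100 := by nlinarith [mul_pos h0 h0]
  constructor
  · exact div_nonneg (add_nonneg (mul_nonneg (by linarith) s1) (mul_nonneg (by linarith) s2)) hs.le
  · rw [edgeSol, div_le_iff₀ hs]
    nlinarith [mul_le_mul_of_nonneg_right (show a ≤ 1001 / 1000 by linarith) s1,
      mul_le_mul_of_nonneg_right (show b ≤ 1001 / 1000 by linarith) s2]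

theorem edgeSol_nonneg {ℓ a b y : ℝ} (h0 : 0 < ℓ) (h1 : ℓ < Real.pi) (ha : 0 ≤ a) (hb : 0 ≤ b)
    (hy : y ∈ Icc 0 ℓ) : 0 ≤ edgeSol ℓ a b y :=
  div_nonneg (add_nonneg
    (mul_nonneg ha (Real.sin_nonneg_of_nonneg_of_le_pi (by linarith [hy.2]) (by linarith [hy.1])))
    (mul_nonneg hb (Real.sin_nonneg_of_nonneg_of_le_pi hy.1 (by linarith [hy.2]))))
    (Real.sin_pos_of_pos_of_lt_pi h0 h1).le

theorem edgeSol_pendant {ℓ u a : ℝ} (hs : Real.sin ℓ ≠ 0) (h : u * Real.cos ℓ = a) (y : ℝ) :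
    edgeSol ℓ u a y = u * Real.cos y := by
  rw [edgeSol, ← h, Real.sin_sub]
  field_simp
  ring

theorem edgeSol_three_pi_div_two (a b y : ℝ) :
    edgeSol (2 * (3 * Real.pi / 4)) a b y = a * Real.cos y - b * Real.sin y := by
  rw [edgeSol, Real.sin_sub, sin_two_mul_three_pi_div_four, cos_two_mul_three_pi_div_four]
  ring

/-- Up to `π` the sine term only lowers the value and the cosine term is at most `a`; beyond `π` the
cosine term is nonpositive and the sine term at most `b`. -/
theorem edgeSol_three_pi_div_two_le {a b m y : ℝ} (ha : 0 ≤ a) (hb : 0 ≤ b) (ham : a ≤ m)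
    (hbm : b ≤ m) (hy : y ∈ Icc 0 (2 * (3 * Real.pi / 4))) :
    edgeSol (2 * (3 * Real.pi / 4)) a b y ≤ m := by
  rw [edgeSol_three_pi_div_two]
  have hpi := Real.pi_pos
  rcases le_total y Real.pi with h | h
  · have := Real.sin_nonneg_of_nonneg_of_le_pi hy.1 h
    nlinarith [Real.cos_le_one y]
  · have : Real.cos y ≤ 0 :=
      Real.cos_nonpos_of_pi_div_two_le_of_le (by linarith) (by linarith [hy.2])
    nlinarith [Real.neg_one_le_sin y]

/-- The bound is just above `4 / √17`, the cosine of `arctan (1/4)`. It makes `1 / cos θ` large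
enough for the tip of `e₂` to rise above all other edges. -/
theorem cos_le_of_arctan_le {θ : ℝ} (h : Real.arctan (1 / 4) ≤ θ) (h1 : θ ≤ Real.pi / 4) :
    Real.cos θ ≤ 9702 / 10000 := by
  have h0 : 0 < Real.arctan (1 / 4) := Real.arctan_pos.2 (by norm_num)
  have h2 : Real.cos θ ≤ Real.cos (Real.arctan (1 / 4)) :=
    Real.cos_le_cos_of_nonneg_of_le_pi h0.le (by linarith [Real.pi_pos]) h
  refine h2.trans (abs_le_of_sq_le_sq' ?_ (by norm_num)).2
  rw [Real.cos_sq_arctan]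
  norm_num

namespace MetricGraph

variable {V E : Type*} {G : DiscreteGraph V E} {Γ : MetricGraph G}

/-- If a function exceeds on the edge `e` all its values on the other edges, then it takes its
maximum, and only on `e`. -/
theorem exists_max_on_edge (hc : ∀ v, ∃ e, G.o e = v ∨ G.t e = v) {f : Γ.Point → ℝ} {e : E} {m : ℝ}
    (hf : ContinuousOn (Γ.onEdge f e) (Icc 0 (Γ.len e)))
    (hm : ∀ e', e' ≠ e → ∀ y ∈ Icc 0 (Γ.len e'), Γ.onEdge f e' y ≤ m)
    (hex : ∃ y ∈ Icc 0 (Γ.len e), m < Γ.onEdge f e y) :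
    {p | ∀ q, f q ≤ f p}.Nonempty ∧ ∀ p, (∀ q, f q ≤ f p) →
      ∃ y ∈ Icc 0 (Γ.len e), p = Γ.edgePoint e y := by
  obtain ⟨y₁, hy₁, hmy₁⟩ := hex
  obtain ⟨y₀, hy₀, hmax⟩ := isCompact_Icc.exists_isMaxOn ⟨y₁, hy₁⟩ hf
  refine ⟨⟨Γ.edgePoint e y₀, fun q => ?_⟩, fun p hp => ?_⟩
  · obtain ⟨e', y, hy, rfl⟩ := Γ.exists_edgePoint hc q
    by_cases he : e' = e
    · subst he
      exact hmax hy
    · exact (hm e' he y hy).trans (hmy₁.le.trans (hmax hy₁))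
  · obtain ⟨e', y, hy, rfl⟩ := Γ.exists_edgePoint hc p
    by_cases he : e' = e
    · subst he
      exact ⟨y, hy, rfl⟩
    · exact absurd (hp (Γ.edgePoint e y₁)) (not_le.2 ((hm e' he y hy).trans_lt hmy₁))

/-- On a pendant edge with the leaf `u`, the solution with a natural boundary condition at `u` is a
cosine of the distance to `u`. -/
theorem exists_pendant_dist {x : V → ℝ} {e : E} {u a : V} (hj : G.Joins e u a)
    (hs : Real.sin (Γ.len e) ≠ 0) (h : x u * Real.cos (Γ.len e) = x a) {y : ℝ}
    (hy : y ∈ Icc 0 (Γ.len e)) : ∃ d ∈ Icc 0 (Γ.len e),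
      edgeSol (Γ.len e) (x (G.o e)) (x (G.t e)) y = x u * Real.cos d ∧
        (d = 0 → Γ.edgePoint e y = .vertex u) := by
  rcases hj with ⟨rfl, rfl⟩ | ⟨rfl, rfl⟩
  · refine ⟨y, hy, edgeSol_pendant hs h y, ?_⟩
    rintro rfl
    exact Γ.edgePoint_zero e
  · refine ⟨Γ.len e - y, ⟨by linarith [hy.2], by linarith [hy.1]⟩, ?_, fun hd => ?_⟩
    · rw [edgeSol_symm, edgeSol_pendant hs h]
    · rw [← sub_eq_zero.1 hd]
      exact Γ.edgePoint_len e

end MetricGraph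

/-! ### Coercivity and the metric graph of a configuration. -/

namespace IsConfig

variable {V E : Type*} [Fintype E] {G : DiscreteGraph V E} {S : Set V} {e₁ e₂ : E}
  {u₁ a₁ u₂ a₂ : V} {n₁ n₂ : ℝ}

/-- Zeros at `a₁` and at the tip of `e₁` cut `e₁` into pieces of length `3π/4 < π`, while `e₂` has
length at most `π/4` with a free tip, or twice that. Jacobi's inequality with factor `kFac` applies
to each piece. The boundary terms at vertices of `S` are small, since by connectedness through short
edges the values there are controlled by `ε` times the energy of the short edges. -/
theorem coercive (h : IsConfig G S e₁ e₂ u₁ a₁ u₂ a₂ n₁ n₂) {K ε θ : ℝ}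
    (hK1 : 1 ≤ K) (hK : ∀ x : V → ℝ, ∀ v ∈ S, (x v - x a₁) ^ 2 ≤ K * diffSum G e₁ e₂ x)
    (h0 : 0 < ε) (h1 : ε ≤ 1 / 10) (hεN : ε * Fintype.card E ≤ 1 / 100) (hεK : ε * K ≤ 1 / 10 ^ 7)
    (hεT : ε * (tanBound * K) ≤ 1 / 10) (hθ0 : 0 < θ) (hθ : θ ≤ Real.pi / 4) {Γ : MetricGraph G}
    (hΓ : Γ.len = configLen e₁ e₂ n₁ n₂ ε θ) : ∃ Q : Γ.Point, ∀ g q, Γ.IsC1 g q →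
      g (.vertex a₁) = 0 → g Q = 0 → 21 / 100 * Γ.ip (Γ.onEdge g) (Γ.onEdge g) ≤
        Γ.ip q q - Γ.ip (Γ.onEdge g) (Γ.onEdge g) := by
  have hpi := Real.pi_pos
  have l1 : Γ.len e₁ = n₁ * (3 * Real.pi / 4) := by rw [hΓ, configLen_first]
  have l2 : Γ.len e₂ = n₂ * θ := by rw [hΓ, configLen_second h.ne]
  have l3 : ∀ e ∈ restEdges e₁ e₂, Γ.len e = ε := fun e he => by
    rw [hΓ, configLen_rest (mem_restEdges.1 he)]
  have hT := tanBound_nonneg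
  have hk2 : kFac ^ 2 = 121 / 100 := by norm_num [kFac]
  set I : (Γ.Point → ℝ) → E → ℝ :=
    fun g e => ∫ x in (0 : ℝ)..Γ.len e, Γ.onEdge g e x * Γ.onEdge g e x with hI
  set J : (E → ℝ → ℝ) → E → ℝ := fun q e => ∫ x in (0 : ℝ)..Γ.len e, q e x * q e x with hJ
  have first : ∃ Q : Γ.Point, ∀ g q, Γ.IsC1 g q → g (.vertex a₁) = 0 → g Q = 0 →
      ∀ r, 0 ≤ r → (∀ v ∈ S, g (.vertex v) ^ 2 ≤ r) →
      kFac ^ 2 * I g e₁ ≤ J q e₁ + tanBound * r := by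
    rcases h.tip₁ with ⟨hn, -⟩ | ⟨hn, hu⟩
    · refine ⟨.vertex u₁, fun g q hgq hP hQ r hr _ => ?_⟩
      have hj := jacobi_le (θ := 3 * Real.pi / 8) (Γ.len_pos e₁).le (hgq e₁).1 (hgq e₁).2.1
        (hgq e₁).2.2 (by linarith) (by rw [l1, hn]; linarith)
      have z1 : Γ.onEdge g e₁ 0 = 0 ∧ Γ.onEdge g e₁ (Γ.len e₁) = 0 := by
        rw [MetricGraph.onEdge_zero, MetricGraph.onEdge_len]
        rcases h.joins₁ with ⟨ho, ht⟩ | ⟨ho, ht⟩ <;> rw [ho, ht] <;> simp [hP, hQ]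
      rw [z1.1, z1.2] at hj
      have := mul_nonneg hT hr
      simp only [hI, hJ]
      linarith
    · refine ⟨Γ.edgePoint e₁ (3 * Real.pi / 4), fun g q hgq hP hQ r hr hS => ?_⟩
      have hlen : Γ.len e₁ = 2 * (3 * Real.pi / 4) := by rw [l1, hn]
      obtain ⟨hg, hq, hd⟩ := hgq e₁
      have hm1 : (3 * Real.pi / 4) ≤ Γ.len e₁ := by rw [hlen]; linarith
      have hm0 : 0 ≤ 3 * Real.pi / 4 := by linarith
      have ja := jacobi_le (θ := 3 * Real.pi / 8) hm0
        (hg.mono (Icc_subset_Icc_right hm1)) (hq.mono (Icc_subset_Icc_right hm1))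
        (fun x hx => hd x ⟨hx.1, hx.2.trans_le hm1⟩) (by linarith) (by linarith)
      have jb := jacobi_le (θ := 9 * Real.pi / 8) hm1
        (hg.mono (Icc_subset_Icc_left hm0)) (hq.mono (Icc_subset_Icc_left hm0))
        (fun x hx => hd x ⟨hm0.trans_lt hx.1, hx.2⟩) (by linarith) (by rw [hlen]; linarith)
      have ii : ∀ {F : ℝ → ℝ}, ContinuousOn F (Icc 0 (Γ.len e₁)) →
          ((∫ x in (0 : ℝ)..(3 * Real.pi / 4), F x) + ∫ x in (3 * Real.pi / 4)..Γ.len e₁, F x) =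
          ∫ x in (0 : ℝ)..Γ.len e₁, F x := fun {F} hF =>
        intervalIntegral.integral_add_adjacent_intervals
          (ContinuousOn.intervalIntegrable
            (by rw [uIcc_of_le hm0]; exact hF.mono (Icc_subset_Icc_right hm1)))
          (ContinuousOn.intervalIntegrable
            (by rw [uIcc_of_le hm1]; exact hF.mono (Icc_subset_Icc_left hm0)))
      have i1 := ii (hg.mul hg)
      have i2 := ii (hq.mul hq)
      have zm : Γ.onEdge g e₁ (3 * Real.pi / 4) = 0 := hQ
      have z1 : Γ.onEdge g e₁ 0 ^ 2 + Γ.onEdge g e₁ (Γ.len e₁) ^ 2 ≤ r := by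
        rw [MetricGraph.onEdge_zero, MetricGraph.onEdge_len]
        have := hS _ hu
        rcases h.joins₁ with ⟨ho, ht⟩ | ⟨ho, ht⟩ <;> rw [ho, ht, hP] <;> linarith
      rw [zm] at ja jb
      have := mul_le_mul_of_nonneg_left z1 hT
      simp only [Pi.mul_apply] at i1 i2
      simp only [hI, hJ]
      rw [← i1, ← i2]
      linarith
  obtain ⟨Q, hQ⟩ := first
  refine ⟨Q, fun g q hgq hP hgQ => ?_⟩
  have second : ∀ r, 0 ≤ r → (∀ v ∈ S, g (.vertex v) ^ 2 ≤ r) →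
      kFac ^ 2 * I g e₂ ≤ J q e₂ + tanBound * (2 * r) := by
    intro r hr hS
    have hTr := mul_nonneg hT hr
    obtain ⟨hg, hq, hd⟩ := hgq e₂
    simp only [hI, hJ]
    rcases h.tip₂ with ⟨hn, -⟩ | ⟨hn, hu⟩
    · have hlen : Γ.len e₂ = θ := by rw [l2, hn, one_mul]
      rcases h.joins₂ with ⟨ho, ht⟩ | ⟨ho, ht⟩
      · have := jacobi_le_left (Γ.len_pos e₂).le hg hq hd (by rw [hlen]; linarith)
        rw [MetricGraph.onEdge_len, ht] at this
        have := mul_le_mul_of_nonneg_left (hS _ h.mem₂) hT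
        linarith
      · have := jacobi_le_right (Γ.len_pos e₂).le hg hq hd (by rw [hlen]; linarith)
        rw [MetricGraph.onEdge_zero, ho] at this
        have := mul_le_mul_of_nonneg_left (hS _ h.mem₂) hT
        linarith
    · have hlen : Γ.len e₂ = 2 * θ := by rw [l2, hn]
      have := jacobi_le (θ := θ) (Γ.len_pos e₂).le hg hq hd (by linarith)
        (by rw [hlen]; linarith)
      rw [MetricGraph.onEdge_zero, MetricGraph.onEdge_len] at this
      have m1 := mul_le_mul_of_nonneg_left (hS _ h.mem₂) hT
      have m2 := mul_le_mul_of_nonneg_left (hS _ hu) hT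
      rcases h.joins₂ with ⟨ho, ht⟩ | ⟨ho, ht⟩ <;> rw [ho, ht] at this <;> linarith
  set D := ∑ e ∈ restEdges e₁ e₂, J q e with hD
  have hJ0 : ∀ e, 0 ≤ J q e := fun e =>
    intervalIntegral.integral_nonneg (Γ.len_pos e).le fun x _ => mul_self_nonneg _
  have hD0 : 0 ≤ D := Finset.sum_nonneg fun e _ => hJ0 e
  have hdiff : diffSum G e₁ e₂ (fun v => g (.vertex v)) ≤ ε * D := by
    rw [hD, Finset.mul_sum]
    refine Finset.sum_le_sum fun e he => ?_
    have := sq_sub_le_mul_integral (Γ.len_pos e).le (hgq e).1 (hgq e).2.1 (hgq e).2.2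
    rw [MetricGraph.onEdge_zero, MetricGraph.onEdge_len] at this
    rw [sub_zero] at this
    rw [← l3 e he]
    simp only [hJ]
    linarith [sq_sub_sq (g (.vertex (G.o e))) (g (.vertex (G.t e))),
      sub_sq_comm (g (.vertex (G.o e))) (g (.vertex (G.t e)))]
  have hr0 : 0 ≤ K * (ε * D) := by positivity
  have hS : ∀ v ∈ S, g (.vertex v) ^ 2 ≤ K * (ε * D) := fun v hv => by
    have := hK (fun v => g (.vertex v)) v hv
    simp only [hP, sub_zero] at this
    exact this.trans (mul_le_mul_of_nonneg_left hdiff (by linarith))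
  have b1 := hQ g q hgq hP hgQ _ hr0 hS
  have b2 := second _ hr0 hS
  have b3 : ∑ e ∈ restEdges e₁ e₂, I g e ≤
      ε * (Fintype.card E * (2 * (K * (ε * D))) + 2 * (ε * D)) := by
    have s1 : ∀ e ∈ restEdges e₁ e₂, I g e ≤ ε * (2 * (K * (ε * D)) + 2 * (ε * J q e)) := by
      intro e he
      have := integral_sq_le (Γ.len_pos e).le (hgq e).1 (hgq e).2.1 (hgq e).2.2
      rw [MetricGraph.onEdge_zero] at this
      have m := hS _ (h.rest e (mem_restEdges.1 he).1 (mem_restEdges.1 he).2).1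
      simp only [hI, hJ]
      refine this.trans ?_
      rw [l3 e he]
      refine mul_le_mul_of_nonneg_left ?_ h0.le
      linarith
    refine (Finset.sum_le_sum s1).trans ?_
    rw [← Finset.mul_sum, Finset.sum_add_distrib, Finset.sum_const, nsmul_eq_mul,
      ← Finset.mul_sum, ← Finset.mul_sum]
    refine mul_le_mul_of_nonneg_left (add_le_add ?_ le_rfl) h0.le
    refine mul_le_mul_of_nonneg_right ?_ (by positivity)
    exact_mod_cast Finset.card_le_univ _
  have c1 : ε * (Fintype.card E * (2 * (K * (ε * D))) + 2 * (ε * D)) ≤ 1 / 10 * D := by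
    have k1 : ε * Fintype.card E * (ε * K) ≤ 1 / 100 * (1 / 10 ^ 7) :=
      mul_le_mul hεN hεK (by positivity) (by norm_num)
    have k2 : ε * ε ≤ 1 / 10 * (1 / 10) := mul_le_mul h1 h1 h0.le (by norm_num)
    have k3 := mul_le_mul_of_nonneg_right k1 hD0
    have k4 := mul_le_mul_of_nonneg_right k2 hD0
    nlinarith
  have c2 : tanBound * (K * (ε * D)) ≤ 1 / 10 * D := by
    have := mul_le_mul_of_nonneg_right hεT hD0
    linarith
  have ipg : Γ.ip (Γ.onEdge g) (Γ.onEdge g) = I g e₁ + I g e₂ + ∑ e ∈ restEdges e₁ e₂, I g e :=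
    sum_eq_add_restEdges h.ne _
  have ipq : Γ.ip q q = J q e₁ + J q e₂ + D := sum_eq_add_restEdges h.ne _
  rw [ipg, ipq]
  rw [hk2] at b1 b2
  linarith

end IsConfig

theorem exists_small (N K T : ℝ) (hN : 0 ≤ N) (hK : 0 ≤ K) (hT : 0 ≤ T) :
    ∃ ε : ℝ, 0 < ε ∧ ε ≤ 1 / 10 ∧ ε * N ≤ 1 / 100 ∧ ε * K ≤ 1 / 10 ^ 7 ∧ ε * T ≤ 1 / 10 := by
  have hpos : 0 < 1 + N + K + T := by positivity
  have hle : ∀ y, 0 ≤ y → y ≤ 1 + N + K + T →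
      1 / 10 ^ 7 / (1 + N + K + T) * y ≤ 1 / 10 ^ 7 := fun y _ hy => by
    rw [div_mul_eq_mul_div, div_le_iff₀ hpos]
    exact mul_le_mul_of_nonneg_left hy (by norm_num)
  refine ⟨1 / 10 ^ 7 / (1 + N + K + T), by positivity, ?_, ?_, ?_, ?_⟩
  · have := hle 1 (by norm_num) (by linarith)
    linarith
  · have := hle N hN (by linarith)
    linarith
  · exact hle K hK (by linarith)
  · have := hle T hT (by linarith)
    linarith

namespace IsConfig

variable {V E : Type*} {G : DiscreteGraph V E} {S : Set V} {e₁ e₂ : E}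
  {u₁ a₁ u₂ a₂ : V} {n₁ n₂ : ℝ}

/-- The leaf `u` for `n = 1`, and the closed edge `e` for `n = 2`. -/
def tipSet (Γ : MetricGraph G) (e : E) (u : V) (n : ℝ) : Set Γ.Point :=
  {p | n = 1 ∧ p = .vertex u ∨ n = 2 ∧ ∃ y ∈ Icc 0 (Γ.len e), p = Γ.edgePoint e y}

theorem mem_tipSet_of_pendant {Γ : MetricGraph G} {f : Γ.Point → ℝ} {x : V → ℝ} {e : E} {u a : V}
    (hj : G.Joins e u a) (hfx : ∀ y ∈ Icc 0 (Γ.len e),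
      Γ.onEdge f e y = edgeSol (Γ.len e) (x (G.o e)) (x (G.t e)) y) (hfu : f (.vertex u) = x u)
    (hs : Real.sin (Γ.len e) ≠ 0) (h : x u * Real.cos (Γ.len e) = x a) (hlen : Γ.len e ≤ Real.pi)
    (hu : 0 < x u) {y : ℝ} (hy : y ∈ Icc 0 (Γ.len e))
    (hmax : f (.vertex u) ≤ f (Γ.edgePoint e y)) : Γ.edgePoint e y = .vertex u := by
  obtain ⟨d, hd, hd1, hd2⟩ := MetricGraph.exists_pendant_dist hj hs h hy
  have h1 := hfx y hy
  rw [hd1, MetricGraph.onEdge] at h1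
  rw [h1, hfu] at hmax
  have h2 : Real.cos d = 1 :=
    le_antisymm (Real.cos_le_one d) (le_of_mul_le_mul_left (by linarith) hu)
  refine hd2 ((Real.cos_eq_one_iff_of_lt_of_lt ?_ ?_).1 h2) <;>
    linarith [hd.1, hd.2, Real.pi_pos]

/-- The levels 0 and `101/100` separate the edges: only `e₁` takes values below 0, and only `e₂`
takes values above `101/100`. The extrema therefore lie on these edges, and on a pendant edge the
cosine profile is extremal only at the leaf. -/
theorem exists_metricGraph [Fintype V] [Fintype E] [DecidableEq V]
    (h : IsConfig G S e₁ e₂ u₁ a₁ u₂ a₂ n₁ n₂) (hc : ∀ v, ∃ e, G.o e = v ∨ G.t e = v) :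
    ∃ Γ : MetricGraph G, Γ.IsMu2 1 ∧ Γ.IsSimpleEigenvalue 1 ∧ ∃ ψ ∈ Γ.eigenspace 1, ψ ≠ 0 ∧
      Γ.TakesMaxOnlyIn ψ (tipSet Γ e₂ u₂ n₂) ∧ Γ.TakesMaxOnlyIn (-ψ) (tipSet Γ e₁ u₁ n₁) := by
  have hpi := Real.pi_pos
  obtain ⟨K, hK1, hK⟩ := h.exists_const
  obtain ⟨ε, h0, h1, hεN, hεK, hεT⟩ := exists_small (Fintype.card E) K (tanBound * K)
    (by positivity) (by linarith) (mul_nonneg tanBound_nonneg (by linarith))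
  obtain ⟨θ, x, hθ1, hθ2, hx1, hxS, hleaf₁, hleaf₂, hvf⟩ :=
    h.exists_vertex_values hK1 hK h0 (by linarith) hεN hεK
  have hθ0 : 0 < θ := (Real.arctan_pos.2 (by norm_num)).trans_le hθ1
  have hcosθ : 0 < Real.cos θ := Real.cos_pos_of_mem_Ioo ⟨by linarith, by linarith⟩
  have hcosθ' := cos_le_of_arctan_le hθ1 hθ2
  have hn₁ : 0 < n₁ := by rcases h.tip₁ with ⟨h, -⟩ | ⟨h, -⟩ <;> rw [h] <;> norm_num
  have hn₂ : 0 < n₂ := by rcases h.tip₂ with ⟨h, -⟩ | ⟨h, -⟩ <;> rw [h] <;> norm_num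
  have hsin₁ := h.sin_n₁_ne
  have hsin₂ := h.sin_n₂_pos hθ0 hθ2
  obtain ⟨Γ, hΓ⟩ : ∃ Γ : MetricGraph G, Γ.len = configLen e₁ e₂ n₁ n₂ ε θ :=
    ⟨⟨configLen e₁ e₂ n₁ n₂ ε θ, fun e => by
      unfold configLen
      split_ifs <;> positivity⟩, rfl⟩
  rw [← hΓ] at hvf
  have l1 : Γ.len e₁ = n₁ * (3 * Real.pi / 4) := by rw [hΓ, configLen_first]
  have l2 : Γ.len e₂ = n₂ * θ := by rw [hΓ, configLen_second h.ne]
  have l3 : ∀ e, e ≠ e₁ → e ≠ e₂ → Γ.len e = ε := fun e h1 h2 => by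
    rw [hΓ, configLen_rest ⟨h1, h2⟩]
  have hs : ∀ e, Real.sin (Γ.len e) ≠ 0 := by
    intro e
    by_cases he1 : e = e₁
    · rw [he1, l1]; exact hsin₁
    by_cases he2 : e = e₂
    · rw [he2, l2]; exact hsin₂.ne'
    · rw [l3 e he1 he2]
      exact (Real.sin_pos_of_pos_of_lt_pi h0 (by linarith [Real.pi_gt_three])).ne'
  obtain ⟨φ, hφ⟩ : ∃ φ : E → ℝ → ℝ, φ = fun e => edgeSol (Γ.len e) (x (G.o e)) (x (G.t e)) :=
    ⟨_, rfl⟩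
  obtain ⟨ψ, hψ⟩ : ∃ ψ, ψ = Γ.ofEdges x φ := ⟨_, rfl⟩
  have hψmem : ψ ∈ Γ.eigenspace 1 := by
    rw [hψ, hφ]
    exact MetricGraph.edgeSol_mem_eigenspace hs hvf
  have hψv : ∀ v, ψ (.vertex v) = x v := fun v => by rw [hψ, MetricGraph.ofEdges]
  have hψe : ∀ e, ∀ y ∈ Icc 0 (Γ.len e), Γ.onEdge ψ e y = φ e y := fun e y hy => by
    rw [hψ]
    refine MetricGraph.onEdge_ofEdges ?_ ?_ hy
    · rw [hφ]
      exact edgeSol_zero (hs e) _ _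
    · rw [hφ]
      exact edgeSol_len (hs e) _ _
  have hψ0 : ψ ≠ 0 := fun h0 => by
    have := congrFun h0 (.vertex a₁)
    rw [hψv, hx1] at this
    simp at this
  obtain ⟨Q, hQ⟩ := h.coercive hK1 hK h0 h1 hεN hεK hεT hθ0 hθ2 hΓ
  obtain ⟨hmu, hsimple⟩ :=
    MetricGraph.isMu2_and_isSimple_of_coercive hc (by norm_num) hQ hψmem hψ0
  have hcont : ∀ e, ContinuousOn (Γ.onEdge ψ e) (Icc 0 (Γ.len e)) := hψmem.1.1.2
  have bS : ∀ v ∈ S, 999 / 1000 ≤ x v ∧ x v ≤ 1001 / 1000 := fun v hv => by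
    have := abs_le.1 (hxS v hv)
    constructor <;> linarith [this.1, this.2]
  have rest : ∀ e, e ≠ e₁ → e ≠ e₂ → ∀ y ∈ Icc 0 (Γ.len e), 0 ≤ φ e y ∧ φ e y ≤ 101 / 100 := by
    intro e he1 he2 y hy
    have m := h.rest e he1 he2
    simp only [hφ]
    rw [l3 e he1 he2] at hy ⊢
    exact edgeSol_short h0 h1 (hxS _ m.1) (hxS _ m.2) hy
  -- the first long edge
  have sq2 : Real.sqrt 2 ^ 2 = 2 := Real.sq_sqrt (by norm_num)
  have sq2pos : 0 < Real.sqrt 2 := by positivity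
  have pend₁ : n₁ = 1 → x u₁ * Real.cos (Γ.len e₁) = x a₁ := fun hn => by
    rw [l1, hleaf₁ hn, hn, one_mul, cos_three_pi_div_four]
    linear_combination (x a₁ / 2) * sq2
  have first_le : ∀ y ∈ Icc 0 (Γ.len e₁), φ e₁ y ≤ 101 / 100 := by
    intro y hy
    rcases h.tip₁ with ⟨hn, -⟩ | ⟨hn, hu⟩
    · obtain ⟨d, hd, hd1, -⟩ := MetricGraph.exists_pendant_dist h.joins₁ (hs e₁) (pend₁ hn) hy
      simp only [hφ]
      rw [hd1, hleaf₁ hn, hx1]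
      have hd2 : Real.cos (3 * Real.pi / 4) ≤ Real.cos d :=
        Real.cos_le_cos_of_nonneg_of_le_pi hd.1 (by linarith)
          (hd.2.trans (by rw [l1, hn, one_mul]))
      rw [cos_three_pi_div_four] at hd2
      nlinarith
    · have m : G.o e₁ ∈ S ∧ G.t e₁ ∈ S := by
        rcases h.joins₁ with ⟨ho, ht⟩ | ⟨ho, ht⟩ <;> rw [ho, ht]
        · exact ⟨hu, h.mem₁⟩
        · exact ⟨h.mem₁, hu⟩
      simp only [hφ]
      rw [l1, hn] at hy ⊢
      have b1 := bS _ m.1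
      have b2 := bS _ m.2
      exact edgeSol_three_pi_div_two_le (by linarith) (by linarith) (by linarith) (by linarith) hy
  have first_lt : ∃ y ∈ Icc 0 (Γ.len e₁), Γ.onEdge ψ e₁ y < 0 := by
    rcases h.tip₁ with ⟨hn, -⟩ | ⟨hn, hu⟩
    · have hu0 : x u₁ < 0 := by rw [hleaf₁ hn, hx1]; linarith
      have hl := Γ.len_pos e₁
      rcases h.joins₁ with ⟨ho, -⟩ | ⟨-, ht⟩
      · exact ⟨0, left_mem_Icc.2 hl.le, by rw [MetricGraph.onEdge_zero, ho, hψv]; exact hu0⟩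
      · exact ⟨_, right_mem_Icc.2 hl.le, by rw [MetricGraph.onEdge_len, ht, hψv]; exact hu0⟩
    · have m : G.o e₁ ∈ S ∧ G.t e₁ ∈ S := by
        rcases h.joins₁ with ⟨ho, ht⟩ | ⟨ho, ht⟩ <;> rw [ho, ht]
        · exact ⟨hu, h.mem₁⟩
        · exact ⟨h.mem₁, hu⟩
      have hmem : 3 * Real.pi / 4 ∈ Icc 0 (Γ.len e₁) := by
        rw [l1, hn]
        constructor <;> linarith
      refine ⟨_, hmem, ?_⟩
      rw [hψe _ _ hmem]
      simp only [hφ]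
      rw [l1, hn, edgeSol_three_pi_div_two, cos_three_pi_div_four, sin_three_pi_div_four]
      have b1 := bS _ m.1
      have b2 := bS _ m.2
      nlinarith
  -- the second long edge
  have pend₂ : n₂ = 1 → x u₂ * Real.cos (Γ.len e₂) = x a₂ := fun hn => by
    rw [l2, hn, one_mul, hleaf₂ hn]
  -- The leaf value is `x a₂ / cos θ`, at least `0.999 / 0.9702`.
  have tip₂ : n₂ = 1 → 102 / 100 < x u₂ := fun hn => by
    have e1 := hleaf₂ hn
    have b := bS _ h.mem₂
    by_contra hlt
    have := mul_le_mul_of_nonneg_right (not_lt.1 hlt) hcosθ.le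
    nlinarith
  have second_nonneg : ∀ y ∈ Icc 0 (Γ.len e₂), 0 ≤ φ e₂ y := by
    intro y hy
    rcases h.tip₂ with ⟨hn, -⟩ | ⟨hn, hu⟩
    · obtain ⟨d, hd, hd1, -⟩ := MetricGraph.exists_pendant_dist h.joins₂ (hs e₂) (pend₂ hn) hy
      simp only [hφ]
      rw [hd1]
      rw [l2, hn, one_mul] at hd
      refine mul_nonneg (by linarith [tip₂ hn])
        (Real.cos_nonneg_of_neg_pi_div_two_le_of_le (by linarith [hd.1]) (by linarith [hd.2]))
    · have m : G.o e₂ ∈ S ∧ G.t e₂ ∈ S := by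
        rcases h.joins₂ with ⟨ho, ht⟩ | ⟨ho, ht⟩ <;> rw [ho, ht]
        · exact ⟨hu, h.mem₂⟩
        · exact ⟨h.mem₂, hu⟩
      have b1 := bS _ m.1
      have b2 := bS _ m.2
      rw [hφ]
      exact edgeSol_nonneg (Γ.len_pos e₂) (by rw [l2, hn]; linarith) (by linarith) (by linarith) hy
  have second_gt : ∃ y ∈ Icc 0 (Γ.len e₂), 101 / 100 < Γ.onEdge ψ e₂ y := by
    rcases h.tip₂ with ⟨hn, -⟩ | ⟨hn, hu⟩
    · have hu0 := tip₂ hn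
      have hl := Γ.len_pos e₂
      rcases h.joins₂ with ⟨ho, -⟩ | ⟨-, ht⟩
      · exact ⟨0, left_mem_Icc.2 hl.le, by rw [MetricGraph.onEdge_zero, ho, hψv]; linarith⟩
      · exact ⟨_, right_mem_Icc.2 hl.le, by rw [MetricGraph.onEdge_len, ht, hψv]; linarith⟩
    · have m : G.o e₂ ∈ S ∧ G.t e₂ ∈ S := by
        rcases h.joins₂ with ⟨ho, ht⟩ | ⟨ho, ht⟩ <;> rw [ho, ht]
        · exact ⟨hu, h.mem₂⟩
        · exact ⟨h.mem₂, hu⟩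
      have b1 := bS _ m.1
      have b2 := bS _ m.2
      have hlen : Γ.len e₂ = 2 * θ := by rw [l2, hn]
      -- At the midpoint the solution is the mean of the end values divided by `cos θ`.
      have hmem : θ ∈ Icc 0 (Γ.len e₂) := by
        rw [hlen]
        constructor <;> linarith
      refine ⟨θ, hmem, ?_⟩
      rw [hψe _ _ hmem]
      simp only [hφ]
      have hsθ : 0 < Real.sin θ := Real.sin_pos_of_pos_of_lt_pi hθ0 (by linarith)
      rw [hlen, edgeSol, show 2 * θ - θ = θ by ring, Real.sin_two_mul, ← add_mul,
        lt_div_iff₀ (by positivity)]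
      nlinarith [mul_le_mul_of_nonneg_right hcosθ' hsθ.le]
  refine ⟨Γ, hmu, hsimple, ψ, hψmem, hψ0, ?_, ?_⟩
  · obtain ⟨hne, hsub⟩ := MetricGraph.exists_max_on_edge (m := 101 / 100) hc (hcont e₂)
      (fun e' he' y hy => by
        rw [hψe _ _ hy]
        by_cases he1 : e' = e₁
        · subst he1
          exact first_le y hy
        · exact (rest e' he1 he' y hy).2) second_gt
    refine ⟨hne, fun p hp => ?_⟩
    obtain ⟨y, hy, rfl⟩ := hsub p hp
    rcases h.tip₂ with ⟨hn, -⟩ | ⟨hn, -⟩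
    · refine Or.inl ⟨hn, ?_⟩
      exact mem_tipSet_of_pendant h.joins₂
        (fun y hy => by rw [hψe _ _ hy, hφ]) (hψv _) (hs e₂) (pend₂ hn)
        (by rw [l2, hn]; linarith) (by linarith [tip₂ hn]) hy (hp _)
    · exact Or.inr ⟨hn, y, hy, rfl⟩
  · obtain ⟨q, hq, hq0⟩ := first_lt
    obtain ⟨hne, hsub⟩ := MetricGraph.exists_max_on_edge (f := -ψ) (m := 0) hc (hcont e₁).neg
      (fun e' he' y hy => by
        have e0 : Γ.onEdge (-ψ) e' y = -φ e' y := by rw [← hψe _ _ hy]; rfl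
        rw [e0, neg_nonpos]
        by_cases he2 : e' = e₂
        · subst he2
          exact second_nonneg y hy
        · exact (rest e' he' he2 y hy).1)
      ⟨q, hq, neg_pos.2 hq0⟩
    refine ⟨hne, fun p hp => ?_⟩
    obtain ⟨y, hy, rfl⟩ := hsub p hp
    rcases h.tip₁ with ⟨hn, -⟩ | ⟨hn, -⟩
    · refine Or.inl ⟨hn, ?_⟩
      refine mem_tipSet_of_pendant (x := -x) h.joins₁ (fun y hy => ?_)
        (congrArg Neg.neg (hψv _)) (hs e₁) ?_
        (by rw [l1, hn]; linarith) ?_ hy (hp _)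
      · have e0 : Γ.onEdge (-ψ) e₁ y = -φ e₁ y := by rw [← hψe _ _ hy]; rfl
        rw [e0]
        simp only [hφ, edgeSol, Pi.neg_apply]
        ring
      · have := pend₁ hn
        simp only [Pi.neg_apply]
        linarith
      · simp only [Pi.neg_apply]
        rw [hleaf₁ hn, hx1]
        linarith
    · exact Or.inr ⟨hn, y, hy, rfl⟩

end IsConfig

/-! ### Spanning edge sets, cycles, leaves and degree counting. -/

namespace DiscreteGraph

variable {V E : Type*} {G : DiscreteGraph V E}

theorem Joins.symm {e : E} {u v : V} (h : G.Joins e u v) : G.Joins e v u := Or.symm h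

theorem joins_self (G : DiscreteGraph V E) (e : E) : G.Joins e (G.o e) (G.t e) :=
  Or.inl ⟨rfl, rfl⟩

/-- Joining two vertices by paths with edges in `T`. -/
def JoinedBy (G : DiscreteGraph V E) (T : Finset E) (u v : V) : Prop :=
  Relation.ReflTransGen (fun a b => ∃ e ∈ T, G.Joins e a b) u v

theorem JoinedBy.symm {T : Finset E} {u v : V} (h : G.JoinedBy T u v) : G.JoinedBy T v u := by
  have : Std.Symm fun a b => ∃ e ∈ T, G.Joins e a b := ⟨fun a b ⟨e, he, hj⟩ => ⟨e, he, hj.symm⟩⟩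
  exact Relation.ReflTransGen.stdSymm.symm _ _ h

theorem exists_crossing {r : V → V → Prop} {A : Finset V} {u v : V}
    (h : Relation.ReflTransGen r u v) (hu : u ∈ A) (hv : v ∉ A) : ∃ a ∈ A, ∃ b ∉ A, r a b := by
  induction h with
  | refl => exact absurd hu hv
  | @tail b c _ hbc ih =>
    by_cases hb : b ∈ A
    · exact ⟨b, hb, c, hv, hbc⟩
    · exact ih hb

/-- A connected graph with `V` vertices has a connecting set of at most `V - 1` edges. -/
theorem Connected.exists_spanning [Fintype V] (hG : G.Connected) :
    ∃ T : Finset E, T.card + 1 ≤ Fintype.card V ∧ ∀ u v, G.JoinedBy T u v := by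
  classical
  obtain ⟨⟨r⟩, hconn⟩ := hG
  -- Growing a tree from `r`: as long as a vertex is missing, some edge leaves the set reached so
  -- far, and adding it reaches one more vertex.
  have key : ∀ n, n + 1 ≤ Fintype.card V → ∃ (A : Finset V) (T : Finset E), A.card = n + 1 ∧
      T.card ≤ n ∧ r ∈ A ∧ ∀ v ∈ A, G.JoinedBy T r v := by
    intro n
    induction n with
    | zero =>
      intro _
      refine ⟨{r}, ∅, by simp, by simp, by simp, fun v hv => ?_⟩
      rw [Finset.mem_singleton.1 hv]
      exact Relation.ReflTransGen.refl
    | succ n ih =>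
      intro hn
      obtain ⟨A, T, hA, hT, hr, hj⟩ := ih (by omega)
      obtain ⟨w, hw⟩ : ∃ w, w ∉ A := by
        by_contra hall
        push Not at hall
        have : A = Finset.univ := Finset.eq_univ_iff_forall.2 hall
        rw [this, Finset.card_univ] at hA
        omega
      obtain ⟨a, ha, b, hb, e, he⟩ := exists_crossing (hconn r w) hr hw
      have hmono : ∀ v ∈ A, G.JoinedBy (insert e T) r v := fun v hv =>
        Relation.ReflTransGen.mono
          (fun x y ⟨e', he', hj'⟩ => ⟨e', Finset.mem_insert_of_mem he', hj'⟩) r v (hj v hv)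
      refine ⟨insert b A, insert e T, by rw [Finset.card_insert_of_notMem hb, hA],
        (Finset.card_insert_le _ _).trans (by omega), Finset.mem_insert_of_mem hr, fun v hv => ?_⟩
      rcases Finset.mem_insert.1 hv with rfl | hv
      · exact (hmono a ha).tail ⟨e, Finset.mem_insert_self _ _, he⟩
      · exact hmono v hv
  have hpos : 0 < Fintype.card V := Fintype.card_pos_iff.2 ⟨r⟩
  obtain ⟨A, T, hA, hT, -, hj⟩ := key (Fintype.card V - 1) (by omega)
  have hAu : A = Finset.univ := Finset.eq_univ_of_card A (by omega)
  refine ⟨T, by omega, fun u v => ?_⟩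
  have hu := hj u (hAu ▸ Finset.mem_univ u)
  have hv := hj v (hAu ▸ Finset.mem_univ v)
  exact hu.symm.trans hv

/-- An edge whose endpoints are joined by other edges is part of a cycle. -/
theorem inCycle_of_joinedBy {T : Finset E} {e : E} (he : e ∉ T)
    (hT : G.JoinedBy T (G.t e) (G.o e)) : G.InCycle e := by
  classical
  -- Loops and multiplicities are forgotten to extract a path without repeated vertices; edges of
  -- `T` are then chosen along it.
  let H : SimpleGraph V := SimpleGraph.fromRel fun a b => ∃ e ∈ T, G.Joins e a b
  have hreach : H.Reachable (G.t e) (G.o e) := by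
    unfold JoinedBy at hT
    generalize G.o e = w at hT
    induction hT with
    | refl => exact SimpleGraph.Reachable.refl _
    | @tail b c _ hbc ih =>
      refine ih.trans ?_
      by_cases hb : b = c
      · rw [hb]
      · exact SimpleGraph.Adj.reachable ((SimpleGraph.fromRel_adj _ _ _).2 ⟨hb, Or.inl hbc⟩)
  obtain ⟨p, hp⟩ := hreach.exists_isPath
  have hadj : ∀ i, i < p.length → ∃ e' ∈ T, G.Joins e' (p.getVert i) (p.getVert (i + 1)) := by
    intro i hi
    have := p.adj_getVert_succ hi
    rcases ((SimpleGraph.fromRel_adj _ _ _).1 this).2 with h | ⟨e', he', hj⟩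
    · exact h
    · exact ⟨e', he', hj.symm⟩
  have : Nonempty E := ⟨e⟩
  choose! c hcT hcJ using hadj
  have hinj : ∀ i j, i ≤ p.length → j ≤ p.length → p.getVert i = p.getVert j → i = j :=
    fun i j hi hj h => hp.getVert_injOn hi hj h
  -- The path from `t e` to `o e` is closed up by `e` at the last index; if `e` is a loop, the path
  -- has length zero and `e` is the whole cycle.
  refine ⟨p.length, fun i => p.getVert i, fun i => if (i : ℕ) < p.length then c i else e,
    ⟨fun i j hij => Fin.ext (hinj _ _ (by omega) (by omega) hij), fun i j hij => ?_, fun i => ?_⟩,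
    Fin.last _, by simp⟩
  · simp only at hij
    by_cases hi : (i : ℕ) < p.length
    · by_cases hj : (j : ℕ) < p.length
      · rw [if_pos hi, if_pos hj] at hij
        have h1 := hcJ i hi
        have h2 := hcJ j hj
        rw [← hij] at h2
        -- Equal edges have the same endpoints; if these occur in opposite order, then `i = j + 1`
        -- and `j = i + 1`, which is absurd.
        have : p.getVert i = p.getVert j ∨
            p.getVert i = p.getVert (j + 1) ∧ p.getVert (i + 1) = p.getVert j := by
          rcases h1 with ⟨a, b⟩ | ⟨a, b⟩ <;> rcases h2 with ⟨c, d⟩ | ⟨c, d⟩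
          · exact Or.inl (a.symm.trans c)
          · exact Or.inr ⟨a.symm.trans c, b.symm.trans d⟩
          · exact Or.inr ⟨b.symm.trans d, a.symm.trans c⟩
          · exact Or.inl (b.symm.trans d)
        rcases this with h | ⟨h, h'⟩
        · exact Fin.ext (hinj _ _ hi.le hj.le h)
        · have := hinj _ _ hi.le hj h
          have := hinj _ _ hi hj.le h'
          omega
      · rw [if_pos hi, if_neg hj] at hij
        exact absurd (hij ▸ hcT i hi) he
    · by_cases hj : (j : ℕ) < p.length
      · rw [if_neg hi, if_pos hj] at hij
        exact absurd (hij ▸ hcT j hj) he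
      · exact Fin.ext (by omega)
  · by_cases hi : (i : ℕ) < p.length
    · simp only [if_pos hi]
      have : ((i + 1 : Fin (p.length + 1)) : ℕ) = i + 1 :=
        Fin.val_add_one_of_lt (Fin.lt_def.2 (by simpa using hi))
      rw [this]
      exact hcJ i hi
    · simp only [if_neg hi]
      have hil : i = Fin.last _ := Fin.ext (by simp; omega)
      rw [hil, Fin.last_add_one]
      simp only [Fin.val_last, Fin.val_zero, SimpleGraph.Walk.getVert_length,
        SimpleGraph.Walk.getVert_zero]
      exact G.joins_self e

/-- The edge `e` joins the leaf `u` to `a`, and is the only edge at `u`. -/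
structure IsLeaf (G : DiscreteGraph V E) (u : V) (e : E) (a : V) : Prop where
  joins : G.Joins e u a
  ne : a ≠ u
  only : ∀ e', G.o e' = u ∨ G.t e' = u → e' = e

theorem exists_isLeaf [Fintype V] [Fintype E] [DecidableEq V] {u : V} (hu : u ∈ G.boundary) :
    ∃ e a, G.IsLeaf u e a := by
  classical
  have hd : G.degree u = 1 := (Finset.mem_filter.1 hu).2
  unfold degree at hd
  rcases Nat.add_eq_one_iff.1 hd with ⟨h0, h1⟩ | ⟨h1, h0⟩
  · obtain ⟨e, he⟩ := Finset.card_eq_one.1 h1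
    have h0' := Finset.card_eq_zero.1 h0
    have hm : ∀ e', G.t e' = u ↔ e' = e := fun e' => by
      simpa using Finset.ext_iff.1 he e'
    have hn : ∀ e', G.o e' ≠ u := fun e' h => by
      simpa [h] using Finset.ext_iff.1 h0' e'
    exact ⟨e, G.o e, Or.inr ⟨rfl, (hm e).2 rfl⟩, hn e,
      fun e' h => h.elim (fun h => absurd h (hn e')) (hm e').1⟩
  · obtain ⟨e, he⟩ := Finset.card_eq_one.1 h1
    have h0' := Finset.card_eq_zero.1 h0
    have hm : ∀ e', G.o e' = u ↔ e' = e := fun e' => by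
      simpa using Finset.ext_iff.1 he e'
    have hn : ∀ e', G.t e' ≠ u := fun e' h => by
      simpa [h] using Finset.ext_iff.1 h0' e'
    exact ⟨e, G.t e, Or.inl ⟨(hm e).2 rfl, rfl⟩, hn e,
      fun e' h => h.elim (hm e').1 (fun h => absurd h (hn e'))⟩

theorem IsLeaf.eq_of_joins {u a b c : V} {e e' : E} (h : G.IsLeaf u e a) (hj : G.Joins e' b c)
    (hu : b = u ∨ c = u) : e' = e := by
  refine h.only e' ?_
  rcases hj with ⟨rfl, rfl⟩ | ⟨rfl, rfl⟩
  · exact hu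
  · exact hu.symm

theorem Joins.eq_or_eq {e : E} {a b c d : V} (h : G.Joins e a b) (h' : G.Joins e c d) :
    c = a ∧ d = b ∨ c = b ∧ d = a := by
  rcases h with ⟨rfl, rfl⟩ | ⟨rfl, rfl⟩ <;> rcases h' with ⟨rfl, rfl⟩ | ⟨rfl, rfl⟩ <;> simp

theorem Connected.exists_edge (hG : G.Connected) {u v : V} (huv : u ≠ v) :
    ∃ e, G.o e = u ∨ G.t e = u := by
  rcases Relation.ReflTransGen.cases_head (hG.2 u v) with h | ⟨w, ⟨e, he⟩, -⟩
  · exact absurd h huv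
  · rcases he with ⟨h, -⟩ | ⟨-, h⟩
    · exact ⟨e, Or.inl h⟩
    · exact ⟨e, Or.inr h⟩

theorem Connected.exists_edge' (hG : G.Connected) (e : E) (v : V) : ∃ e, G.o e = v ∨ G.t e = v := by
  by_cases h : v = G.o e
  · exact ⟨e, Or.inl h.symm⟩
  · exact hG.exists_edge h

theorem sum_degree [Fintype V] [Fintype E] [DecidableEq V] (G : DiscreteGraph V E) :
    ∑ v, G.degree v = 2 * Fintype.card E := by
  unfold degree
  rw [Finset.sum_add_distrib, two_mul]
  congr 1
  · exact (Finset.card_eq_sum_card_fiberwise (f := G.o) fun _ _ => Finset.mem_univ _).symm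
  · exact (Finset.card_eq_sum_card_fiberwise (f := G.t) fun _ _ => Finset.mem_univ _).symm

theorem one_le_degree [Fintype E] [DecidableEq V] {v : V} (h : ∃ e, G.o e = v ∨ G.t e = v) :
    1 ≤ G.degree v := by
  obtain ⟨e, h | h⟩ := h
  · have : 0 < (Finset.univ.filter fun e => G.o e = v).card :=
      Finset.card_pos.2 ⟨e, by simpa using h⟩
    unfold degree
    omega
  · have : 0 < (Finset.univ.filter fun e => G.t e = v).card :=
      Finset.card_pos.2 ⟨e, by simpa using h⟩
    unfold degree
    omega

theorem two_le_degree [Fintype V] [Fintype E] [DecidableEq V] {v : V}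
    (h : ∃ e, G.o e = v ∨ G.t e = v) (hv : v ∉ G.boundary) : 2 ≤ G.degree v := by
  have h1 := one_le_degree h
  have h2 : G.degree v ≠ 1 := fun h => hv (Finset.mem_filter.2 ⟨Finset.mem_univ v, h⟩)
  omega

/-- The degree sum is `2E`, and every vertex other than a leaf has degree at least two. With exactly
one leaf, parity yields `E ≥ V`, hence a cycle. -/
theorem two_mul_card_le [Fintype V] [Fintype E] [DecidableEq V]
    (hc : ∀ v, ∃ e, G.o e = v ∨ G.t e = v) :
    2 * Fintype.card V ≤ 2 * Fintype.card E + G.boundary.card := by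
  have h : ∀ v ∈ Finset.univ, 2 ≤ G.degree v + if v ∈ G.boundary then 1 else 0 := fun v _ => by
    split_ifs with hv
    · have := one_le_degree (hc v)
      omega
    · exact two_le_degree (hc v) hv
  have h1 := Finset.sum_le_sum h
  rw [Finset.sum_add_distrib, sum_degree, Finset.sum_const, smul_eq_mul, Finset.card_univ,
    Finset.sum_ite_mem, Finset.univ_inter, Finset.sum_const, smul_eq_mul] at h1
  omega

/-- A connected graph with Betti number one and without leaves is a cycle graph. -/
theorem isCycleGraph_of_boundary_eq_empty [Fintype V] [Fintype E] [DecidableEq V]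
    (hG : G.Connected) (hc : ∀ v, ∃ e, G.o e = v ∨ G.t e = v)
    (hE : Fintype.card E = Fintype.card V) (hb : G.boundary = ∅) : G.IsCycleGraph := by
  refine ⟨hG, fun v => ?_⟩
  have h : ∀ v ∈ Finset.univ, 2 ≤ G.degree v := fun v _ =>
    two_le_degree (hc v) (by rw [hb]; exact Finset.notMem_empty v)
  have h1 : ∑ v : V, 2 = ∑ v, G.degree v := by
    rw [sum_degree, hE, Finset.sum_const, smul_eq_mul, Finset.card_univ, mul_comm]
  exact ((Finset.sum_eq_sum_iff_of_le h).1 h1 v (Finset.mem_univ v)).symm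

end DiscreteGraph

/-- Used to push a connecting path off the leaves: a leaf is mapped to its neighbour, which
contracts its edge and fixes all others. -/
theorem reflTransGen_of_retraction {α : Type*} {R P : α → α → Prop} {r : α → α}
    (hstep : ∀ b c, R b c → r b = r c ∨ P (r b) (r c)) {u v : α}
    (h : Relation.ReflTransGen R u v) : Relation.ReflTransGen P (r u) (r v) := by
  induction h with
  | refl => exact Relation.ReflTransGen.refl
  | @tail b c _ hbc ih =>
    rcases hstep b c hbc with h | h
    · rwa [← h]
    · exact ih.tail h

/-! ### Configurations from leaves and from edges outside a spanning set. -/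

namespace DiscreteGraph

variable {V E : Type*} {G : DiscreteGraph V E}

theorem IsLeaf.isConfig_of_isLeaf {u₁ a₁ u₂ a₂ : V} {e₁ e₂ : E} (hG : G.Connected)
    (h₁ : G.IsLeaf u₁ e₁ a₁) (h₂ : G.IsLeaf u₂ e₂ a₂) (hu : u₁ ≠ u₂) (he : e₁ ≠ e₂) :
    IsConfig G {v | v ≠ u₁ ∧ v ≠ u₂} e₁ e₂ u₁ a₁ u₂ a₂ 1 1 := by
  classical
  have ha₁ : a₁ ≠ u₂ := fun h => he (h₂.eq_of_joins h₁.joins (Or.inr h))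
  have ha₂ : a₂ ≠ u₁ := fun h => he (h₁.eq_of_joins h₂.joins (Or.inr h)).symm
  refine ⟨he, h₁.joins, h₂.joins, ⟨h₁.ne, ha₁⟩, ⟨ha₂, h₂.ne⟩, Or.inl ⟨rfl, fun h => h.1 rfl⟩,
    Or.inl ⟨rfl, fun h => h.2 rfl⟩, le_rfl, fun _ => hu, fun v => ?_, fun e h1 h2 => ?_,
    fun v hv => ?_⟩
  · by_cases h1 : v = u₁
    · exact Or.inr (Or.inl h1)
    by_cases h2 : v = u₂
    · exact Or.inr (Or.inr h2)
    · exact Or.inl ⟨h1, h2⟩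
  · exact ⟨⟨fun h => h1 (h₁.only e (Or.inl h)), fun h => h2 (h₂.only e (Or.inl h))⟩,
      fun h => h1 (h₁.only e (Or.inr h)), fun h => h2 (h₂.only e (Or.inr h))⟩
  · set r : V → V := fun v => if v = u₁ then a₁ else if v = u₂ then a₂ else v
    have r1 : r u₁ = a₁ := by simp [r]
    have r2 : r u₂ = a₂ := by simp [r, hu.symm]
    have r3 : ∀ v, v ≠ u₁ → v ≠ u₂ → r v = v := fun v h1 h2 => by simp [r, h1, h2]
    have hstep : ∀ b c, (∃ e, G.Joins e b c) →
        r b = r c ∨ ∃ e, (e ≠ e₁ ∧ e ≠ e₂) ∧ G.Joins e (r b) (r c) := by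
      rintro b c ⟨e, hj⟩
      by_cases h1 : e = e₁
      · subst h1
        left
        rcases h₁.joins.eq_or_eq hj with ⟨rfl, rfl⟩ | ⟨rfl, rfl⟩ <;> rw [r1, r3 _ h₁.ne ha₁]
      by_cases h2 : e = e₂
      · subst h2
        left
        rcases h₂.joins.eq_or_eq hj with ⟨rfl, rfl⟩ | ⟨rfl, rfl⟩ <;> rw [r2, r3 _ ha₂ h₂.ne]
      · right
        rw [r3 b (fun h => h1 (h₁.eq_of_joins hj (Or.inl h)))
          (fun h => h2 (h₂.eq_of_joins hj (Or.inl h))),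
          r3 c (fun h => h1 (h₁.eq_of_joins hj (Or.inr h)))
          (fun h => h2 (h₂.eq_of_joins hj (Or.inr h)))]
        exact ⟨e, ⟨h1, h2⟩, hj⟩
    have := reflTransGen_of_retraction
      (P := fun a b => ∃ e, (e ≠ e₁ ∧ e ≠ e₂) ∧ G.Joins e a b) hstep (hG.2 a₁ v)
    rwa [r3 _ hv.1 hv.2, r3 _ h₁.ne ha₁] at this

theorem IsLeaf.isConfig_of_notMem {u a : V} {e₁ e₂ : E} {T : Finset E} (h : G.IsLeaf u e₁ a)
    (hT : ∀ u v, G.JoinedBy T u v) (he : e₂ ∉ T) :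
    IsConfig G {v | v ≠ u} e₁ e₂ u a (G.o e₂) (G.t e₂) 1 2 := by
  classical
  -- The set `T` connects `u` to `a`, and `e₁` is the only edge at `u`; so `e₂`, being outside `T`,
  -- differs from `e₁` and misses `u`.
  have he₁ : e₁ ∈ T := by
    rcases Relation.ReflTransGen.cases_head (hT u a) with h' | ⟨w, ⟨e, heT, hj⟩, -⟩
    · exact absurd h'.symm h.ne
    · exact h.eq_of_joins hj (Or.inl rfl) ▸ heT
  have hne : e₁ ≠ e₂ := fun h' => he (h' ▸ he₁)
  have ho : G.o e₂ ≠ u := fun h' => hne (h.only e₂ (Or.inl h')).symm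
  have ht : G.t e₂ ≠ u := fun h' => hne (h.only e₂ (Or.inr h')).symm
  refine ⟨hne, h.joins, G.joins_self e₂, h.ne, ht, Or.inl ⟨rfl, fun h => h rfl⟩, Or.inr ⟨rfl, ho⟩,
    by norm_num, fun _ => ho.symm, fun v => ?_, fun e h1 _ => ?_, fun v hv => ?_⟩
  · by_cases h1 : v = u
    · exact Or.inr (Or.inl h1)
    · exact Or.inl h1
  · exact ⟨fun h' => h1 (h.only e (Or.inl h')), fun h' => h1 (h.only e (Or.inr h'))⟩
  · set r : V → V := fun v => if v = u then a else v
    have r1 : r u = a := by simp [r]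
    have r3 : ∀ v, v ≠ u → r v = v := fun v h1 => by simp [r, h1]
    have hstep : ∀ b c, (∃ e ∈ T, G.Joins e b c) →
        r b = r c ∨ ∃ e, (e ≠ e₁ ∧ e ≠ e₂) ∧ G.Joins e (r b) (r c) := by
      rintro b c ⟨e, heT, hj⟩
      by_cases h1 : e = e₁
      · subst h1
        left
        rcases h.joins.eq_or_eq hj with ⟨rfl, rfl⟩ | ⟨rfl, rfl⟩ <;> rw [r1, r3 _ h.ne]
      · right
        rw [r3 b (fun h' => h1 (h.eq_of_joins hj (Or.inl h'))),
          r3 c (fun h' => h1 (h.eq_of_joins hj (Or.inr h')))]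
        exact ⟨e, ⟨h1, fun h' => he (h' ▸ heT)⟩, hj⟩
    have := reflTransGen_of_retraction
      (P := fun a b => ∃ e, (e ≠ e₁ ∧ e ≠ e₂) ∧ G.Joins e a b) hstep (hT a v)
    rwa [r3 _ hv, r3 _ h.ne] at this

theorem isConfig_of_notMem {e₁ e₂ : E} {T : Finset E} (hT : ∀ u v, G.JoinedBy T u v)
    (h₁ : e₁ ∉ T) (h₂ : e₂ ∉ T) (hne : e₁ ≠ e₂) :
    IsConfig G Set.univ e₁ e₂ (G.o e₁) (G.t e₁) (G.o e₂) (G.t e₂) 2 2 := by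
  refine ⟨hne, G.joins_self e₁, G.joins_self e₂, mem_univ _, mem_univ _, Or.inr ⟨rfl, mem_univ _⟩,
    Or.inr ⟨rfl, mem_univ _⟩, le_rfl, fun h => absurd (mem_univ _) h, fun v => Or.inl (mem_univ _),
    fun _ _ _ => ⟨mem_univ _, mem_univ _⟩, fun v _ => ?_⟩
  exact reflTransGen_of_retraction (r := id)
    (fun b c ⟨e, he, hj⟩ => Or.inr ⟨e, ⟨fun h => h₁ (h ▸ he), fun h => h₂ (h ▸ he)⟩, hj⟩) (hT _ v)

theorem exists_notMem_of_betti [Fintype V] [Fintype E] {T : Finset E}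
    (hT : T.card + 1 ≤ Fintype.card V) (hb : 1 ≤ G.betti) : ∃ e, e ∉ T := by
  classical
  unfold betti at hb
  have h1 : 0 < Tᶜ.card := by
    rw [Finset.card_compl]
    omega
  obtain ⟨e, he⟩ := Finset.card_pos.1 h1
  exact ⟨e, Finset.mem_compl.1 he⟩

theorem exists_two_notMem_of_betti [Fintype V] [Fintype E] {T : Finset E}
    (hT : T.card + 1 ≤ Fintype.card V) (hb : 2 ≤ G.betti) : ∃ e₁ e₂, e₁ ∉ T ∧ e₂ ∉ T ∧ e₁ ≠ e₂ := by
  classical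
  unfold betti at hb
  have h1 : 1 < Tᶜ.card := by
    rw [Finset.card_compl]
    omega
  obtain ⟨e₁, h₁, e₂, h₂, hne⟩ := Finset.one_lt_card.1 h1
  exact ⟨e₁, e₂, Finset.mem_compl.1 h₁, Finset.mem_compl.1 h₂, hne⟩

end DiscreteGraph

/-! ### Locating the extrema in the four cases. -/

namespace MetricGraph

variable {V E : Type*} {G : DiscreteGraph V E}

theorem TakesMaxOnlyIn.mono {Γ : MetricGraph G} {ψ : Γ.Point → ℝ} {S S' : Set Γ.Point}
    (h : Γ.TakesMaxOnlyIn ψ S) (hS : S ⊆ S') : Γ.TakesMaxOnlyIn ψ S' :=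
  ⟨h.1, h.2.trans hS⟩

theorem TakesMaxOnlyIn.pos_smul {Γ : MetricGraph G} {ψ : Γ.Point → ℝ} {S : Set Γ.Point}
    (h : Γ.TakesMaxOnlyIn ψ S) {c : ℝ} (hc : 0 < c) : Γ.TakesMaxOnlyIn (c • ψ) S := by
  have : {p | ∀ q, (c • ψ) q ≤ (c • ψ) p} = {p | ∀ q, ψ q ≤ ψ p} := by
    ext p
    simp [hc]
  unfold TakesMaxOnlyIn
  rw [this]
  exact h

theorem takesMinOnlyIn_iff {Γ : MetricGraph G} {ψ : Γ.Point → ℝ} {S : Set Γ.Point} :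
    Γ.TakesMinOnlyIn ψ S ↔ Γ.TakesMaxOnlyIn (-ψ) S := by
  simp [TakesMinOnlyIn, TakesMaxOnlyIn]

/-- There is a metric graph for which `μ₂ = 1` is simple with an eigenfunction which takes its
maximum only in `S` and its minimum only in `S'`. -/
def ExtremaIn [Fintype E] [DecidableEq V] (G : DiscreteGraph V E)
    (S S' : ∀ Γ : MetricGraph G, Set Γ.Point) : Prop :=
  ∃ Γ : MetricGraph G, Γ.IsMu2 1 ∧ Γ.IsSimpleEigenvalue 1 ∧ ∃ ψ ∈ Γ.eigenspace 1, ψ ≠ 0 ∧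
    Γ.TakesMaxOnlyIn ψ (S Γ) ∧ Γ.TakesMaxOnlyIn (-ψ) (S' Γ)

theorem ExtremaIn.exists_max [Fintype E] [DecidableEq V]
    {S S' : ∀ Γ : MetricGraph G, Set Γ.Point} (h : ExtremaIn G S S') :
    ∃ (Γ : MetricGraph G) (μ : ℝ), Γ.IsMu2 μ ∧ Γ.IsSimpleEigenvalue μ ∧
      ∃ ψ ∈ Γ.eigenspace μ, ψ ≠ 0 ∧ Γ.TakesMaxOnlyIn ψ (S Γ) := by
  obtain ⟨Γ, h1, h2, ψ, h3, h4, h5, -⟩ := h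
  exact ⟨Γ, 1, h1, h2, ψ, h3, h4, h5⟩

theorem ExtremaIn.swap [Fintype E] [DecidableEq V]
    {S S' : ∀ Γ : MetricGraph G, Set Γ.Point} (h : ExtremaIn G S S') : ExtremaIn G S' S := by
  obtain ⟨Γ, h1, h2, ψ, h3, h4, h5, h6⟩ := h
  exact ⟨Γ, h1, h2, -ψ, neg_mem h3, neg_ne_zero.2 h4, h6, by rwa [neg_neg]⟩

/-- By simplicity every eigenfunction is a multiple of the given one; a negative factor exchanges
maximum and minimum, which is harmless as both lie in the same kind of set. -/
theorem ExtremaIn.forall_extrema [Fintype E] [DecidableEq V]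
    {S : ∀ Γ : MetricGraph G, Set Γ.Point} (h : ExtremaIn G S S) :
    ∃ (Γ : MetricGraph G) (μ : ℝ), Γ.IsMu2 μ ∧ Γ.IsSimpleEigenvalue μ ∧
      ∀ ψ ∈ Γ.eigenspace μ, ψ ≠ 0 → Γ.TakesMaxOnlyIn ψ (S Γ) ∧ Γ.TakesMinOnlyIn ψ (S Γ) := by
  obtain ⟨Γ, h1, h2, ψ, h3, h4, h5, h6⟩ := h
  refine ⟨Γ, 1, h1, h2, fun f hf hf0 => ?_⟩
  have hψ' : (⟨ψ, h3⟩ : Γ.eigenspace 1) ≠ 0 := fun h => h4 (congrArg Subtype.val h)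
  obtain ⟨c, hc⟩ := (finrank_eq_one_iff_of_nonzero' _ hψ').1 h2 ⟨f, hf⟩
  have hcf : c • ψ = f := congrArg Subtype.val hc
  rw [takesMinOnlyIn_iff]
  rcases lt_trichotomy c 0 with h | h | h
  · have e : f = (-c) • (-ψ) := by rw [← hcf, neg_smul_neg]
    have e' : -f = (-c) • ψ := by rw [← hcf, neg_smul]
    rw [e', e]
    exact ⟨h6.pos_smul (neg_pos.2 h), h5.pos_smul (neg_pos.2 h)⟩
  · exact absurd (by rw [← hcf, h, zero_smul]) hf0
  · have e' : -f = c • (-ψ) := by rw [← hcf, smul_neg]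
    rw [e', ← hcf]
    exact ⟨h5.pos_smul h, h6.pos_smul h⟩

theorem tipSet_subset_boundary [Fintype V] [Fintype E] [DecidableEq V] (Γ : MetricGraph G) {e : E}
    {u : V} (hu : u ∈ G.boundary) : IsConfig.tipSet Γ e u 1 ⊆ Γ.boundary := by
  rintro p (⟨-, rfl⟩ | ⟨h, -⟩)
  · exact ⟨u, hu, rfl⟩
  · norm_num at h

theorem tipSet_subset_doublyConnectedPart (Γ : MetricGraph G) {e : E} {u : V} (he : G.InCycle e) :
    IsConfig.tipSet Γ e u 2 ⊆ Γ.doublyConnectedPart := by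
  rintro p (⟨h, -⟩ | ⟨-, h⟩)
  · norm_num at h
  · exact ⟨e, he, h⟩

/-- The graph with a single edge, which has length `π`. -/
theorem extremaIn_boundary_of_single_edge [Fintype V] [Fintype E] [DecidableEq V] {e : E}
    (he : ∀ e', e' = e) (hc : ∀ v, v = G.o e ∨ v = G.t e) (hne : G.o e ≠ G.t e)
    (ho : G.o e ∈ G.boundary) (ht : G.t e ∈ G.boundary) :
    ExtremaIn G (fun Γ => Γ.boundary) fun Γ => Γ.boundary := by
  have hpi := Real.pi_pos
  obtain ⟨Γ, hΓ⟩ : ∃ Γ : MetricGraph G, ∀ e, Γ.len e = Real.pi :=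
    ⟨⟨fun _ => Real.pi, fun _ => hpi⟩, fun _ => rfl⟩
  obtain ⟨x, hxo, hxt⟩ : ∃ x : V → ℝ, x (G.o e) = 1 ∧ x (G.t e) = -1 :=
    ⟨fun v => if v = G.o e then 1 else -1, by simp, by simp [hne.symm]⟩
  have hcov : ∀ v, ∃ e, G.o e = v ∨ G.t e = v := fun v =>
    ⟨e, (hc v).imp Eq.symm Eq.symm⟩
  obtain ⟨ψ, hψ⟩ : ∃ ψ, ψ = Γ.ofEdges x fun _ => Real.cos := ⟨_, rfl⟩
  have m0 : ∀ e', Real.cos 0 = x (G.o e') := fun e' => by rw [he e', hxo, Real.cos_zero]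
  have m1 : ∀ e', Real.cos (Γ.len e') = x (G.t e') := fun e' => by
    rw [he e', hΓ, hxt, Real.cos_pi]
  have hmem : ψ ∈ Γ.eigenspace 1 := by
    rw [hψ]
    refine ofEdges_mem_eigenspace (φ' := fun _ y => -Real.sin y)
      (fun _ y => Real.hasDerivAt_cos y) (fun _ y => (Real.hasDerivAt_sin y).neg) m0 m1 fun v => ?_
    simp [vertexSum, hΓ]
  have hval : ∀ y ∈ Icc 0 Real.pi, ψ (Γ.edgePoint e y) = Real.cos y := fun y hy => by
    have := onEdge_ofEdges (Γ := Γ) (φ := fun _ => Real.cos) (m0 e) (m1 e)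
      (y := y) (by rwa [hΓ])
    rw [hψ]
    exact this
  have hpt : ∀ p : Γ.Point, ∃ y ∈ Icc 0 Real.pi, p = Γ.edgePoint e y := fun p => by
    obtain ⟨e', y, hy, rfl⟩ := Γ.exists_edgePoint hcov p
    rw [hΓ] at hy
    exact ⟨y, hy, by rw [he e']⟩
  have v0 : Γ.edgePoint e 0 = .vertex (G.o e) := Γ.edgePoint_zero e
  have v1 : Γ.edgePoint e Real.pi = .vertex (G.t e) := by rw [← hΓ e, Γ.edgePoint_len]
  have z0 : (0 : ℝ) ∈ Icc 0 Real.pi := ⟨le_rfl, hpi.le⟩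
  have z1 : Real.pi ∈ Icc 0 Real.pi := ⟨hpi.le, le_rfl⟩
  have hψ0 : ψ ≠ 0 := fun h => by
    have := hval 0 z0
    rw [h, Real.cos_zero] at this
    simp at this
  have hip : ∀ F H : E → ℝ → ℝ, Γ.ip F H = ∫ y in (0 : ℝ)..Real.pi, F e y * H e y := fun F H => by
    rw [ip, Finset.sum_eq_single e (fun e' _ h => absurd (he e') h) (by simp), hΓ]
  -- Zeros at `π/3` and `2π/3` leave three pieces of length `π/3 < 3π/8`, the outer two with a free
  -- end.
  have hco : ∀ g q, Γ.IsC1 g q → g (Γ.edgePoint e (Real.pi / 3)) = 0 →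
      g (Γ.edgePoint e (2 * Real.pi / 3)) = 0 →
      21 / 100 * Γ.ip (Γ.onEdge g) (Γ.onEdge g) ≤
        Γ.ip q q - Γ.ip (Γ.onEdge g) (Γ.onEdge g) := by
    intro g q hgq h1 h2
    obtain ⟨hg, hq, hd⟩ := hgq e
    rw [hΓ] at hg hq hd
    have g1 : Γ.onEdge g e (Real.pi / 3) = 0 := h1
    have g2 : Γ.onEdge g e (2 * Real.pi / 3) = 0 := h2
    have sub : ∀ {a b : ℝ}, 0 ≤ a → b ≤ Real.pi → Icc a b ⊆ Icc 0 Real.pi := fun ha hb =>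
      Icc_subset_Icc ha hb
    have A := jacobi_le_left (a := 0) (b := Real.pi / 3) (by linarith)
      (hg.mono (sub le_rfl (by linarith))) (hq.mono (sub le_rfl (by linarith)))
      (fun x hx => hd x ⟨hx.1, by linarith [hx.2]⟩) (by linarith)
    have B := jacobi_le (a := Real.pi / 3) (b := 2 * Real.pi / 3) (θ := Real.pi / 2) (by linarith)
      (hg.mono (sub (by linarith) (by linarith))) (hq.mono (sub (by linarith) (by linarith)))
      (fun x hx => hd x ⟨by linarith [hx.1], by linarith [hx.2]⟩) (by linarith) (by linarith)
    have C := jacobi_le_right (a := 2 * Real.pi / 3) (b := Real.pi) (by linarith)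
      (hg.mono (sub (by linarith) le_rfl)) (hq.mono (sub (by linarith) le_rfl))
      (fun x hx => hd x ⟨by linarith [hx.1], hx.2⟩) (by linarith)
    have ii : ∀ {F : ℝ → ℝ}, ContinuousOn F (Icc 0 Real.pi) →
        (∫ y in (0 : ℝ)..Real.pi, F y) = (∫ y in (0 : ℝ)..(Real.pi / 3), F y) +
          (∫ y in (Real.pi / 3)..(2 * Real.pi / 3), F y) +
          ∫ y in (2 * Real.pi / 3)..Real.pi, F y := by
      intro F hF
      have hi : ∀ {a b : ℝ}, 0 ≤ a → a ≤ b → b ≤ Real.pi → IntervalIntegrable F volume a b :=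
        fun ha hab hb => ContinuousOn.intervalIntegrable
          (by rw [uIcc_of_le hab]; exact hF.mono (sub ha hb))
      rw [intervalIntegral.integral_add_adjacent_intervals
        (hi le_rfl (by linarith) (by linarith)) (hi (by linarith) (by linarith) (by linarith)),
        intervalIntegral.integral_add_adjacent_intervals
        (hi le_rfl (by linarith) (by linarith)) (hi (by linarith) (by linarith) le_rfl)]
    have i1 := ii (hg.mul hg)
    have i2 := ii (hq.mul hq)
    simp only [Pi.mul_apply] at i1 i2
    have hk2 : kFac ^ 2 = 121 / 100 := by norm_num [kFac]
    rw [g1, hk2] at A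
    rw [g1, g2, hk2] at B
    rw [g2, hk2] at C
    rw [hip, hip, i1, i2]
    linarith
  obtain ⟨hmu, hsimple⟩ := isMu2_and_isSimple_of_coercive hcov (by norm_num) hco hmem hψ0
  refine ⟨Γ, hmu, hsimple, ψ, hmem, hψ0, ⟨⟨Γ.edgePoint e 0, fun q => ?_⟩, fun p hp => ?_⟩,
    ⟨⟨Γ.edgePoint e Real.pi, fun q => ?_⟩, fun p hp => ?_⟩⟩
  · obtain ⟨y, hy, rfl⟩ := hpt q
    rw [hval y hy, hval 0 z0, Real.cos_zero]
    exact Real.cos_le_one y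
  · obtain ⟨y, hy, rfl⟩ := hpt p
    have h1 := hp (Γ.edgePoint e 0)
    rw [hval y hy, hval 0 z0, Real.cos_zero] at h1
    have h2 : y = 0 := Real.injOn_cos hy z0 (by
      rw [Real.cos_zero]
      exact le_antisymm (Real.cos_le_one y) h1)
    rw [h2, v0]
    exact ⟨_, ho, rfl⟩
  · obtain ⟨y, hy, rfl⟩ := hpt q
    rw [Pi.neg_apply, Pi.neg_apply, hval y hy, hval _ z1, Real.cos_pi]
    linarith [Real.neg_one_le_cos y]
  · obtain ⟨y, hy, rfl⟩ := hpt p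
    have h1 := hp (Γ.edgePoint e Real.pi)
    rw [Pi.neg_apply, Pi.neg_apply, hval y hy, hval _ z1, Real.cos_pi] at h1
    have h2 : y = Real.pi := Real.injOn_cos hy z1 (by
      rw [Real.cos_pi]
      exact le_antisymm (by linarith) (Real.neg_one_le_cos y))
    rw [h2, v1]
    exact ⟨_, ht, rfl⟩

/-- Two leaves on different edges form a configuration. If they share their edge, connectedness
makes it the whole graph, so that no vertex is left for `S`. -/
theorem extremaIn_boundary [Fintype V] [Fintype E] [DecidableEq V] (hG : G.Connected)
    (h : 2 ≤ G.boundary.card) : ExtremaIn G (fun Γ => Γ.boundary) fun Γ => Γ.boundary := by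
  obtain ⟨u₁, hu₁, u₂, hu₂, hu⟩ := Finset.one_lt_card.1 h
  obtain ⟨e₁, a₁, h₁⟩ := DiscreteGraph.exists_isLeaf hu₁
  obtain ⟨e₂, a₂, h₂⟩ := DiscreteGraph.exists_isLeaf hu₂
  by_cases he : e₁ = e₂
  · subst he
    have hj : G.Joins e₁ u₁ u₂ := by
      rcases h₁.joins.eq_or_eq h₂.joins with ⟨h, -⟩ | ⟨h, -⟩
      · exact absurd h.symm hu
      · rw [h]; exact h₁.joins
    have hV : ∀ v, v = u₁ ∨ v = u₂ := by
      intro v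
      have hr := hG.2 u₁ v
      induction hr with
      | refl => exact Or.inl rfl
      | @tail b c _ hbc ih =>
        obtain ⟨e, he⟩ := hbc
        have : e = e₁ := ih.elim (fun h => h₁.eq_of_joins he (Or.inl h))
          fun h => h₂.eq_of_joins he (Or.inl h)
        subst this
        rcases hj.eq_or_eq he with ⟨-, h⟩ | ⟨-, h⟩
        · exact Or.inr h
        · exact Or.inl h
    have hE : ∀ e', e' = e₁ := fun e' => (hV (G.o e')).elim
      (fun h => h₁.only e' (Or.inl h)) fun h => h₂.only e' (Or.inl h)
    rcases hj with ⟨ho, ht⟩ | ⟨ho, ht⟩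
    · exact extremaIn_boundary_of_single_edge hE (by rwa [ho, ht]) (by rwa [ho, ht])
        (by rwa [ho]) (by rwa [ht])
    · exact extremaIn_boundary_of_single_edge hE (by rw [ho, ht]; exact fun v => (hV v).symm)
        (by rw [ho, ht]; exact hu.symm) (by rwa [ho]) (by rwa [ht])
  · obtain ⟨Γ, h1, h2, ψ, h3, h4, h5, h6⟩ :=
      (h₁.isConfig_of_isLeaf hG h₂ hu he).exists_metricGraph (hG.exists_edge' e₁)
    exact ⟨Γ, h1, h2, ψ, h3, h4, h5.mono (tipSet_subset_boundary Γ hu₂),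
      h6.mono (tipSet_subset_boundary Γ hu₁)⟩

/-- The condition `n₁ ≤ n₂` puts the leaf on the first edge, where the minimum is, and the cycle
edge second. -/
theorem extremaIn_doublyConnectedPart_boundary [Fintype V] [Fintype E] [DecidableEq V]
    (hG : G.Connected) (h : 1 ≤ G.boundary.card) (hb : 1 ≤ G.betti) :
    ExtremaIn G (fun Γ => Γ.doublyConnectedPart) fun Γ => Γ.boundary := by
  obtain ⟨u, hu⟩ := Finset.card_pos.1 h
  obtain ⟨e₁, a, h₁⟩ := DiscreteGraph.exists_isLeaf hu
  obtain ⟨T, hT, hTj⟩ := hG.exists_spanning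
  obtain ⟨e₂, he₂⟩ := DiscreteGraph.exists_notMem_of_betti hT hb
  obtain ⟨Γ, h1, h2, ψ, h3, h4, h5, h6⟩ :=
    (h₁.isConfig_of_notMem hTj he₂).exists_metricGraph (hG.exists_edge' e₁)
  exact ⟨Γ, h1, h2, ψ, h3, h4, h5.mono (tipSet_subset_doublyConnectedPart Γ
    (DiscreteGraph.inCycle_of_joinedBy he₂ (hTj _ _))), h6.mono (tipSet_subset_boundary Γ hu)⟩

theorem extremaIn_doublyConnectedPart [Fintype V] [Fintype E] [DecidableEq V]
    (hG : G.Connected) (hb : 2 ≤ G.betti) :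
    ExtremaIn G (fun Γ => Γ.doublyConnectedPart) fun Γ => Γ.doublyConnectedPart := by
  obtain ⟨T, hT, hTj⟩ := hG.exists_spanning
  obtain ⟨e₁, e₂, he₁, he₂, hne⟩ := DiscreteGraph.exists_two_notMem_of_betti hT hb
  obtain ⟨Γ, h1, h2, ψ, h3, h4, h5, h6⟩ :=
    (DiscreteGraph.isConfig_of_notMem hTj he₁ he₂ hne).exists_metricGraph (hG.exists_edge' e₁)
  exact ⟨Γ, h1, h2, ψ, h3, h4, h5.mono (tipSet_subset_doublyConnectedPart Γ
    (DiscreteGraph.inCycle_of_joinedBy he₂ (hTj _ _))), h6.mono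
    (tipSet_subset_doublyConnectedPart Γ (DiscreteGraph.inCycle_of_joinedBy he₁ (hTj _ _)))⟩

end MetricGraph

theorem theorem4p9 {V E : Type*} [Fintype V] [DecidableEq V] [Fintype E]
    (G : DiscreteGraph V E) (hG : G.Connected) :
    (1 ≤ G.boundary.card → ∃ (Γ : MetricGraph G) (μ : ℝ), Γ.IsMu2 μ ∧ Γ.IsSimpleEigenvalue μ ∧
      ∃ ψ ∈ Γ.eigenspace μ, ψ ≠ 0 ∧ Γ.TakesMaxOnlyIn ψ Γ.boundary) ∧
    (2 ≤ G.boundary.card → ∃ (Γ : MetricGraph G) (μ : ℝ), Γ.IsMu2 μ ∧ Γ.IsSimpleEigenvalue μ ∧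
      ∀ ψ ∈ Γ.eigenspace μ, ψ ≠ 0 →
        Γ.TakesMaxOnlyIn ψ Γ.boundary ∧ Γ.TakesMinOnlyIn ψ Γ.boundary) ∧
    (1 ≤ G.betti → ¬ G.IsCycleGraph →
      ∃ (Γ : MetricGraph G) (μ : ℝ), Γ.IsMu2 μ ∧ Γ.IsSimpleEigenvalue μ ∧
        ∃ ψ ∈ Γ.eigenspace μ, ψ ≠ 0 ∧ Γ.TakesMaxOnlyIn ψ Γ.doublyConnectedPart) ∧
    (2 ≤ G.betti → ∃ (Γ : MetricGraph G) (μ : ℝ), Γ.IsMu2 μ ∧ Γ.IsSimpleEigenvalue μ ∧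
      ∀ ψ ∈ Γ.eigenspace μ, ψ ≠ 0 →
        Γ.TakesMaxOnlyIn ψ Γ.doublyConnectedPart ∧
          Γ.TakesMinOnlyIn ψ Γ.doublyConnectedPart) := by
  refine ⟨fun h => ?_, fun h => (MetricGraph.extremaIn_boundary hG h).forall_extrema,
    fun h hcyc => ?_, fun h => (MetricGraph.extremaIn_doublyConnectedPart hG h).forall_extrema⟩
  · rcases h.lt_or_eq with h2 | h1
    · exact (MetricGraph.extremaIn_boundary hG h2).exists_max
    -- With a single leaf the degree count forces a cycle; the sign of the eigenfunction is switched
    -- to put the maximum at the leaf.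
    · obtain ⟨u, hu⟩ := Finset.card_pos.1 h
      obtain ⟨e, -, -⟩ := DiscreteGraph.exists_isLeaf hu
      have := DiscreteGraph.two_mul_card_le (hG.exists_edge' e)
      refine (MetricGraph.extremaIn_doublyConnectedPart_boundary hG h ?_).swap.exists_max
      unfold DiscreteGraph.betti
      omega
  · rcases h.lt_or_eq with h2 | h1
    · exact (MetricGraph.extremaIn_doublyConnectedPart hG h2).exists_max
    -- With Betti number one there must be a leaf, since otherwise all degrees are two and the graph
    -- is a cycle graph.
    · refine (MetricGraph.extremaIn_doublyConnectedPart_boundary hG ?_ h).exists_max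
      rw [Nat.one_le_iff_ne_zero, Ne, Finset.card_eq_zero]
      intro hb
      obtain ⟨v⟩ := hG.1
      unfold DiscreteGraph.betti at h1
      have hV : 0 < Fintype.card V := Fintype.card_pos_iff.2 ⟨v⟩
      have hE : Fintype.card E = Fintype.card V := by omega
      obtain ⟨e⟩ := Fintype.card_pos_iff.1 (hE ▸ hV)
      exact hcyc (DiscreteGraph.isCycleGraph_of_boundary_eq_empty hG (hG.exists_edge' e) hE hb)
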